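/- Let $k$ be a field of characteristic $0$ and $V$ a $k$-vector space with a basis $E$, where either (a) $E=\{e_n\}_{n\ge 1}$; or (b) $V$ carries a non-degenerate symmetric or skew-symmetric bilinear form $w:V\times V\to k$ and $E$ is a $w$-isotropic basis, i.e. $E=\{e_n,e^n\}_{n\ge1}$, together with one further vector $e_0=e^0$ in type $B$ ($w$ symmetric), with $w(e_i,e_j)=w(e^i,e^j)=0$ and $w(e_i,e^j)=\delta_{ij}$ (in type $B$: $w(e_0,e_0)=1$ and $e_0$ is orthogonal to all other elements of $E$). In case (a) "basis" means any basis of $V$, in case (b) only $w$-isotropic bases are considered. Put $E_n=\{e_i\}_{i\le n}$, resp. $E_n=\{e_i,e^i\}_{i\le n}$, and $V_n=\operatorname{Span}E_n$. A generalized flag in $V$ is a chain $\mathcal F$ of subspaces such that each $F\in\mathcal F$ has an immediate successor or an immediate predecessor in $\mathcal F$, and $V\setminus\{0\}$ is the union of the sets $F''\setminus F'$ over all pairs of consecutive members $F'\subset F''$ of $\mathcal F$. For $0\ne v\in V$ write $F'_v\subset F''_v$ for the pair with $v\in F''_v\setminus F'_v$. $\mathcal F$ is $w$-isotropic if it has an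 involution $\tau$ such that, for every $F'\in\mathcal F$ with an immediate successor, $\tau(F')=(F')^\perp$, and $(F')^\perp$ has an immediate predecessor in $\mathcal F$. $\mathcal F$ is compatible with a basis $L$ if there is a strict weak order $\prec$ on $L$ with $F'_l=\operatorname{Span}\{m\in L: m\prec l\}$ for all $l\in L$, and $\mathcal F$ is the generalized flag which defines the same partition of $V$ as the chain $\{F'_l\}_{l\in L}$ (vectors being in the same part if they lie in the same members of the chain). It is weakly compatible with $E$ if it is compatible with a basis $L$ such that $E\setminus(E\cap L)$ is finite. $\mathcal F$ and $\mathcal G$ are $E$-commensurable if both are weakly compatible with $E$ and there are an inclusion-preserving bijection $\varphi:\mathcal F\to\mathcal G$ and a finite-dimensional $U\subset V$ with $F\subset\varphi(F)+U$, $\varphi(F)\subset F+U$ and $\dim(F\cap U)=\dim(\varphi(F)\cap U)$ for all $F\in\mathcal F$. Let $\mathcal F$ be a generalized flag weakly compatible with $E$, $w$-isotropic in case (b), and let $X$ be the set $\mathcal F\ell(\mathcal F,E)$ of all generalized flags $E$-commensurable with $\mathcal F$, resp. the set $\mathcal F\ell(\mathcal F,w,E)$ of all $w$-isotropic ones. Call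 $n$ adapted if $\mathcal F$ is compatible with a basis consisting of $E\setminus E_n$ and a basis of $V_n$. Let $d_n$ be the set of dimensions of the spaces $F\cap V_n$, $F\in\mathcal F$, and let $\mathcal F\ell_n$ be the variety of flags of type $d_n$ in $V_n$ (in case (b): of those flags which are stable under taking orthogonal complements in $V_n$), with its structure of a reduced projective variety over $k$ given by the Plücker embedding. For a flag $H\in\mathcal F\ell_n$ and $F\in\mathcal F$ write $H_F$ for the member of $H$ of dimension $\dim(F\cap V_n)$, and put $$\iota_n(H)=\{\,H_F\oplus\operatorname{Span}(F\cap(E_{n+1}\setminus E_n)) : F\in\mathcal F\,\}.$$ Then adapted integers exist, and for every adapted $n_0$ the following holds. 1. For $n\ge n_0$, $\iota_n$ is a well-defined map $\mathcal F\ell_n\to\mathcal F\ell_{n+1}$ and is given by a closed immersion of algebraic varieties over $k$. 2. For every $\mathcal G\in X$ and all sufficiently large $n$, $\mathcal G_n:=\{G\cap V_n: G\in\mathcal G\}$ belongs to $\mathcal F\ell_n$, and its class $\theta(\mathcal G)$ in the direct limit $\varinjlim_{n\ge n_0}\mathcal F\ell_n$ taken along the maps $\iota_n$ does not depend on $n$.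 The resulting map $\theta:X\to\varinjlim_{n\ge n_0}\mathcal F\ell_n$ is a bijection. 3. Consequently $X$ has the structure of an ind-variety over $k$: it is the union of the increasing subsets $\theta^{-1}(\mathcal F\ell_n)$, $n\ge n_0$, each of which is the set of $k$-points of the variety $\mathcal F\ell_n$ (these points being dense), and the inclusions of these subsets are given by the closed immersions $\iota_n$. -/

import Mathlib

open CategoryTheory AlgebraicGeometry Limits

universe u v

namespace IndFlag

/-! ### Generalized flags -/

section Flags

variable {k : Type u} [Field k] {V : Type v} [AddCommGroup V] [Module k V]

/-- `F''` is the immediate successor of `F'` (and `F'` the immediate predecessor of `F''`)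
in the chain `C`. -/
def ImmSucc (C : Set (Submodule k V)) (F' F'' : Submodule k V) : Prop :=
  F' ∈ C ∧ F'' ∈ C ∧ F' < F'' ∧ ∀ G ∈ C, ¬ (F' < G ∧ G < F'')

/-- Generalized flags in `V`. -/
structure IsGeneralizedFlag (F : Set (Submodule k V)) : Prop where
  chain : IsChain (· ≤ ·) F
  adjacent : ∀ G ∈ F, (∃ G'', ImmSucc F G G'') ∨ (∃ G', ImmSucc F G' G)
  cover : ∀ v : V, v ≠ 0 ↔ ∃ F' F'', ImmSucc F F' F'' ∧ v ∈ F'' ∧ v ∉ F'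

/-- The chains `C` and `D` define the same partition of `V`, where `v`, `w` lie in the same part
for `C` iff they belong to the same members of `C`. -/
def SamePartition (C D : Set (Submodule k V)) : Prop :=
  ∀ v w : V, (∀ F ∈ C, v ∈ F ↔ w ∈ F) ↔ (∀ F ∈ D, v ∈ F ↔ w ∈ F)

/-- `F = fl(C)`: `F` is the generalized flag defining the same partition of `V` as `C`
(there is exactly one for each chain `C`). -/
def IsFl (C F : Set (Submodule k V)) : Prop :=
  IsGeneralizedFlag F ∧ SamePartition C F

/-- `L` is (the set of vectors of) a basis of `V`. -/
def IsBasisSet (k : Type u) [Field k] {V : Type v} [AddCommGroup V] [Module k V]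
    (L : Set V) : Prop :=
  LinearIndepOn k id L ∧ Submodule.span k L = ⊤

/-- `Span {β ∈ L : β ≺ α}`. -/
def spanBelow (k : Type u) [Field k] {V : Type v} [AddCommGroup V] [Module k V]
    {L : Set V} (r : L → L → Prop) (α : L) : Submodule k V :=
  Submodule.span k {x : V | ∃ β : L, r β α ∧ (β : V) = x}

/-- The generalized flag `F` and the basis `L` of `V` are compatible: for some strict weak order
`≺` on `L`, `F'_α = Span {β : β ≺ α}` for all `α ∈ L`, where `F'_α ⊂ F''_α` is the pair of
consecutive members of `F` with `α ∈ F''_α \ F'_α`, and `F = fl({F'_α})`. -/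
def IsCompatible (F : Set (Submodule k V)) (L : Set V) : Prop :=
  ∃ r : L → L → Prop, IsStrictWeakOrder L r ∧
    (∀ α : L, ∃ F'', ImmSucc F (spanBelow k r α) F'' ∧
      (α : V) ∈ F'' ∧ (α : V) ∉ spanBelow k r α) ∧
    IsFl (Set.range (spanBelow k r)) F

/-- Weak compatibility with the basis `E`. The predicate `adm` singles out the bases which
are considered: all bases of `V`, or all `w`-isotropic bases of `V`. -/
def IsWeaklyCompatible (adm : Set V → Prop) (E : Set V) (F : Set (Submodule k V)) : Prop :=
  ∃ L : Set V, adm L ∧ IsCompatible F L ∧ (E \ (E ∩ L)).Finite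

/-- `E`-commensurability of generalized flags. -/
def IsCommensurable (adm : Set V → Prop) (E : Set V) (F G : Set (Submodule k V)) : Prop :=
  IsWeaklyCompatible adm E F ∧ IsWeaklyCompatible adm E G ∧
    ∃ (φ : F ≃o G) (U : Submodule k V), FiniteDimensional k U ∧
      ∀ A : F, (A : Submodule k V) ≤ (φ A : Submodule k V) ⊔ U ∧
        (φ A : Submodule k V) ≤ (A : Submodule k V) ⊔ U ∧
        Module.finrank k ↥((A : Submodule k V) ⊓ U) =
          Module.finrank k ↥((φ A : Submodule k V) ⊓ U)

/-- `Fl(F, E)`: the set of all generalized flags in `V` which are `E`-commensurable with `F`. -/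
def Fl (F : Set (Submodule k V)) (E : Set V) : Set (Set (Submodule k V)) :=
  {G | IsGeneralizedFlag G ∧ IsCommensurable (IsBasisSet k) E F G}

/-! ### Isotropic generalized flags -/

/-- `F` is `w`-isotropic: there is an involution `τ` of `F` which sends every `F' ∈ F` having an
immediate successor to `(F')^⊥`, and `(F')^⊥` has an immediate predecessor in `F`. -/
def IsIsotropic (w : LinearMap.BilinForm k V) (F : Set (Submodule k V)) : Prop :=
  ∃ τ : F → F, Function.Involutive τ ∧
    ∀ A : F, (∃ A'', ImmSucc F A A'') →
      (τ A : Submodule k V) = w.orthogonal A ∧ ∃ B', ImmSucc F B' (τ A)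

/-- The basis `b` consists of the vectors `e_i = b (inl (inl i))`, `e^i = b (inl (inr i))`
(`i ∈ ℕ`) and, if `ε = 1`, one more vector `e_0 = e^0 = b (inr 0)`. It is of type `C` if `w` is
skew-symmetric and `ε = 0`, of type `B` if `w` is symmetric and `ε = 1`, of type `D` if `w` is
symmetric and `ε = 0`. -/
structure IsBasisOfTypeBCD (w : LinearMap.BilinForm k V) {ε : ℕ}
    (b : Module.Basis ((ℕ ⊕ ℕ) ⊕ Fin ε) k V) : Prop where
  kind : ((∀ x y, w x y = - w y x) ∧ ε = 0) ∨ ((∀ x y, w x y = w y x) ∧ (ε = 0 ∨ ε = 1))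
  lower : ∀ i j, w (b (.inl (.inl i))) (b (.inl (.inl j))) = 0
  upper : ∀ i j, w (b (.inl (.inr i))) (b (.inl (.inr j))) = 0
  pairing : ∀ i j, w (b (.inl (.inl i))) (b (.inl (.inr j))) = if i = j then 1 else 0
  zero_lower : ∀ z i, w (b (.inr z)) (b (.inl (.inl i))) = 0
  zero_upper : ∀ z i, w (b (.inr z)) (b (.inl (.inr i))) = 0
  zero_zero : ∀ z, w (b (.inr z)) (b (.inr z)) = 1

/-- `w`-isotropic bases of a vector space of countably infinite dimension. -/
def IsIsotropicBasisSet (w : LinearMap.BilinForm k V) (L : Set V) : Prop :=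
  ∃ (ε : ℕ) (b : Module.Basis ((ℕ ⊕ ℕ) ⊕ Fin ε) k V), IsBasisOfTypeBCD w b ∧ Set.range b = L

/-- `Fl(F, w, E)`: the set of all `w`-isotropic generalized flags in `V` which are
`E`-commensurable with `F`, where only `w`-isotropic bases are considered. -/
def FlIso (w : LinearMap.BilinForm k V) (F : Set (Submodule k V)) (E : Set V) :
    Set (Set (Submodule k V)) :=
  {G | IsGeneralizedFlag G ∧ IsIsotropic w G ∧ IsCommensurable (IsIsotropicBasisSet w) E F G}

/-! ### Flags in the finite-dimensional subspaces spanned by finitely many basis vectors -/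

variable {κ : Type} (e : Module.Basis κ k V)

/-- `V_B = Span {e_b : b ∈ B}`. -/
def spanOf (B : Finset κ) : Submodule k V := Submodule.span k (e '' B)

/-- `{G ∩ V_B : G ∈ 𝒢}`. -/
def truncate (B : Finset κ) (G : Set (Submodule k V)) : Set (Submodule k V) :=
  {H | ∃ A ∈ G, H = A ⊓ spanOf e B}

open Classical in
/-- The type of the flag `{A ∩ V_B : A ∈ F}`: the set of dimensions of its members. -/
noncomputable def flagType (B : Finset κ) (F : Set (Submodule k V)) : Finset ℕ :=
  (Finset.range (B.card + 1)).filter fun i =>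
    ∃ A ∈ F, Module.finrank k ↥(A ⊓ spanOf e B) = i

/-- `Fl(d; V_B)` as a set: flags in `V_B` whose set of dimensions is `d`. -/
def FlFin (B : Finset κ) (d : Finset ℕ) : Set (Set (Submodule k V)) :=
  {H | IsChain (· ≤ ·) H ∧ (∀ A ∈ H, A ≤ spanOf e B) ∧
    (fun A : Submodule k V => Module.finrank k A) '' H = (d : Set ℕ)}

/-- `Fl(d; V_B, w)` as a set: flags of type `d` in `V_B` which are stable under taking
orthogonal complements in `V_B`. -/
def FlIsoFin (w : LinearMap.BilinForm k V) (B : Finset κ) (d : Finset ℕ) :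
    Set (Set (Submodule k V)) :=
  {H | H ∈ FlFin e B d ∧ ∀ A ∈ H, w.orthogonal A ⊓ spanOf e B ∈ H}

/-- The map `ι` from flags in `V_B` of the type of `F ∩ V_B` to flags in `V_{B'}`, `B ⊆ B'`.
The member of `H` corresponding to `A ∈ F`, i.e. the one of dimension `dim (A ∩ V_B)`, is enlarged
by those new basis vectors `e_b`, `b ∈ B' \ B`, which lie in `A`. -/
def extendFlag (F : Set (Submodule k V)) (B B' : Finset κ) (H : Set (Submodule k V)) :
    Set (Submodule k V) :=
  {K | ∃ A ∈ F, ∃ C ∈ H, Module.finrank k C = Module.finrank k ↥(A ⊓ spanOf e B) ∧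
    K = C ⊔ Submodule.span k {x | ∃ b ∈ B', b ∉ B ∧ e b ∈ A ∧ x = e b}}

/-- `F` is compatible with a basis consisting of all the vectors `e_b`, `b ∉ B`, and of
a basis of `V_B`. -/
def IsAdapted (adm : Set V → Prop) (F : Set (Submodule k V)) (B : Finset κ) : Prop :=
  ∃ L : Set V, adm L ∧ IsCompatible F L ∧ (∀ b, b ∉ B → e b ∈ L) ∧
    ∀ x ∈ L, x ∈ spanOf e B ∨ ∃ b, b ∉ B ∧ x = e b

end Flags

/-- `E_n = {e_i, e^i}_{i ≤ n}` (including `e_0 = e^0` if `ε = 1`), as a set of indices; the pairs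
`e_i, e^i` are numbered from `0`, so that there are `n` of them. -/
def isoSupport (ε n : ℕ) : Finset ((ℕ ⊕ ℕ) ⊕ Fin ε) :=
  ((Finset.range n).disjSum (Finset.range n)).disjSum Finset.univ

/-! ### Direct limits of sequences of sets -/

/-- The direct limit of `X 0 → X 1 → X 2 → ⋯`. -/
def SeqLim (X : ℕ → Type v) (f : ∀ n, X n → X (n + 1)) : Type v :=
  Quot fun a b : (Σ n, X n) => b = ⟨a.1 + 1, f a.1 a.2⟩

/-- The canonical map `X n → lim X`. -/
def SeqLim.of {X : ℕ → Type v} (f : ∀ n, X n → X (n + 1)) (n : ℕ) (x : X n) : SeqLim X f :=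
  Quot.mk _ ⟨n, x⟩

/-! ### Varieties and ind-varieties over `k` -/

section Varieties

variable (k : Type u) [Field k]

/-- The set of `k`-points of a scheme over `k`. -/
abbrev RationalPoints (X : Over (Spec (.of k))) := Over.mk (𝟙 (Spec (.of k))) ⟶ X

variable {k}

/-- The point of the underlying topological space defined by a `k`-point. -/
noncomputable def RationalPoints.pt {X : Over (Spec (.of k))} (s : RationalPoints k X) : X.left :=
  s.left (IsLocalRing.closedPoint k : PrimeSpectrum k)

/-- Noetherian algebraic varieties over `k`, not necessarily irreducible. -/
structure IsVariety (X : Over (Spec (.of k))) : Prop where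
  reduced : IsReduced X.left
  separated : IsSeparated X.hom
  locallyOfFiniteType : LocallyOfFiniteType X.hom
  quasiCompact : QuasiCompact X.hom

variable (k)

/-- The structure of an ind-variety over `k` on the set `S`: an exhaustive filtration of `S` by
subsets `piece n`, each of which is the set of `k`-points of an algebraic variety `var n`,
such that the inclusions are given by closed immersions of varieties over `k`. The set of
`k`-points has to be dense in each variety, which is automatic if `k` is algebraically closed;
hence the inclusions determine the closed immersions. -/
structure IndVarietyStructure (S : Type v) where
  piece : ℕ → Set S
  mono : ∀ n, piece n ⊆ piece (n + 1)
  exhaust : ⋃ n, piece n = Set.univ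
  var : ℕ → Over (Spec (.of k))
  isVariety : ∀ n, IsVariety (var n)
  pts : ∀ n, piece n ≃ RationalPoints k (var n)
  dense : ∀ n, Dense (Set.range fun s : RationalPoints k (var n) => s.pt)
  incl : ∀ n, var n ⟶ var (n + 1)
  isClosedImmersion : ∀ n, IsClosedImmersion (incl n).left
  pts_incl : ∀ n (x : S) (hx : x ∈ piece n), pts n ⟨x, hx⟩ ≫ incl n = pts (n + 1) ⟨x, mono n hx⟩

attribute [local instance] MvPolynomial.gradedAlgebra

/-- The projective space over `k` with homogeneous coordinates indexed by `σ`. -/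
noncomputable def projSpace (σ : Type) : Over (Spec (.of k)) :=
  Over.mk (Proj.toSpecZero (MvPolynomial.homogeneousSubmodule σ k) ≫
    Spec.map (CommRingCat.ofHom (algebraMap k (MvPolynomial.homogeneousSubmodule σ k 0))))

variable {k}

/-- The `k`-point `s` of projective space has homogeneous coordinates `c`: a homogeneous
polynomial is nonzero at `s` iff its value at `c` is nonzero. (This forces `c ≠ 0`.) -/
def HasCoords {σ : Type} (s : RationalPoints k (projSpace k σ)) (c : σ → k) : Prop :=
  ∀ (n : ℕ) (f : MvPolynomial σ k), f.IsHomogeneous n →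
    (s.pt ∈ Proj.basicOpen (MvPolynomial.homogeneousSubmodule σ k) f ↔ MvPolynomial.eval c f ≠ 0)

/-- The reduced closed subscheme of `Y` which is the closure of the set `Z` of `k`-points. -/
noncomputable def reducedClosure (Y : Over (Spec (.of k))) (Z : Set (RationalPoints k Y)) :
    Over (Spec (.of k)) :=
  Over.mk ((Scheme.IdealSheafData.vanishingIdeal (.closure (RationalPoints.pt '' Z))).subschemeι ≫
    Y.hom)

/-- The embedding of `reducedClosure Y Z` into `Y`. -/
noncomputable def reducedClosureι (Y : Over (Spec (.of k))) (Z : Set (RationalPoints k Y)) :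
    reducedClosure Y Z ⟶ Y :=
  Over.homMk
    (Scheme.IdealSheafData.vanishingIdeal (.closure (RationalPoints.pt '' Z))).subschemeι rfl

variable (k)

/-- `∏_{i ∈ d} ℙ(k^{B^i})`, which contains the product of the projective spaces `ℙ(Λ^i V_B)`. -/
noncomputable def plueckerSpace {κ : Type} (B : Finset κ) (d : Finset ℕ) : Over (Spec (.of k)) :=
  ∏ᶜ fun i : d => projSpace k (Fin i → B)

variable {k}
variable {V : Type v} [AddCommGroup V] [Module k V] {κ : Type} (e : Module.Basis κ k V)

/-- `s` is the image of the flag `H` in `V_B` under the Plücker embedding: its component of index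
`i ∈ d` has as homogeneous coordinates the `i × i` minors of the coordinates (with respect to
`e_b`, `b ∈ B`) of a basis `g` of the `i`-dimensional member of `H`. -/
def IsPlueckerPoint (B : Finset κ) (d : Finset ℕ) (H : Set (Submodule k V))
    (s : RationalPoints k (plueckerSpace k B d)) : Prop :=
  ∀ i : d, ∃ g : Fin i → V, LinearIndependent k g ∧ Submodule.span k (Set.range g) ∈ H ∧
    HasCoords (s ≫ Pi.π (fun i : d => projSpace k (Fin i → B)) i)
      (fun I => Matrix.det (Matrix.of fun a b => e.repr (g b) (I a)))

/-- The variety of the flags `H ∈ 𝓗`, where `𝓗` is a set of flags of type `d` in `V_B`: the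
(reduced) closure of their images under the Plücker embedding. For `𝓗 = Fl(d; V_B)` this is
the usual flag variety, for `𝓗 = Fl(d; V_B, w)` the usual variety of isotropic flags. -/
noncomputable def flagVariety (B : Finset κ) (d : Finset ℕ) (𝓗 : Set (Set (Submodule k V))) :
    Over (Spec (.of k)) :=
  reducedClosure (plueckerSpace k B d) {s | ∃ H ∈ 𝓗, IsPlueckerPoint e B d H s}

/-- The flag `H` corresponds to the `k`-point `s` of the flag variety. -/
def IsPointOfFlag (B : Finset κ) (d : Finset ℕ) (𝓗 : Set (Set (Submodule k V)))
    (H : Set (Submodule k V)) (s : RationalPoints k (flagVariety e B d 𝓗)) : Prop :=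
  IsPlueckerPoint e B d H (s ≫ reducedClosureι _ _)

/-- The set `X` of generalized flags is an ind-variety through its identification with the direct
limit of the flag varieties `Fl_m`, `m ≥ 0`, where `V_m = Span {e_b : b ∈ S m}`, `d m` is the type
of `F ∩ V_m`, and `Fl_m` is the set `𝓗 m` of (isotropic) flags in `V_m` of type `d m`:

* the maps `ι_m` send `Fl_m` to `Fl_{m+1}`, and they are given by closed immersions `j m` of
  varieties over `k`;
* `θ : X → lim Fl_m` is well defined by `θ(G) = lim (G ∩ V_m)`, and it is a bijection;
* `X` has an ind-variety structure `𝒜` whose `m`-th piece corresponds under `θ` to the image of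
  `Fl_m` in the direct limit, with the structure of a variety of `Fl_m`. -/
def IsIndVarietyOfFlags (S : ℕ → Finset κ) (F : Set (Submodule k V))
    (X : Set (Set (Submodule k V))) (𝓗 : ℕ → Set (Set (Submodule k V))) : Prop :=
  ∃ (hι : ∀ m, ∀ H ∈ 𝓗 m, extendFlag e F (S m) (S (m + 1)) H ∈ 𝓗 (m + 1))
    (j : ∀ m, flagVariety e (S m) (flagType e (S m) F) (𝓗 m) ⟶
      flagVariety e (S (m + 1)) (flagType e (S (m + 1)) F) (𝓗 (m + 1)))
    (θ : X → SeqLim (fun m => 𝓗 m) (fun m H => ⟨_, hι m H.1 H.2⟩))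
    (𝒜 : IndVarietyStructure k X)
    (iso : ∀ m, 𝒜.var m ≅ flagVariety e (S m) (flagType e (S m) F) (𝓗 m)),
    (∀ m, IsClosedImmersion (j m).left) ∧
    (∀ m, ∀ H ∈ 𝓗 m, ∃ s, IsPointOfFlag e (S m) (flagType e (S m) F) (𝓗 m) H s ∧
      IsPointOfFlag e (S (m + 1)) (flagType e (S (m + 1)) F) (𝓗 (m + 1))
        (extendFlag e F (S m) (S (m + 1)) H) (s ≫ j m)) ∧
    (∀ G : X, ∀ᶠ m in Filter.atTop, ∃ h : truncate e (S m) G ∈ 𝓗 m,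
      θ G = SeqLim.of _ m ⟨truncate e (S m) G, h⟩) ∧
    Function.Bijective θ ∧
    (∀ m, 𝒜.piece m = θ ⁻¹' Set.range (SeqLim.of _ m)) ∧
    (∀ m (G : X) (hG : G ∈ 𝒜.piece m) (H : 𝓗 m), θ G = SeqLim.of _ m H →
      IsPointOfFlag e (S m) (flagType e (S m) F) (𝓗 m) H (𝒜.pts m ⟨G, hG⟩ ≫ (iso m).hom)) ∧
    (∀ m, 𝒜.incl m ≫ (iso (m + 1)).hom = (iso m).hom ≫ j m)

end Varieties

end IndFlag

namespace IndFlag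

/-! ### Properness, closed immersions and `k`-points. -/

section Schemes

/-! Algebra. If `F` is adapted to `V_n`, every member `A` is the direct sum of `A ∩ V_n` and the
span of the basis vectors outside `V_n` that lie in `A` (`IsAdapted.isSplit`). A flag `G`
commensurable with `F` is split in the same way for large `n`; outside `V_n` it contains the same
basis vectors as `F`, and inside `V_n` its members have the same dimensions
(`finrank_eq_of_commensurable`). So `G` is recovered from its trace on `V_n` by adding those vectors
back, and `X` is a union of sets of finite-dimensional flags.

Conversely, every flag `H` of the right type in `V_n` must extend to an element of `X`. This is a
transitivity statement: the automorphisms (in case (b), the isometries) of `V` that preserve `V_n`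
and fix the remaining basis vectors act transitively on `Fl_n` (`exists_transitive_flFin`, and the
Witt-type result `IsBasisOfTypeBCD.exists_map_standardFlag`). Hence the extension of `H` is `gF` for
such a `g` and inherits all properties of `F`, while `ι_n(H)` is just the trace of `gF` on
`V_{n+1}`. This gives the compatibility of the extensions with `ι_n` at once
(`isIndVarietyOfFlags_of_transitive`).

Geometry. In the chart where one chosen minor in each degree is 1, the other minors satisfy
polynomial equations expressing that they come from a matrix, that the spaces are nested, and that
they are orthogonal where required. Polynomial equations pass to the closure, so the closure of the
Plücker image acquires no new `k`-points (`exists_flag_of_mem_closure`). Adding basis vectors to a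
space changes its minors by linear forms, by Laplace expansion, and every old minor is among the new
ones (`exists_linear_forms`). So `ι_n` is induced by linear embeddings of projective spaces; it is a
monomorphism from a proper scheme to a separated one, hence a closed immersion
(`exists_closedImmersion_flagVariety`).

The two halves are combined formally in `isIndVarietyOfFlags_of_truncate`. -/

theorem isClosedUnderFiniteProducts_overObj {C : Type*} [Category C] [HasPullbacks C]
    (P : MorphismProperty C) [P.IsMultiplicative] [P.IsStableUnderBaseChange] (S : C)
    [HasFiniteProducts (Over S)] : (P.overObj (X := S)).IsClosedUnderFiniteProducts := by
  have hb : (P.overObj (X := S)).IsClosedUnderBinaryProducts := by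
    refine ObjectProperty.IsClosedUnderLimitsOfShape.mk' ?_
    rintro _ ⟨G, hG⟩
    let e : limit G ≅ (G.obj ⟨.left⟩) ⨯ (G.obj ⟨.right⟩) := HasLimit.isoOfNatIso (diagramIsoPair G)
    refine (P.overObj (X := S)).prop_of_iso e.symm ?_
    have h1 : P (G.obj ⟨.left⟩).hom := hG _
    have h2 : P (G.obj ⟨.right⟩).hom := hG _
    change P (G.obj ⟨.left⟩ ⨯ G.obj ⟨.right⟩).hom
    -- The structure morphism of the product is the first projection, a base change of the second
    -- structure morphism, followed by the first structure morphism.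
    rw [← Over.w (prod.fst (X := G.obj ⟨.left⟩) (Y := G.obj ⟨.right⟩)),
      ← Over.prodLeftIsoPullback_hom_fst]
    exact P.comp_mem _ _ ((P.cancel_left_of_respectsIso _ _).2 (P.pullback_fst _ _ h2)) h1
  exact ObjectProperty.IsClosedUnderFiniteProducts.mk'

theorem isProper_product {S : Scheme.{u}} {ι : Type} [Finite ι] (X : ι → Over S)
    (h : ∀ i, IsProper (X i).hom) : IsProper (∏ᶜ X).hom :=
  have := isClosedUnderFiniteProducts_overObj (@IsProper : MorphismProperty Scheme.{u}) S
  (MorphismProperty.overObj (@IsProper : MorphismProperty Scheme.{u}) (X := S)).prop_product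
    (f := X) h

/-- A morphism of schemes over a base, from a proper one to a separated one, is a closed immersion
as soon as it is a monomorphism. -/
theorem isClosedImmersion_left_of_mono {S : Scheme.{u}} {X Y : Over S} (f : X ⟶ Y)
    [IsProper X.hom] [IsSeparated Y.hom] [Mono f] : IsClosedImmersion f.left := by
  rw [IsClosedImmersion.iff_isProper_and_mono]
  refine ⟨?_, inferInstance⟩
  -- Properness of the composite with a separated morphism passes to the first factor.
  have : IsProper (f.left ≫ Y.hom) := by rw [Over.w]; infer_instance
  exact IsProper.of_comp f.left Y.hom

variable {k : Type u} [Field k]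

attribute [local instance] MvPolynomial.gradedAlgebra

/-- Homogeneous polynomials of degree zero are constants. This transfers properness of `Proj` over
its degree-zero part to properness over `k`. -/
theorem isIso_specMap_algebraMap_zero (σ : Type) : IsIso (Spec.map (CommRingCat.ofHom
    (algebraMap k (MvPolynomial.homogeneousSubmodule σ k 0)))) := by
  have : IsIso (CommRingCat.ofHom (algebraMap k (MvPolynomial.homogeneousSubmodule σ k 0))) := by
    rw [ConcreteCategory.isIso_iff_bijective]
    constructor
    · intro a b h
      exact MvPolynomial.C_injective σ k (congr_arg Subtype.val h)
    · rintro ⟨p, hp⟩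
      have hp' : p.IsHomogeneous 0 := hp
      refine ⟨p.coeff 0, Subtype.ext ?_⟩
      exact (MvPolynomial.totalDegree_eq_zero_iff_eq_C.mp (Nat.le_zero.mp hp'.totalDegree_le)).symm
  infer_instance

theorem isProper_projSpace (σ : Type) [Finite σ] : IsProper (projSpace k σ).hom := by
  have : Algebra.FiniteType (MvPolynomial.homogeneousSubmodule σ k 0) (MvPolynomial σ k) := by
    have h : Algebra.FiniteType k (MvPolynomial σ k) := inferInstance
    have : IsScalarTower k (MvPolynomial.homogeneousSubmodule σ k 0) (MvPolynomial σ k) :=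
      ⟨fun a x y => smul_mul_assoc a (x : MvPolynomial σ k) y⟩
    exact Algebra.FiniteType.of_restrictScalars_finiteType k _ _
  have := isIso_specMap_algebraMap_zero (k := k) σ
  change IsProper (Proj.toSpecZero (MvPolynomial.homogeneousSubmodule σ k) ≫ _)
  infer_instance

theorem isProper_plueckerSpace {κ : Type} (B : Finset κ) (d : Finset ℕ) :
    IsProper (plueckerSpace k B d).hom :=
  isProper_product _ fun _ => isProper_projSpace _

/-! ### Rational points -/

theorem RationalPoints.left_comp_hom {X : Over (Spec (.of k))} (s : RationalPoints k X) :
    s.left ≫ X.hom = 𝟙 _ := by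
  simp

theorem RationalPoints.pt_comp {X Y : Over (Spec (.of k))} (s : RationalPoints k X) (f : X ⟶ Y) :
    RationalPoints.pt (s ≫ f) = f.left s.pt := by
  rfl

/-- A `k`-point factors through the residue field of its image. The resulting map from the residue
field to `k` is injective and retracts the structure map, so it is the inverse of that map and
leaves no choice. -/
theorem RationalPoints.ext_pt {X : Over (Spec (.of k))} {s t : RationalPoints k X}
    (h : s.pt = t.pt) : s = t := by
  have key : ∀ (x : X.left) (φ ψ : X.left.residueField x ⟶ .of k),
      Spec.map φ ≫ X.left.fromSpecResidueField x ≫ X.hom = 𝟙 _ →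
      Spec.map ψ ≫ X.left.fromSpecResidueField x ≫ X.hom = 𝟙 _ → φ = ψ := by
    intro x φ ψ hφ hψ
    obtain ⟨c, hc⟩ := Spec.map_surjective (X.left.fromSpecResidueField x ≫ X.hom)
    rw [← hc, ← Spec.map_comp, ← Spec.map_id, Spec.map_inj] at hφ hψ
    have hinv : φ ≫ c = 𝟙 _ := by
      ext a
      apply φ.hom.injective
      simpa using congr($(hφ) (φ a))
    calc φ = (φ ≫ c) ≫ ψ := by rw [Category.assoc, hψ, Category.comp_id]
      _ = ψ := by rw [hinv, Category.id_comp]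
  have key2 : ∀ (x : X.left) (f g : Spec (.of k) ⟶ X.left), f (IsLocalRing.closedPoint k) = x →
      g (IsLocalRing.closedPoint k) = x → f ≫ X.hom = 𝟙 _ → g ≫ X.hom = 𝟙 _ → f = g := by
    intro x f g hf hg hf1 hg1
    have main : ∀ (f : Spec (.of k) ⟶ X.left), f (IsLocalRing.closedPoint k) = x →
        ∃ φ : X.left.residueField x ⟶ .of k, Spec.map φ ≫ X.left.fromSpecResidueField x = f := by
      rintro f rfl
      exact ⟨_, Scheme.descResidueField_stalkClosedPointTo_fromSpecResidueField k X.left f⟩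
    obtain ⟨φ, rfl⟩ := main f hf
    obtain ⟨ψ, rfl⟩ := main g hg
    rw [Category.assoc] at hf1 hg1
    rw [key x φ ψ hf1 hg1]
  ext1
  exact key2 _ s.left t.left h rfl s.left_comp_hom t.left_comp_hom

end Schemes

/-! ### Values of regular functions at `k`-points. -/

section Evaluation

variable {k : Type u} [Field k]

/-- The evaluation at a `k`-point of the functions defined in a neighbourhood of it. -/
noncomputable def evalHom {X : Scheme.{u}} (s : Spec (.of k) ⟶ X) (U : X.Opens)
    (h : s (IsLocalRing.closedPoint k) ∈ U) : Γ(X, U) ⟶ .of k :=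
  s.appLE U ⊤ (fun x _ => by
    obtain rfl : x = IsLocalRing.closedPoint k := Subsingleton.elim (α := PrimeSpectrum k) _ _
    exact h) ≫ (Scheme.ΓSpecIso (.of k)).hom

/-- The value at a `k`-point of a function defined in a neighbourhood of it. -/
noncomputable abbrev evalAt {X : Scheme.{u}} (s : Spec (.of k) ⟶ X) (U : X.Opens)
    (h : s (IsLocalRing.closedPoint k) ∈ U) : Γ(X, U) →+* k :=
  (evalHom s U h).hom

theorem evalAt_comp {X Y : Scheme.{u}} (s : Spec (.of k) ⟶ X) (f : X ⟶ Y) (U : Y.Opens)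
    (h : f (s (IsLocalRing.closedPoint k)) ∈ U) (a : Γ(Y, U)) :
    evalAt (s ≫ f) U h a = evalAt s (f ⁻¹ᵁ U) h (f.app U a) := by
  change ((s ≫ f).appLE U ⊤ _ ≫ _) a = (f.app U ≫ s.appLE (f ⁻¹ᵁ U) ⊤ _ ≫ _) a
  rw [← Category.assoc, Scheme.Hom.app_eq_appLE, Scheme.Hom.appLE_comp_appLE]

theorem evalAt_map {X : Scheme.{u}} (s : Spec (.of k) ⟶ X) {U W : X.Opens} (i : W ≤ U)
    (h : s (IsLocalRing.closedPoint k) ∈ W) (a : Γ(X, U)) :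
    evalAt s W h (X.presheaf.map (homOfLE i).op a) = evalAt s U (i h) a := by
  change (X.presheaf.map (homOfLE i).op ≫ s.appLE W ⊤ _ ≫ _) a = (s.appLE U ⊤ _ ≫ _) a
  rw [← Category.assoc, Scheme.Hom.map_appLE]

theorem closedPoint_mem_basicOpen (a : k) :
    (IsLocalRing.closedPoint k : PrimeSpectrum k) ∈ PrimeSpectrum.basicOpen a ↔ a ≠ 0 := by
  rw [PrimeSpectrum.mem_basicOpen]
  simp [IsLocalRing.closedPoint]

/-- Makes non-vanishing of a value an open condition, which is how polynomial identities will be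
extended to closures. -/
theorem mem_basicOpen_iff_evalAt_ne_zero {X : Scheme.{u}} (s : Spec (.of k) ⟶ X) (U : X.Opens)
    (h : s (IsLocalRing.closedPoint k) ∈ U) (a : Γ(X, U)) :
    s (IsLocalRing.closedPoint k) ∈ X.basicOpen a ↔ evalAt s U h a ≠ 0 := by
  have hU : (⊤ : (Spec (.of k)).Opens) ≤ s ⁻¹ᵁ U := fun x _ => by
    obtain rfl : x = IsLocalRing.closedPoint k := Subsingleton.elim (α := PrimeSpectrum k) _ _
    exact h
  have h1 : (Spec (.of k)).basicOpen (s.appLE U ⊤ hU a) = ⊤ ⊓ s ⁻¹ᵁ X.basicOpen a := by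
    rw [Scheme.basicOpen_appLE]
  have h2 : IsLocalRing.closedPoint k ∈ s ⁻¹ᵁ X.basicOpen a ↔
      IsLocalRing.closedPoint k ∈ (Spec (.of k)).basicOpen (s.appLE U ⊤ hU a) := by
    rw [h1]; simp
  refine h2.trans ?_
  rw [basicOpen_eq_of_affine']
  exact closedPoint_mem_basicOpen _

end Evaluation

/-! ### Homogeneous coordinates of `k`-points of projective space. -/

section ProjectiveSpace

variable {k : Type u} [Field k] {σ : Type}

attribute [local instance] MvPolynomial.gradedAlgebra

/-- At the zero vector all forms of positive degree vanish, so the prime of `s` would contain the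
irrelevant ideal. -/
theorem HasCoords.ne_zero {s : RationalPoints k (projSpace k σ)} {c : σ → k}
    (h : HasCoords s c) : c ≠ 0 := by
  rintro rfl
  have hle : HomogeneousIdeal.irrelevant (MvPolynomial.homogeneousSubmodule σ k) ≤
      ProjectiveSpectrum.asHomogeneousIdeal (s.pt : ProjectiveSpectrum _) := by
    rw [HomogeneousIdeal.irrelevant_le]
    intro i hi f hf
    by_contra hcon
    have := (h i f hf).1 hcon
    apply this
    have hf' : f.IsHomogeneous i := hf
    have h0 := hf'.coeff_eq_zero (d := 0) (by simpa using hi.ne)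
    rw [← MvPolynomial.constantCoeff_eq] at h0
    simpa [MvPolynomial.constantCoeff] using h0
  exact (s.pt : ProjectiveSpectrum _).not_irrelevant_le hle

theorem HasCoords.eq_of_hasCoords {s t : RationalPoints k (projSpace k σ)} {c : σ → k}
    (hs : HasCoords s c) (ht : HasCoords t c) : s = t := by
  apply RationalPoints.ext_pt
  have : ∀ x y : ProjectiveSpectrum (MvPolynomial.homogeneousSubmodule σ k),
      (∀ n, ∀ f ∈ MvPolynomial.homogeneousSubmodule σ k n,
        f ∈ x.asHomogeneousIdeal ↔ f ∈ y.asHomogeneousIdeal) → x = y := by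
    intro x y h
    exact ProjectiveSpectrum.ext (HomogeneousIdeal.ext' h)
  refine this _ _ fun n f hf => ?_
  exact not_iff_not.1 ((hs n f hf).trans (ht n f hf).symm)

theorem eval₂_mul_of_isHomogeneous {R S : Type*} [CommRing R] [CommRing S] (g : R →+* S)
    (y : σ → S) (a : S) {n : ℕ} {f : MvPolynomial σ R} (hf : f.IsHomogeneous n) :
    MvPolynomial.eval₂ g (fun i => a * y i) f = a ^ n * MvPolynomial.eval₂ g y f := by
  simp only [MvPolynomial.eval₂_eq, Finset.mul_sum]
  refine Finset.sum_congr rfl fun d hd => ?_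
  have hdeg : ∑ i ∈ d.support, d i = n := by
    have := hf (MvPolynomial.mem_support_iff.1 hd)
    simpa [Finsupp.weight_apply, Finsupp.sum] using this
  simp only [mul_pow, Finset.prod_mul_distrib, Finset.prod_pow_eq_pow_sum, hdeg]
  ring

theorem HasCoords.smul {s : RationalPoints k (projSpace k σ)} {c : σ → k}
    (hs : HasCoords s c) {a : k} (ha : a ≠ 0) : HasCoords s (a • c) := by
  intro n f hf
  rw [hs n f hf]
  have : MvPolynomial.eval (a • c) f = a ^ n * MvPolynomial.eval c f :=
    eval₂_mul_of_isHomogeneous (RingHom.id k) c a hf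
  rw [this]
  simp [ha]

theorem HasCoords.eq_smul {s : RationalPoints k (projSpace k σ)} {c c' : σ → k}
    (hs : HasCoords s c) (hs' : HasCoords s c') : ∃ a : k, a ≠ 0 ∧ c' = a • c := by
  obtain ⟨I, hI⟩ := Function.ne_iff.1 hs.ne_zero
  have hI' : c I ≠ 0 := hI
  have hX : (MvPolynomial.X I : MvPolynomial σ k).IsHomogeneous 1 := MvPolynomial.isHomogeneous_X _ _
  have hI2 : c' I ≠ 0 := by
    simpa using ((hs 1 _ hX).symm.trans (hs' 1 _ hX)).1 (by simpa using hI')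
  refine ⟨c' I / c I, div_ne_zero hI2 hI', funext fun J => ?_⟩
  -- This linear form vanishes at `c`, hence at `c'`, which makes the two vectors proportional.
  have hf : (MvPolynomial.C (c I) * MvPolynomial.X J - MvPolynomial.C (c J) * MvPolynomial.X I :
      MvPolynomial σ k).IsHomogeneous 1 :=
    ((MvPolynomial.isHomogeneous_X _ _).C_mul _).sub ((MvPolynomial.isHomogeneous_X _ _).C_mul _)
  have := not_iff_not.2 ((hs 1 _ hf).symm.trans (hs' 1 _ hf))
  simp only [map_sub, map_mul, MvPolynomial.eval_C, MvPolynomial.eval_X, ne_eq, not_not] at this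
  have h2 := this.1 (by ring)
  simp only [Pi.smul_apply, smul_eq_mul]
  field_simp
  linear_combination h2

/-- Evaluation at `c` maps the irrelevant ideal onto the unit ideal because some `c I` is
invertible, and so defines a morphism to `Proj`. -/
theorem exists_hasCoords {c : σ → k} (hc : c ≠ 0) :
    ∃ s : RationalPoints k (projSpace k σ), HasCoords s c := by
  obtain ⟨I, hI⟩ := Function.ne_iff.1 hc
  let f : MvPolynomial σ k →+* Γ(Spec (.of k), ⊤) :=
    (Scheme.ΓSpecIso (.of k)).inv.hom.comp (MvPolynomial.eval c)
  have hf : (HomogeneousIdeal.irrelevant (MvPolynomial.homogeneousSubmodule σ k)).toIdeal.map f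
      = ⊤ := by
    rw [Ideal.eq_top_iff_one]
    have h1 : f (MvPolynomial.C (c I)⁻¹ * MvPolynomial.X I) = 1 := by
      have : MvPolynomial.eval c (MvPolynomial.C (c I)⁻¹ * MvPolynomial.X I) = 1 := by
        simpa using inv_mul_cancel₀ hI
      simp only [f, RingHom.comp_apply, this, map_one]
    rw [← h1]
    refine Ideal.mem_map_of_mem f ?_
    exact HomogeneousIdeal.mem_irrelevant_of_mem _ one_pos
      ((MvPolynomial.isHomogeneous_X _ _).C_mul _ : MvPolynomial.IsHomogeneous _ 1)
  refine ⟨Over.homMk (Proj.fromOfGlobalSections _ f hf) ?_, ?_⟩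
  · change Proj.fromOfGlobalSections _ f hf ≫ Proj.toSpecZero _ ≫ Spec.map _ = 𝟙 _
    rw [Proj.fromOfGlobalSections_toSpecZero_assoc, ← Spec.map_comp,
      ← toSpecΓ_SpecMap_ΓSpecIso_inv]
    congr 2
    ext a
    change f (MvPolynomial.C a) = _
    simp [f]
  · intro n g hg
    -- The description of preimages of basic open sets needs positive degree; constants are treated
    -- by hand.
    rcases Nat.eq_zero_or_pos n with rfl | hn
    · obtain ⟨a, rfl⟩ : ∃ a, g = MvPolynomial.C a :=
        ⟨_, MvPolynomial.totalDegree_eq_zero_iff_eq_C.mp (Nat.le_zero.mp hg.totalDegree_le)⟩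
      by_cases ha : a = 0
      · subst ha; simp
        exact fun h => h
      · simp only [MvPolynomial.eval_C, ne_eq, ha, not_false_eq_true, iff_true]
        intro h
        refine (ProjectiveSpectrum.isPrime _).ne_top (Ideal.eq_top_of_isUnit_mem _ h ?_)
        exact (isUnit_iff_ne_zero.2 ha).map MvPolynomial.C
    · have := Proj.fromOfGlobalSections_preimage_basicOpen _ f hf hn hg
      have h2 : IsLocalRing.closedPoint k ∈ (Spec (.of k)).basicOpen (f g) ↔
          MvPolynomial.eval c g ≠ 0 := by
        change IsLocalRing.closedPoint k ∈ (Spec (.of k)).basicOpen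
          ((Scheme.ΓSpecIso (.of k)).inv (MvPolynomial.eval c g)) ↔ _
        rw [basicOpen_eq_of_affine]
        exact closedPoint_mem_basicOpen _
      rw [← h2, ← this]
      rfl

end ProjectiveSpace

/-! ### Affine charts of projective space and normalized coordinates. -/

section ProjectiveSpace

variable {k : Type u} [Field k] {σ : Type}

attribute [local instance] MvPolynomial.gradedAlgebra

/-- The set `X_I ≠ 0` in projective space. -/
noncomputable def chart (k : Type u) [Field k] {σ : Type} (I : σ) : (projSpace k σ).left.Opens :=
  Proj.basicOpen (MvPolynomial.homogeneousSubmodule σ k) (MvPolynomial.X I)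

theorem X_mem_homogeneousSubmodule (I : σ) :
    (MvPolynomial.X I : MvPolynomial σ k) ∈ MvPolynomial.homogeneousSubmodule σ k 1 :=
  MvPolynomial.isHomogeneous_X _ _

/-- The function `X_J / X_I` on the set `X_I ≠ 0`. -/
noncomputable def chartCoord (k : Type u) [Field k] {σ : Type} (I J : σ) :
    Γ((projSpace k σ).left, chart k I) :=
  Proj.awayToSection (MvPolynomial.homogeneousSubmodule σ k) (MvPolynomial.X I)
    (HomogeneousLocalization.Away.mk _ (X_mem_homogeneousSubmodule I) 1 (MvPolynomial.X J)
      (X_mem_homogeneousSubmodule J))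

/-- The coordinates of a `k`-point in the set `X_I ≠ 0`, normalized by `X_I = 1`. -/
noncomputable def RationalPoints.coord (s : RationalPoints k (projSpace k σ)) (I : σ)
    (h : s.pt ∈ chart k I) (J : σ) : k :=
  evalAt s.left (chart k I) h (chartCoord k I J)

/-- A point of the chart factors through the affine scheme of that chart, the ring map being
evaluation of functions; this reduces `hasCoords_coord` to algebra. -/
theorem specMap_evalAt_awayι (s : Spec (.of k) ⟶ Proj (MvPolynomial.homogeneousSubmodule σ k))
    (I : σ) (h : s (IsLocalRing.closedPoint k) ∈
      Proj.basicOpen (MvPolynomial.homogeneousSubmodule σ k) (MvPolynomial.X I)) :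
    Spec.map (Proj.awayToSection _ _ ≫ evalHom s _ h) ≫
      Proj.awayι _ _ (X_mem_homogeneousSubmodule I) one_pos = s := by
  set U := Proj.basicOpen (MvPolynomial.homogeneousSubmodule σ k) (MvPolynomial.X I)
  have hU : (⊤ : (Spec (.of k)).Opens) ≤ s ⁻¹ᵁ U := fun x _ => by
    obtain rfl : x = IsLocalRing.closedPoint k := Subsingleton.elim (α := PrimeSpectrum k) _ _
    exact h
  have : IsIso (⊤ : (Spec (.of k)).Opens).ι :=
    inferInstanceAs (IsIso (Scheme.topIso (Spec (.of k))).hom)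
  rw [← cancel_epi (⊤ : (Spec (.of k)).Opens).ι, ← Scheme.Hom.resLE_comp_ι s hU]
  have h1 := Scheme.Opens.toSpecΓ_SpecMap_appLE (f := s) (hUV := hU)
  rw [Scheme.Opens.toSpecΓ_top, ← SpecMap_ΓSpecIso_hom, Category.assoc, ← Spec.map_comp] at h1
  have h2 : evalHom s U h = s.appLE U ⊤ hU ≫ (Scheme.ΓSpecIso (.of k)).hom := rfl
  rw [Spec.map_comp, h2, Category.assoc, reassoc_of% h1, ← Proj.basicOpenIsoSpec_inv_ι]
  congr 1
  rw [← Category.assoc, ← Category.assoc]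
  change (Proj.basicOpenToSpec _ _ ≫ _) ≫ _ = _
  rw [← Proj.basicOpenIsoSpec_hom _ _ (X_mem_homogeneousSubmodule I) one_pos, Iso.hom_inv_id,
    Category.id_comp]

/-- By homogeneity, `f / X_I ^ n` is the polynomial `f` in the fractions `X_J / X_I`, and `φ` fixes
constants. -/
theorem away_ringHom_eq_eval {I : σ}
    (φ : HomogeneousLocalization.Away (MvPolynomial.homogeneousSubmodule σ k) (MvPolynomial.X I)
      →+* k)
    (hφ : ∀ a : k, φ (HomogeneousLocalization.fromZeroRingHom _ _
      (algebraMap k (MvPolynomial.homogeneousSubmodule σ k 0) a)) = a)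
    (n : ℕ) (f : MvPolynomial σ k) (hf : f ∈ MvPolynomial.homogeneousSubmodule σ k (n • 1)) :
    φ (HomogeneousLocalization.Away.mk _ (X_mem_homogeneousSubmodule I) n f hf) =
      MvPolynomial.eval (fun J => φ (HomogeneousLocalization.Away.mk _
        (X_mem_homogeneousSubmodule I) 1 (MvPolynomial.X J) (X_mem_homogeneousSubmodule J))) f := by
  have key : HomogeneousLocalization.Away.mk _ (X_mem_homogeneousSubmodule I) n f hf =
      MvPolynomial.eval₂ ((HomogeneousLocalization.fromZeroRingHom _ _).comp
        (algebraMap k (MvPolynomial.homogeneousSubmodule σ k 0)))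
        (fun J => HomogeneousLocalization.Away.mk _
        (X_mem_homogeneousSubmodule I) 1 (MvPolynomial.X J) (X_mem_homogeneousSubmodule J)) f := by
    have hf' : f.IsHomogeneous n := by simpa using hf
    apply HomogeneousLocalization.val_injective
    rw [← HomogeneousLocalization.algebraMap_apply, ← HomogeneousLocalization.algebraMap_apply,
      MvPolynomial.hom_eval₂, HomogeneousLocalization.algebraMap_apply,
      HomogeneousLocalization.Away.val_mk, Localization.mk_eq_mk', IsLocalization.mk'_eq_iff_eq_mul,
      mul_comm, map_pow, ← eval₂_mul_of_isHomogeneous _ _ _ hf']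
    conv_lhs => rw [← MvPolynomial.eval₂_eta f, MvPolynomial.hom_eval₂]
    congr 1
    · ext J
      rw [HomogeneousLocalization.algebraMap_apply, HomogeneousLocalization.Away.val_mk,
        Localization.mk_eq_mk', eq_comm, mul_comm]
      have := IsLocalization.mk'_spec (Localization (Submonoid.powers (MvPolynomial.X I :
        MvPolynomial σ k))) (MvPolynomial.X J) (⟨MvPolynomial.X I ^ 1, ⟨1, rfl⟩⟩ :
        Submonoid.powers (MvPolynomial.X I : MvPolynomial σ k))
      simpa only [pow_one] using this
  rw [key, ← MvPolynomial.eval₂_id, MvPolynomial.hom_eval₂]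
  congr 1
  ext a
  exact hφ a

theorem RationalPoints.hasCoords_coord (s : RationalPoints k (projSpace k σ)) (I : σ)
    (h : s.pt ∈ chart k I) : HasCoords s (s.coord I h) := by
  set φ := Proj.awayToSection _ _ ≫ evalHom s.left _ h with hφdef
  have hs : Spec.map φ ≫ Proj.awayι _ _ (X_mem_homogeneousSubmodule I) one_pos = s.left :=
    specMap_evalAt_awayι _ _ _
  have hφ : ∀ a : k, φ (HomogeneousLocalization.fromZeroRingHom _ _
      (algebraMap k (MvPolynomial.homogeneousSubmodule σ k 0) a)) = a := by
    have h1 : (Spec.map φ ≫ Proj.awayι _ _ (X_mem_homogeneousSubmodule I) one_pos) ≫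
        Proj.toSpecZero (MvPolynomial.homogeneousSubmodule σ k) ≫ Spec.map (CommRingCat.ofHom
          (algebraMap k (MvPolynomial.homogeneousSubmodule σ k 0))) = 𝟙 (Spec (.of k)) :=
      (congrArg (· ≫ (projSpace k σ).hom) hs).trans s.left_comp_hom
    rw [Category.assoc, Proj.awayι_toSpecZero_assoc, ← Spec.map_comp, ← Spec.map_comp,
      ← Spec.map_id, Spec.map_inj] at h1
    intro a
    exact congr($h1 a)
  have pos : ∀ (n : ℕ) (f : MvPolynomial σ k), f.IsHomogeneous n → 0 < n →
    (s.pt ∈ Proj.basicOpen (MvPolynomial.homogeneousSubmodule σ k) f ↔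
      MvPolynomial.eval (s.coord I h) f ≠ 0) := by
    intro n f hf hn
    have h1 := Proj.awayι_preimage_basicOpen (MvPolynomial.homogeneousSubmodule σ k)
      (X_mem_homogeneousSubmodule (k := k) I) one_pos (g := f) hf hn
    have h3 := away_ringHom_eq_eval φ.hom hφ n f (by simpa using hf)
    have h4 : MvPolynomial.eval (s.coord I h) f =
      φ (HomogeneousLocalization.Away.isLocalizationElem (X_mem_homogeneousSubmodule I) hf) := by
      refine h3.symm.trans ?_
      congr 2
      simp
    have h2 : s.pt ∈ Proj.basicOpen (MvPolynomial.homogeneousSubmodule σ k) f ↔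
        Spec.map φ (IsLocalRing.closedPoint k) ∈
          Proj.awayι _ _ (X_mem_homogeneousSubmodule (k := k) I) one_pos ⁻¹ᵁ
          Proj.basicOpen (MvPolynomial.homogeneousSubmodule σ k) f := by
      rw [RationalPoints.pt, ← hs]; rfl
    rw [h2, h1, h4]
    exact closedPoint_mem_basicOpen _
  intro n f hf
  rcases Nat.eq_zero_or_pos n with rfl | hn
  -- In degree zero the form is multiplied by `X_I`, which does not vanish at `s`.
  · have := pos 1 (f * MvPolynomial.X I) (by simpa using hf.mul (MvPolynomial.isHomogeneous_X _ I)) one_pos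
    rw [Proj.basicOpen_mul] at this
    have h1 : s.coord I h I ≠ 0 := by
      simpa using (pos 1 (MvPolynomial.X I) (MvPolynomial.isHomogeneous_X _ _) one_pos).1 h
    simp only [map_mul, MvPolynomial.eval_X, ne_eq, mul_eq_zero, h1, or_false] at this
    exact Iff.trans ⟨fun x => ⟨x, h⟩, fun x => x.1⟩ this
  · exact pos n f hf hn

end ProjectiveSpace

/-! ### Linear embeddings of projective spaces. -/

section LinearMaps

variable {k : Type u} [Field k] {σ τ : Type}

attribute [local instance] MvPolynomial.gradedAlgebra

/-- The graded homomorphism `k[y] → k[x]` defined by linear forms. -/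
noncomputable def linearGradedHom (ℓ : τ → MvPolynomial σ k) (hℓ : ∀ j, (ℓ j).IsHomogeneous 1) :
    MvPolynomial.homogeneousSubmodule τ k →+*ᵍ MvPolynomial.homogeneousSubmodule σ k where
  __ := (MvPolynomial.aeval ℓ).toRingHom
  map_mem {n f} hf := by
    have hf' : f.IsHomogeneous n := hf
    simpa using hf'.aeval ℓ hℓ

theorem linearGradedHom_apply (ℓ : τ → MvPolynomial σ k) (hℓ : ∀ j, (ℓ j).IsHomogeneous 1)
    (f : MvPolynomial τ k) : linearGradedHom ℓ hℓ f = MvPolynomial.aeval ℓ f := rfl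

variable {ℓ : τ → MvPolynomial σ k} {hℓ : ∀ j, (ℓ j).IsHomogeneous 1}

/-- Since every variable occurs among the forms `ℓ j`, renaming variables is a degree-preserving
section of the substitution. Hence the linear map has no base points. -/
theorem irrelevant_le_map_linearGradedHom (hsurj : ∀ i, ∃ j, ℓ j = MvPolynomial.X i) :
    HomogeneousIdeal.irrelevant (MvPolynomial.homogeneousSubmodule σ k) ≤
      (HomogeneousIdeal.irrelevant (MvPolynomial.homogeneousSubmodule τ k)).map
        (linearGradedHom ℓ hℓ) := by
  choose m hm using hsurj
  rw [HomogeneousIdeal.irrelevant_le]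
  intro n hn f hf
  have hf' : f.IsHomogeneous n := hf
  have h1 : linearGradedHom ℓ hℓ (MvPolynomial.rename m f) = f := by
    rw [linearGradedHom_apply, MvPolynomial.aeval_rename]
    have : ℓ ∘ m = MvPolynomial.X := funext hm
    rw [this, MvPolynomial.aeval_X_left_apply]
  change f ∈ _
  rw [← h1]
  refine Ideal.mem_map_of_mem _ ?_
  exact HomogeneousIdeal.mem_irrelevant_of_mem _ hn
    (show _ ∈ MvPolynomial.homogeneousSubmodule τ k n from hf'.rename_isHomogeneous)

theorem away_map_linearGradedHom_surjective (hsurj : ∀ i, ∃ j, ℓ j = MvPolynomial.X i)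
    {n : ℕ} {f : MvPolynomial τ k} (hf : f ∈ MvPolynomial.homogeneousSubmodule τ k n) :
    Function.Surjective (HomogeneousLocalization.Away.map (linearGradedHom ℓ hℓ) f) := by
  choose m hm using hsurj
  intro x
  obtain ⟨r, a, ha, rfl⟩ := HomogeneousLocalization.Away.mk_surjective _
    ((linearGradedHom ℓ hℓ).map_mem hf) x
  have ha' : a.IsHomogeneous (r • n) := ha
  have hb : MvPolynomial.rename m a ∈ MvPolynomial.homogeneousSubmodule τ k (r • n) :=
    ha'.rename_isHomogeneous
  refine ⟨HomogeneousLocalization.Away.mk _ hf r (MvPolynomial.rename m a) hb, ?_⟩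
  rw [HomogeneousLocalization.Away.map_mk]
  congr 1
  rw [linearGradedHom_apply, MvPolynomial.aeval_rename]
  have : ℓ ∘ m = MvPolynomial.X := funext hm
  rw [this, MvPolynomial.aeval_X_left_apply]

/-- Both morphisms are compared on affine charts, where the claim is that the substitution fixes
constants. -/
theorem projMap_linearGradedHom_comp (h : HomogeneousIdeal.irrelevant
    (MvPolynomial.homogeneousSubmodule σ k) ≤ (HomogeneousIdeal.irrelevant
      (MvPolynomial.homogeneousSubmodule τ k)).map (linearGradedHom ℓ hℓ)) :
    Proj.map (linearGradedHom ℓ hℓ) h ≫ (projSpace k τ).hom = (projSpace k σ).hom := by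
  have key : ∀ (i : ℕ) (hi : 0 < i) (f : MvPolynomial τ k)
      (hf : f ∈ MvPolynomial.homogeneousSubmodule τ k i),
      Proj.awayι _ (linearGradedHom ℓ hℓ f) ((linearGradedHom ℓ hℓ).map_mem hf) hi ≫
        Proj.map (linearGradedHom ℓ hℓ) h ≫ (projSpace k τ).hom =
      Proj.awayι _ (linearGradedHom ℓ hℓ f) ((linearGradedHom ℓ hℓ).map_mem hf) hi ≫
        (projSpace k σ).hom := by
    intro i hi f hf
    change Proj.awayι _ _ _ _ ≫ Proj.map _ h ≫ Proj.toSpecZero _ ≫ Spec.map _ =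
      Proj.awayι _ _ _ _ ≫ Proj.toSpecZero _ ≫ Spec.map _
    rw [Proj.awayι_comp_map_assoc _ _ hi _ hf, Proj.awayι_toSpecZero_assoc,
      Proj.awayι_toSpecZero_assoc, ← Spec.map_comp, ← Spec.map_comp, ← Spec.map_comp]
    congr 1
    ext a
    change Localization.mk (MvPolynomial.aeval ℓ (MvPolynomial.C a)) _ =
      Localization.mk (MvPolynomial.C a) _
    congr 1
    · exact MvPolynomial.aeval_C _ _
    · exact Subtype.ext (map_one (linearGradedHom ℓ hℓ))
  exact (Proj.mapAffineOpenCover _ h).openCover.hom_ext _ _ fun s => key s.1 s.1.2 s.2 s.2.2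

/-- Closed immersions are local on the target, and over a chart the map is `Spec` of the surjection
in `away_map_linearGradedHom_surjective`. -/
theorem isClosedImmersion_projMap_linearGradedHom (hsurj : ∀ i, ∃ j, ℓ j = MvPolynomial.X i) :
    IsClosedImmersion (Proj.map (linearGradedHom ℓ hℓ)
      (irrelevant_le_map_linearGradedHom hsurj)) := by
  have key : ∀ (i : ℕ) (hi : 0 < i) (f : MvPolynomial τ k)
      (hf : f ∈ MvPolynomial.homogeneousSubmodule τ k i), IsClosedImmersion (pullback.snd
        (Proj.map (linearGradedHom ℓ hℓ) (irrelevant_le_map_linearGradedHom hsurj))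
        (Proj.awayι _ f hf hi)) := by
    intro i hi f hf
    have hp : IsPullback (Spec.map (CommRingCat.ofHom (HomogeneousLocalization.Away.map
        (linearGradedHom ℓ hℓ) f)))
        (Proj.awayι _ _ ((linearGradedHom ℓ hℓ).map_mem hf) hi)
        (Proj.awayι _ _ hf hi)
        (Proj.map (linearGradedHom ℓ hℓ) (irrelevant_le_map_linearGradedHom hsurj)) := by
      apply IsOpenImmersion.isPullback
      · exact Proj.awayι_comp_map _ _ hi _ hf
      · rw [Proj.opensRange_awayι, Proj.opensRange_awayι, Proj.map_preimage_basicOpen]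
    have h1 : IsClosedImmersion (Spec.map (CommRingCat.ofHom (HomogeneousLocalization.Away.map
        (linearGradedHom ℓ hℓ) f))) :=
      IsClosedImmersion.spec_of_surjective _ (away_map_linearGradedHom_surjective hsurj hf)
    rw [← hp.flip.isoPullback_inv_snd]
    infer_instance
  exact IsZariskiLocalAtTarget.of_openCover (P := @IsClosedImmersion)
    (Proj.affineOpenCover (MvPolynomial.homogeneousSubmodule τ k)).openCover
    fun s => key s.1 s.1.2 s.2 s.2.2

/-- A linear embedding of projective spaces. -/
noncomputable def linearMap (ℓ : τ → MvPolynomial σ k) (hℓ : ∀ j, (ℓ j).IsHomogeneous 1)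
    (hsurj : ∀ i, ∃ j, ℓ j = MvPolynomial.X i) : projSpace k σ ⟶ projSpace k τ :=
  Over.homMk (Proj.map (linearGradedHom ℓ hℓ) (irrelevant_le_map_linearGradedHom hsurj))
    (projMap_linearGradedHom_comp _)

theorem HasCoords.comp_linearMap {hsurj : ∀ i, ∃ j, ℓ j = MvPolynomial.X i}
    {s : RationalPoints k (projSpace k σ)} {c : σ → k} (h : HasCoords s c) :
    HasCoords (s ≫ linearMap ℓ hℓ hsurj) (fun j => MvPolynomial.eval c (ℓ j)) := by
  intro n f hf
  have h1 := h n (linearGradedHom ℓ hℓ f) ((linearGradedHom ℓ hℓ).map_mem hf)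
  rw [RationalPoints.pt_comp]
  refine Iff.trans ?_ (h1.trans ?_)
  · rfl
  · rw [linearGradedHom_apply, ← MvPolynomial.coe_aeval_eq_eval, ← MvPolynomial.coe_aeval_eq_eval]
    simp only [RingHom.coe_coe]
    rw [← AlgHom.comp_apply, MvPolynomial.comp_aeval]

theorem mono_linearMap {hsurj : ∀ i, ∃ j, ℓ j = MvPolynomial.X i} :
    Mono (linearMap ℓ hℓ hsurj) := by
  have : IsClosedImmersion (linearMap ℓ hℓ hsurj).left :=
    isClosedImmersion_projMap_linearGradedHom hsurj
  exact Over.mono_of_mono_left _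

end LinearMaps

/-! ### Reduced closures of sets of `k`-points. -/

section ReducedClosure

/-- On a reduced scheme a function with empty non-vanishing locus is zero, so the set-theoretic
condition suffices for a scheme-theoretic factorization. -/
theorem vanishingIdeal_le_ker {X Y : Scheme.{u}} [IsReduced X] (f : X ⟶ Y)
    (Z : TopologicalSpace.Closeds Y) (hf : ∀ x, f x ∈ Z) :
    Scheme.IdealSheafData.vanishingIdeal Z ≤ f.ker := by
  rw [Scheme.Hom.ker, Scheme.IdealSheafData.le_ofIdeals_iff]
  intro U a ha
  rw [RingHom.mem_ker]
  refine (basicOpen_eq_bot_iff _).1 ?_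
  refine le_bot_iff.1 fun x hx => ?_
  have hx' : x ∈ f ⁻¹ᵁ Y.basicOpen a := by rwa [Scheme.preimage_basicOpen]
  have hxU : f x ∈ U.1 := Y.basicOpen_le a hx'
  have h1 : f x ∈ (Scheme.IdealSheafData.vanishingIdeal Z).support := by
    have : ((Scheme.IdealSheafData.vanishingIdeal Z).support : Set Y) = Z :=
      Scheme.IdealSheafData.coe_support_vanishingIdeal _
    change f x ∈ ((Scheme.IdealSheafData.vanishingIdeal Z).support : Set Y)
    rw [this]
    exact hf x
  rw [Scheme.IdealSheafData.mem_support_iff_of_mem hxU, Scheme.mem_zeroLocus_iff] at h1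
  exact h1 a ha hx'

/-- On each affine open set this is the spectrum of a quotient by a radical ideal. -/
theorem isReduced_subscheme_vanishingIdeal {Y : Scheme.{u}} (Z : TopologicalSpace.Closeds Y) :
    IsReduced (Scheme.IdealSheafData.vanishingIdeal Z).subscheme := by
  have : ∀ i, IsReduced
      ((Scheme.IdealSheafData.vanishingIdeal Z).subschemeCover.openCover.X i) := by
    intro U
    change IsReduced (Spec (.of (Γ(Y, U.1) ⧸ (Scheme.IdealSheafData.vanishingIdeal Z).ideal U)))
    have h : _root_.IsReduced (Γ(Y, U.1) ⧸ (Scheme.IdealSheafData.vanishingIdeal Z).ideal U) := by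
      rw [← Ideal.isRadical_iff_quotient_reduced]
      exact PrimeSpectrum.isRadical_vanishingIdeal _
    have : _root_.IsReduced (CommRingCat.of
      (Γ(Y, U.1) ⧸ (Scheme.IdealSheafData.vanishingIdeal Z).ideal U)) := h
    infer_instance
  exact IsReduced.of_openCover _
    (Scheme.IdealSheafData.vanishingIdeal Z).subschemeCover.openCover

variable {k : Type u} [Field k]

theorem isClosedImmersion_reducedClosureι (Y : Over (Spec (.of k)))
    (Z : Set (RationalPoints k Y)) : IsClosedImmersion (reducedClosureι Y Z).left := by
  change IsClosedImmersion (Scheme.IdealSheafData.subschemeι _)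
  infer_instance

theorem mono_reducedClosureι (Y : Over (Spec (.of k))) (Z : Set (RationalPoints k Y)) :
    Mono (reducedClosureι Y Z) := by
  have := isClosedImmersion_reducedClosureι Y Z
  exact Over.mono_of_mono_left _

theorem isProper_reducedClosure (Y : Over (Spec (.of k))) [IsProper Y.hom]
    (Z : Set (RationalPoints k Y)) : IsProper (reducedClosure Y Z).hom := by
  change IsProper (Scheme.IdealSheafData.subschemeι _ ≫ Y.hom)
  infer_instance

theorem isVariety_reducedClosure (Y : Over (Spec (.of k))) [IsProper Y.hom]
    (Z : Set (RationalPoints k Y)) : IsVariety (reducedClosure Y Z) := by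
  have := isProper_reducedClosure Y Z
  exact ⟨isReduced_subscheme_vanishingIdeal _, inferInstance, inferInstance, inferInstance⟩

theorem range_reducedClosureι (Y : Over (Spec (.of k))) (Z : Set (RationalPoints k Y)) :
    Set.range (reducedClosureι Y Z).left = closure (RationalPoints.pt '' Z) := by
  change Set.range (Scheme.IdealSheafData.subschemeι _) = _
  rw [Scheme.IdealSheafData.range_subschemeι]
  exact Scheme.IdealSheafData.coe_support_vanishingIdeal _

/-- Morphisms from a reduced scheme into the closure of a set of `k`-points. -/
theorem exists_lift_reducedClosure {Y : Over (Spec (.of k))} {Z : Set (RationalPoints k Y)}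
    {T : Over (Spec (.of k))} [IsReduced T.left] (f : T ⟶ Y)
    (hf : ∀ x, f.left x ∈ closure (RationalPoints.pt '' Z)) :
    ∃ g : T ⟶ reducedClosure Y Z, g ≫ reducedClosureι Y Z = f := by
  have h : (reducedClosureι Y Z).left.ker ≤ f.left.ker := by
    change (Scheme.IdealSheafData.subschemeι _).ker ≤ _
    rw [Scheme.IdealSheafData.ker_subschemeι]
    exact vanishingIdeal_le_ker _ _ hf
  have := isClosedImmersion_reducedClosureι Y Z
  have hfac := IsClosedImmersion.lift_fac (reducedClosureι Y Z).left f.left h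
  refine ⟨Over.homMk (IsClosedImmersion.lift (reducedClosureι Y Z).left f.left h) ?_, ?_⟩
  · rw [← Over.w (reducedClosureι Y Z), ← Category.assoc, hfac, Over.w]
  · ext1
    exact hfac

theorem exists_lift_rationalPoint {Y : Over (Spec (.of k))} {Z : Set (RationalPoints k Y)}
    {s : RationalPoints k Y} (hs : s.pt ∈ closure (RationalPoints.pt '' Z)) :
    ∃ t : RationalPoints k (reducedClosure Y Z), t ≫ reducedClosureι Y Z = s := by
  have : IsReduced (Over.mk (𝟙 (Spec (.of k)))).left :=
    inferInstanceAs (IsReduced (Spec (.of k)))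
  refine exists_lift_reducedClosure s fun x => ?_
  obtain rfl : x = IsLocalRing.closedPoint k := Subsingleton.elim (α := PrimeSpectrum k) _ _
  exact hs

theorem RationalPoints.pt_mem_closure {Y : Over (Spec (.of k))} {Z : Set (RationalPoints k Y)}
    (t : RationalPoints k (reducedClosure Y Z)) :
    RationalPoints.pt (t ≫ reducedClosureι Y Z) ∈ closure (RationalPoints.pt '' Z) := by
  rw [RationalPoints.pt_comp, ← range_reducedClosureι]
  exact Set.mem_range_self _

/-- The closed subscheme has the induced topology, and every point of `Z` lifts to it. -/
theorem dense_rationalPoints_reducedClosure (Y : Over (Spec (.of k)))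
    (Z : Set (RationalPoints k Y)) :
    Dense (Set.range fun s : RationalPoints k (reducedClosure Y Z) => s.pt) := by
  have hι := isClosedImmersion_reducedClosureι Y Z
  intro x
  rw [(reducedClosureι Y Z).left.isClosedEmbedding.isInducing.closure_eq_preimage_closure_image]
  have hx : (reducedClosureι Y Z).left x ∈ closure (RationalPoints.pt '' Z) := by
    rw [← range_reducedClosureι]
    exact Set.mem_range_self _
  refine closure_mono ?_ hx
  rintro _ ⟨s, hs, rfl⟩
  obtain ⟨t, rfl⟩ := exists_lift_rationalPoint (subset_closure (Set.mem_image_of_mem _ hs))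
  exact ⟨t.pt, ⟨t, rfl⟩, (RationalPoints.pt_comp t _).symm⟩

end ReducedClosure

/-! ### Polynomial identities between coordinates and their closure. -/

section Products

variable {k : Type u} [Field k]

theorem evalAt_of_eq_id (b : Γ(Spec (.of k), ⊤)) (f : Spec (.of k) ⟶ Spec (.of k)) (hf : f = 𝟙 _)
    (h : f (IsLocalRing.closedPoint k) ∈ (⊤ : (Spec (.of k)).Opens)) :
    evalAt f ⊤ h b = (Scheme.ΓSpecIso (.of k)).hom b := by
  subst hf
  have : ∀ hle, Scheme.Hom.appLE (𝟙 (Spec (.of k))) ⊤ ⊤ hle = 𝟙 _ := by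
    intro hle
    rw [Scheme.Hom.appLE, Scheme.Hom.id_app]
    exact (Category.id_comp _).trans ((Spec (.of k)).presheaf.map_id _)
  change (Scheme.Hom.appLE _ _ _ _ ≫ _) b = _
  exact congr(($(this _) ≫ (Scheme.ΓSpecIso (.of k)).hom) b)

/-- The constant functions on a scheme over `k`. -/
noncomputable def constFun (Y : Over (Spec (.of k))) (U : Y.left.Opens) : k →+* Γ(Y.left, U) :=
  ((Scheme.ΓSpecIso (.of k)).inv ≫ Y.hom.app ⊤ ≫
    Y.left.presheaf.map (homOfLE (le_top : U ≤ Y.hom ⁻¹ᵁ ⊤)).op).hom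

theorem evalAt_constFun {Y : Over (Spec (.of k))} (s : RationalPoints k Y) (U : Y.left.Opens)
    (h : s.pt ∈ U) (a : k) : evalAt s.left U h (constFun Y U a) = a := by
  change evalAt s.left U h (Y.left.presheaf.map (homOfLE (le_top : U ≤ Y.hom ⁻¹ᵁ ⊤)).op
    (Y.hom.app ⊤ ((Scheme.ΓSpecIso (.of k)).inv a))) = a
  refine (evalAt_map s.left le_top h _).trans ?_
  refine (evalAt_comp s.left Y.hom ⊤ trivial _).symm.trans ?_
  refine (evalAt_of_eq_id _ _ s.left_comp_hom _).trans ?_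
  exact (Scheme.ΓSpecIso (.of k)).inv_hom_id_apply a

attribute [local instance] MvPolynomial.gradedAlgebra

theorem RationalPoints.coord_self {σ : Type} (s : RationalPoints k (projSpace k σ)) (I : σ)
    (h : s.pt ∈ chart k I) : s.coord I h I = 1 := by
  have : (HomogeneousLocalization.Away.mk (MvPolynomial.homogeneousSubmodule σ k)
      (X_mem_homogeneousSubmodule I) 1 (MvPolynomial.X I)
      (X_mem_homogeneousSubmodule I)) = 1 := by
    apply HomogeneousLocalization.val_injective
    rw [HomogeneousLocalization.Away.val_mk, HomogeneousLocalization.val_one]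
    simp only [pow_one]
    exact Localization.mk_self (⟨_, _⟩ : Submonoid.powers (MvPolynomial.X I : MvPolynomial σ k))
  rw [RationalPoints.coord, chartCoord, this, map_one]
  exact map_one _

theorem HasCoords.mem_chart_iff {σ : Type} {s : RationalPoints k (projSpace k σ)} {c : σ → k}
    (hs : HasCoords s c) (I : σ) : s.pt ∈ chart k I ↔ c I ≠ 0 := by
  have := hs 1 (MvPolynomial.X I) (MvPolynomial.isHomogeneous_X _ _)
  rwa [MvPolynomial.eval_X] at this

theorem HasCoords.eq_coord {σ : Type} {s : RationalPoints k (projSpace k σ)} {c : σ → k}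
    (hs : HasCoords s c) (I : σ) (hI : c I = 1) (h : s.pt ∈ chart k I) : c = s.coord I h := by
  obtain ⟨a, -, ha2⟩ := (s.hasCoords_coord I h).eq_smul hs
  have h1 := congrFun ha2 I
  rw [hI, Pi.smul_apply, s.coord_self, smul_eq_mul, mul_one] at h1
  rw [ha2, ← h1, one_smul]

/-- A `k`-point of projective space has homogeneous coordinates, one of which is equal to one. -/
theorem RationalPoints.exists_hasCoords_eq_one {σ : Type} (s : RationalPoints k (projSpace k σ)) :
    ∃ (I : σ) (c : σ → k), HasCoords s c ∧ c I = 1 := by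
  suffices ∃ I, s.pt ∈ chart k I by
    obtain ⟨I, hI⟩ := this
    exact ⟨I, _, s.hasCoords_coord I hI, s.coord_self I hI⟩
  by_contra! hcon
  have hle : HomogeneousIdeal.irrelevant (MvPolynomial.homogeneousSubmodule σ k) ≤
      ProjectiveSpectrum.asHomogeneousIdeal (s.pt : ProjectiveSpectrum _) := by
    rw [HomogeneousIdeal.irrelevant_le]
    intro i hi f hf
    have hf' : f.IsHomogeneous i := hf
    have h0 := hf'.coeff_eq_zero (d := 0) (by simpa using hi.ne)
    -- A polynomial without constant term lies in the ideal of the variables; if all variables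
    -- vanished at `s`, its prime would contain the irrelevant ideal.
    have hmem : f ∈ Ideal.span (MvPolynomial.X '' (Set.univ : Set σ)) := by
      rw [MvPolynomial.mem_ideal_span_X_image]
      intro m hm
      by_contra! h
      have hm0 : m = 0 := Finsupp.ext fun j => h j trivial
      rw [hm0] at hm
      exact MvPolynomial.mem_support_iff.1 hm h0
    refine Ideal.span_le.2 ?_ hmem
    rintro _ ⟨I, -, rfl⟩
    exact not_not.1 (hcon I)
  exact (s.pt : ProjectiveSpectrum _).not_irrelevant_le hle

theorem map_eval₂_of_leftInverse {k R ι : Type*} [CommRing k] [CommRing R] (φ : R →+* k)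
    (g : k →+* R) (hg : ∀ a, φ (g a) = a) {y : ι → R} {v : ι → k} (hy : ∀ i, φ (y i) = v i)
    (P : MvPolynomial ι k) : φ (MvPolynomial.eval₂ g y P) = MvPolynomial.eval v P := by
  rw [MvPolynomial.hom_eval₂, ← MvPolynomial.eval₂_id]
  congr 1
  · ext a
    exact hg a
  · ext i
    exact hy i

/-- The pull-back of the function `X_J / X_I`. -/
noncomputable def pullbackCoord {σ : Type} {Y : Over (Spec (.of k))}
    (π : Y ⟶ projSpace k σ) (I J : σ) (U : Y.left.Opens)
    (hU : U ≤ π.left ⁻¹ᵁ chart k I) : Γ(Y.left, U) :=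
  Y.left.presheaf.map (homOfLE hU).op (π.left.app _ (chartCoord k I J))

theorem evalAt_pullbackCoord {σ : Type} {Y : Over (Spec (.of k))}
    (π : Y ⟶ projSpace k σ) (I J : σ) (U : Y.left.Opens)
    (hU : U ≤ π.left ⁻¹ᵁ chart k I) (t : RationalPoints k Y)
    (ht : RationalPoints.pt (t ≫ π) ∈ chart k I) (htU : t.pt ∈ U) :
    evalAt t.left U htU (pullbackCoord π I J U hU) = RationalPoints.coord (t ≫ π) I ht J := by
  refine (evalAt_map t.left hU htU _).trans ?_
  exact (evalAt_comp t.left π.left _ ht _).symm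

/-- The function is `P` evaluated at the pull-backs of the fractions `X_J / X_I`. Its values are the
values of `P` at the coordinates normalized at `I`. -/
theorem exists_evalAt_eq_eval {ι : Type} {σ : ι → Type} {Y : Over (Spec (.of k))}
    (π : ∀ i, Y ⟶ projSpace k (σ i)) (I : ∀ i, σ i) (U : Y.left.Opens)
    (hU : ∀ i, U ≤ (π i).left ⁻¹ᵁ chart k (I i)) (P : MvPolynomial (Σ i, σ i) k) :
    ∃ p : Γ(Y.left, U), ∀ (t : RationalPoints k Y) (htU : t.pt ∈ U) (c : ∀ i, σ i → k),
      (∀ i, HasCoords (t ≫ π i) (c i)) → (∀ i, c i (I i) = 1) →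
      evalAt t.left U htU p = MvPolynomial.eval (fun x : Σ i, σ i => c x.1 x.2) P :=
  ⟨MvPolynomial.eval₂ (constFun Y U)
      (fun x : Σ i, σ i => pullbackCoord (π x.1) (I x.1) x.2 U (hU x.1)) P,
    fun t htU c hc hI => map_eval₂_of_leftInverse (evalAt t.left U htU) (constFun Y U)
      (evalAt_constFun t U htU) (fun x => by
        have ht : RationalPoints.pt (t ≫ π x.1) ∈ chart k (I x.1) := hU x.1 htU
        rw [(hc x.1).eq_coord (I x.1) (hI x.1) ht]
        exact evalAt_pullbackCoord (π x.1) (I x.1) x.2 U (hU x.1) t ht htU) P⟩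

theorem exists_opens_forall_mem_iff {ι X : Type*} [Finite ι] [TopologicalSpace X]
    (W : ι → TopologicalSpace.Opens X) :
    ∃ U : TopologicalSpace.Opens X, ∀ x, x ∈ U ↔ ∀ i, x ∈ W i :=
  ⟨⟨⋂ i, (W i : Set X), isOpen_iInter_of_finite fun i => (W i).isOpen⟩,
    fun _ => Set.mem_iInter⟩

/-- A polynomial equation between normalized coordinates which holds on a set of `k`-points also
holds on its closure. -/
theorem eval_eq_zero_of_mem_closure {ι : Type} [Finite ι] {σ : ι → Type}
    {Y : Over (Spec (.of k))} (π : ∀ i, Y ⟶ projSpace k (σ i))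
    {Z : Set (RationalPoints k Y)} {s : RationalPoints k Y}
    (hs : s.pt ∈ closure (RationalPoints.pt '' Z)) (I : ∀ i, σ i) (c : ∀ i, σ i → k)
    (hc : ∀ i, HasCoords (s ≫ π i) (c i)) (hI : ∀ i, c i (I i) = 1)
    (P : MvPolynomial (Σ i, σ i) k)
    (hP : ∀ t ∈ Z, ∀ c' : ∀ i, σ i → k, (∀ i, HasCoords (t ≫ π i) (c' i)) →
      (∀ i, c' i (I i) = 1) → MvPolynomial.eval (fun x : Σ i, σ i => c' x.1 x.2) P = 0) :
    MvPolynomial.eval (fun x : Σ i, σ i => c x.1 x.2) P = 0 := by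
  obtain ⟨U, hUmem⟩ : ∃ U : Y.left.Opens, ∀ x, x ∈ U ↔ ∀ i, x ∈ (π i).left ⁻¹ᵁ chart k (I i) :=
    exists_opens_forall_mem_iff _
  have hU : ∀ i, U ≤ (π i).left ⁻¹ᵁ chart k (I i) := fun i x hx => (hUmem x).1 hx i
  obtain ⟨p, hval⟩ := exists_evalAt_eq_eval π I U hU P
  have hsU : s.pt ∈ U := (hUmem _).2 fun i =>
    ((hc i).mem_chart_iff (I i)).2 (by rw [hI]; exact one_ne_zero)
  by_contra hne
  rw [← hval s hsU c hc hI] at hne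
  -- If `P` were nonzero at `s`, the open set where `p` is nonzero would be a neighbourhood of `s`
  -- and would meet `Z`, where `P` vanishes.
  obtain ⟨_, hx, t, htZ, rfl⟩ := mem_closure_iff.1 hs _
    (Y.left.basicOpen p).isOpen ((mem_basicOpen_iff_evalAt_ne_zero s.left U hsU _).2 hne)
  have htU : t.pt ∈ U := Y.left.basicOpen_le _ hx
  refine (mem_basicOpen_iff_evalAt_ne_zero t.left U htU _).1 hx ?_
  have hmem : ∀ i, RationalPoints.pt (t ≫ π i) ∈ chart k (I i) := fun i => hU i htU
  have h : ∀ i, ∃ c' : σ i → k, HasCoords (t ≫ π i) c' ∧ c' (I i) = 1 := fun i =>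
    ⟨_, RationalPoints.hasCoords_coord (t ≫ π i) (I i) (hmem i),
      RationalPoints.coord_self (t ≫ π i) (I i) (hmem i)⟩
  choose c' h1 h2 using h
  exact (hval t htU c' h1 h2).trans (hP t htZ c' h1 h2)

theorem eq_of_hasCoords_pi {ι : Type} [Finite ι] {σ : ι → Type}
    {s t : RationalPoints k (∏ᶜ fun i => projSpace k (σ i))}
    (h : ∀ i, ∃ c, HasCoords (s ≫ Pi.π (fun i => projSpace k (σ i)) i) c ∧
      HasCoords (t ≫ Pi.π (fun i => projSpace k (σ i)) i) c) : s = t := by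
  refine Pi.hom_ext _ _ fun i => ?_
  obtain ⟨c, h1, h2⟩ := h i
  exact h1.eq_of_hasCoords h2

end Products

/-! ### Normalized minors and the equations of flags. -/

section Minors

variable {k : Type u} [Field k] {V : Type v} [AddCommGroup V] [Module k V] {κ : Type}
  (e : Module.Basis κ k V) {B : Finset κ} {i : ℕ}

/-- The maximal minors of the coordinates of the vectors `g b`. -/
noncomputable def minors (g : Fin i → V) (I : Fin i → B) : k :=
  Matrix.det (Matrix.of fun a b => e.repr (g b) (I a))

/-- The vectors spanning the space with the maximal minors `c`, where `c I = 1`. -/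
noncomputable def column (c : (Fin i → B) → k) (I : Fin i → B) (b : Fin i) : V :=
  ∑ x : B, c (Function.update I b x) • e x

theorem repr_column (c : (Fin i → B) → k) (I : Fin i → B) (b : Fin i) (x : B) :
    e.repr (column e c I b) x = c (Function.update I b x) := by
  classical
  simp only [column, map_sum, map_smul, Module.Basis.repr_self, Finsupp.coe_finsetSum,
    Finset.sum_apply, Finsupp.smul_single, smul_eq_mul, mul_one, Finsupp.single_apply]
  rw [Finset.sum_eq_single x _ (fun h => absurd (Finset.mem_univ _) h), if_pos rfl]
  exact fun y _ hy => if_neg fun h => hy (Subtype.ext h)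

theorem column_mem_spanOf (c : (Fin i → B) → k) (I : Fin i → B) (b : Fin i) :
    column e c I b ∈ spanOf e B :=
  Submodule.sum_mem _ fun x _ => Submodule.smul_mem _ _ (Submodule.subset_span ⟨x, x.2, rfl⟩)

theorem mem_spanOf_iff {x : V} : x ∈ spanOf e B ↔ ∀ b, b ∉ B → e.repr x b = 0 := by
  rw [spanOf, Module.Basis.mem_span_image]
  constructor
  · intro h b hb
    by_contra hne
    exact hb (h (Finsupp.mem_support_iff.2 hne))
  · intro h b hb
    by_contra hne
    exact Finsupp.mem_support_iff.1 hb (h b hne)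

theorem sum_repr_smul_of_mem_spanOf {x : V} (hx : x ∈ spanOf e B) :
    ∑ b : B, e.repr x b • e b = x := by
  classical
  apply e.repr.injective
  ext b
  simp only [map_sum, map_smul, Module.Basis.repr_self, Finsupp.coe_finsetSum,
    Finset.sum_apply, Finsupp.smul_single, smul_eq_mul, mul_one, Finsupp.single_apply]
  by_cases hb : b ∈ B
  · rw [Finset.sum_eq_single ⟨b, hb⟩ _ (fun h => absurd (Finset.mem_univ _) h), if_pos rfl]
    exact fun y _ hy => if_neg fun h => hy (Subtype.ext h)
  · rw [(mem_spanOf_iff e).1 hx b hb]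
    refine Finset.sum_eq_zero fun y _ => if_neg ?_
    rintro rfl
    exact hb y.2

theorem ext_of_mem_spanOf {x y : V} (hx : x ∈ spanOf e B) (hy : y ∈ spanOf e B)
    (h : ∀ b : B, e.repr x b = e.repr y b) : x = y := by
  rw [← sum_repr_smul_of_mem_spanOf e hx, ← sum_repr_smul_of_mem_spanOf e hy]
  simp only [h]

instance finiteDimensional_spanOf : FiniteDimensional k (spanOf e B) :=
  FiniteDimensional.span_of_finite k (B.finite_toSet.image e)

/-- Row rank equals column rank, so the coordinate matrix has `i` independent rows. -/
theorem exists_minors_ne_zero {g : Fin i → V} (hg : LinearIndependent k g)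
    (hgB : ∀ b, g b ∈ spanOf e B) : ∃ I : Fin i → B, minors e g I ≠ 0 := by
  classical
  let M : Matrix B (Fin i) k := Matrix.of fun x b => e.repr (g b) x
  have hrow : LinearIndependent k M.transpose.row := by
    rw [Fintype.linearIndependent_iff]
    intro a ha
    refine Fintype.linearIndependent_iff.1 hg a ?_
    refine ext_of_mem_spanOf e (Submodule.sum_mem _ fun b _ => Submodule.smul_mem _ _ (hgB b))
      (Submodule.zero_mem _) fun x => ?_
    have := congrFun ha x
    simpa [M, Finset.sum_apply] using this
  have hrank : Module.finrank k (Submodule.span k (Set.range M.row)) = i := by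
    rw [← Matrix.rank_eq_finrank_span_row, ← Matrix.rank_transpose, hrow.rank_matrix,
      Fintype.card_fin]
  obtain ⟨f, hf, -, hli⟩ := Submodule.exists_fun_fin_finrank_span_eq k (Set.range M.row)
  choose I hI using hf
  refine ⟨fun a => I (Fin.cast hrank.symm a), ?_⟩
  have h2 : LinearIndependent k (M.submatrix (fun a => I (Fin.cast hrank.symm a)) id).row := by
    have h3 := hli.comp _ (Fin.cast_injective hrank.symm)
    have h4 : f ∘ Fin.cast hrank.symm =
        (M.submatrix (fun a => I (Fin.cast hrank.symm a)) id).row := by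
      funext a
      exact (hI _).symm
    rwa [h4] at h3
  rw [Matrix.linearIndependent_rows_iff_isUnit, Matrix.isUnit_iff_isUnit_det] at h2
  exact h2.ne_zero

/-- The coordinates of these vectors at the indices `I` form the identity matrix. -/
theorem linearIndependent_column {c : (Fin i → B) → k} {I : Fin i → B}
    (h : ∀ a b, c (Function.update I b (I a)) = if a = b then 1 else 0) :
    LinearIndependent k (column e c I) := by
  classical
  rw [Fintype.linearIndependent_iff]
  intro a ha j
  have := congr(e.repr $ha (I j))
  simpa [repr_column, h] using this

theorem finrank_span_column {c : (Fin i → B) → k} {I : Fin i → B}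
    (h : ∀ a b, c (Function.update I b (I a)) = if a = b then 1 else 0) :
    Module.finrank k (Submodule.span k (Set.range (column e c I))) = i := by
  rw [finrank_span_eq_card (linearIndependent_column e h), Fintype.card_fin]

variable {e} in
/-- The normalized minors satisfy the equations of the Grassmannian. -/
theorem minors_normalized {g : Fin i → V} {c : (Fin i → B) → k} {I : Fin i → B}
    {z : k} (hc : c = z • minors e g) (hI : c I = 1) :
    (∀ a b, c (Function.update I b (I a)) = if a = b then 1 else 0) ∧
    (∀ J, c J = Matrix.det (Matrix.of fun a b => c (Function.update I b (J a)))) := by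
  classical
  let M : (Fin i → B) → Matrix (Fin i) (Fin i) k := fun J => Matrix.of fun a b => e.repr (g b) (J a)
  have hdet : z * (M I).det = 1 := by rw [hc] at hI; exact hI
  have hinv : (M I)⁻¹.det = z := by
    rw [Matrix.det_nonsing_inv, Ring.inverse_eq_inv']
    exact inv_eq_of_mul_eq_one_left hdet
  have hu : IsUnit (M I).det := IsUnit.of_mul_eq_one_right _ hdet
  -- The scalar `z` is the determinant of the inverse of the `I`-block, so `c` consists of the
  -- minors of the basis changed to have the identity as its `I`-block.
  have h1 : ∀ J, c J = (M J * (M I)⁻¹).det := by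
    intro J
    rw [Matrix.det_mul, hinv, hc, mul_comm]
    rfl
  have h2 : ∀ b x, M (Function.update I b x) = (M I).updateRow b (fun j => e.repr (g j) x) := by
    intro b x
    ext a j
    by_cases hab : a = b
    · subst hab; simp [M]
    · simp [M, hab]
  have h3 : ∀ b x, c (Function.update I b x) =
      Matrix.vecMul (fun j => e.repr (g j) x) (M I)⁻¹ b := by
    intro b x
    rw [h1, h2]
    -- Exchanging one index of `I` changes one row of the identity matrix, and the determinant is
    -- then a single entry of the new row.
    have : (M I).updateRow b (fun j => e.repr (g j) x) * (M I)⁻¹ = (1 : Matrix _ _ k).updateRow b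
        (Matrix.vecMul (fun j => e.repr (g j) x) (M I)⁻¹) := by
      rw [← Matrix.mul_nonsing_inv _ hu, Matrix.updateRow_mul]
    rw [this, ← Matrix.cramer_transpose_apply, Matrix.transpose_one, Matrix.cramer_one]
    rfl
  have h4 : ∀ J, Matrix.of (fun a b => c (Function.update I b (J a))) = M J * (M I)⁻¹ := by
    intro J
    ext a b
    rw [Matrix.of_apply, h3]
    rfl
  refine ⟨fun a b => ?_, fun J => by rw [h4, h1]⟩
  have := congr($(h4 I) a b)
  rw [Matrix.mul_nonsing_inv _ hu, Matrix.one_apply] at this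
  exact this

variable {e} in
-- Expanding the minors along the exchanged row writes each column vector as a combination of the `g
-- j` with cofactors as coefficients. The dimensions agree, so the inclusion of spans is an
-- equality.
theorem span_column_minors {g : Fin i → V} (hg : LinearIndependent k g)
    (hgB : ∀ b, g b ∈ spanOf e B) {c : (Fin i → B) → k} {I : Fin i → B}
    {z : k} (hc : c = z • minors e g) (hI : c I = 1) :
    Submodule.span k (Set.range (column e c I)) = Submodule.span k (Set.range g) := by
  classical
  have : FiniteDimensional k (Submodule.span k (Set.range g)) :=
    FiniteDimensional.span_of_finite k (Set.finite_range g)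
  refine Submodule.eq_of_le_of_finrank_eq ?_ ?_
  swap
  · rw [finrank_span_column e (minors_normalized hc hI).1, finrank_span_eq_card hg,
      Fintype.card_fin]
  rw [Submodule.span_le]
  rintro _ ⟨b, rfl⟩
  have : column e c I b = ∑ j, (z * Matrix.cramer
      (Matrix.of fun a b => e.repr (g b) (I a)).transpose (Pi.single j 1) b) • g j := by
    refine ext_of_mem_spanOf e (column_mem_spanOf e _ _ _)
      (Submodule.sum_mem _ fun j _ => Submodule.smul_mem _ _ (hgB j)) fun x => ?_
    have h2 : (Matrix.of fun a j => e.repr (g j) (Function.update I b x a)) =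
        (Matrix.of fun a j => e.repr (g j) (I a)).updateRow b (fun j => e.repr (g j) x) := by
      ext a j
      by_cases hab : a = b
      · subst hab; simp
      · simp [hab]
    rw [repr_column, hc, Pi.smul_apply, minors, h2, ← Matrix.cramer_transpose_apply]
    have h3 : (fun j => e.repr (g j) x) = ∑ j, e.repr (g j) x • Pi.single j (1 : k) := by
      ext j; simp [Finset.sum_apply, Pi.single_apply]
    rw [h3]
    simp only [map_sum, map_smul, Finset.sum_apply, Pi.smul_apply, smul_eq_mul, Finset.mul_sum,
      Finsupp.coe_finsetSum, Finsupp.coe_smul]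
    refine Finset.sum_congr rfl fun j _ => ?_
    ring
  rw [this]
  exact Submodule.sum_mem _ fun j _ =>
    Submodule.smul_mem _ _ (Submodule.subset_span (Set.mem_range_self j))

/-- Incidence of subspaces in terms of normalized minors. -/
theorem span_column_le_iff {j : ℕ} {c : (Fin i → B) → k} {I : Fin i → B}
    {c' : (Fin j → B) → k} {J : Fin j → B}
    (h' : ∀ a b, c' (Function.update J b (J a)) = if a = b then 1 else 0) :
    Submodule.span k (Set.range (column e c I)) ≤ Submodule.span k (Set.range (column e c' J)) ↔
      ∀ a (x : B), c (Function.update I a x) =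
        ∑ b, c (Function.update I a (J b)) * c' (Function.update J b x) := by
  classical
  constructor
  · intro hle a x
    have hmem := hle (Submodule.subset_span (Set.mem_range_self a))
    obtain ⟨m, hm⟩ := (Submodule.mem_span_range_iff_exists_fun k).1 hmem
    have hm2 : ∀ y : B, c (Function.update I a y) = ∑ b, m b * c' (Function.update J b y) := by
      intro y
      rw [← repr_column e c, ← hm]
      simp [repr_column]
    -- The second family is normalized at `J`, so the coordinates at `J` are the coefficients.
    have hm3 : ∀ b, c (Function.update I a (J b)) = m b := by
      intro b
      rw [hm2]
      simp [h']
    simp only [hm3]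
    exact hm2 x
  · intro h
    rw [Submodule.span_le]
    rintro _ ⟨a, rfl⟩
    have : column e c I a = ∑ b, c (Function.update I a (J b)) • column e c' J b := by
      refine ext_of_mem_spanOf e (column_mem_spanOf e _ _ _) (Submodule.sum_mem _ fun j _ =>
        Submodule.smul_mem _ _ (column_mem_spanOf e _ _ _)) fun x => ?_
      rw [repr_column, h]
      simp [repr_column]
    rw [this]
    exact Submodule.sum_mem _ fun b _ =>
      Submodule.smul_mem _ _ (Submodule.subset_span (Set.mem_range_self b))

/-- Orthogonality of subspaces in terms of normalized minors. -/
theorem orthogonal_span_column_iff (w : LinearMap.BilinForm k V) {j : ℕ} {c : (Fin i → B) → k}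
    {I : Fin i → B} {c' : (Fin j → B) → k} {J : Fin j → B} :
    (∀ x ∈ Submodule.span k (Set.range (column e c I)),
      ∀ y ∈ Submodule.span k (Set.range (column e c' J)), w x y = 0) ↔
      ∀ a b, ∑ x : B, ∑ y : B, c (Function.update I a x) * c' (Function.update J b y) *
        w (e x) (e y) = 0 := by
  have key : ∀ a b, w (column e c I a) (column e c' J b) = ∑ x : B, ∑ y : B,
      c (Function.update I a x) * c' (Function.update J b y) * w (e x) (e y) := by
    intro a b
    simp only [column, map_sum, map_smul, LinearMap.sum_apply, LinearMap.smul_apply, smul_eq_mul,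
      Finset.mul_sum]
    rw [Finset.sum_comm]
    refine Finset.sum_congr rfl fun x _ => Finset.sum_congr rfl fun y _ => ?_
    ring
  simp only [← key]
  constructor
  · intro h a b
    exact h _ (Submodule.subset_span (Set.mem_range_self a)) _
      (Submodule.subset_span (Set.mem_range_self b))
  · intro h x hx y hy
    induction hx using Submodule.span_induction with
    | mem x hx =>
      obtain ⟨a, rfl⟩ := hx
      induction hy using Submodule.span_induction with
      | mem y hy => obtain ⟨b, rfl⟩ := hy; exact h a b
      | zero => simp
      | add y z _ _ h1 h2 => rw [map_add, h1, h2, add_zero]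
      | smul r y _ h1 => rw [map_smul, h1, smul_zero]
    | zero => simp
    | add y z _ _ h1 h2 => rw [map_add, LinearMap.add_apply, h1, h2, add_zero]
    | smul r y _ h1 => rw [map_smul, LinearMap.smul_apply, h1, smul_zero]

/-- The minors of the normalized basis. -/
theorem minors_column {c : (Fin i → B) → k} {I : Fin i → B}
    (h : ∀ J, c J = Matrix.det (Matrix.of fun a b => c (Function.update I b (J a)))) :
    minors e (column e c I) = c := by
  funext J
  rw [h J, minors]
  simp only [repr_column]

end Minors

/-! ### The `k`-points of flag varieties. -/

section FlagPoints

variable {k : Type u} [Field k] {V : Type v} [AddCommGroup V] [Module k V] {κ : Type}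
  (e : Module.Basis κ k V) {B : Finset κ} {d : Finset ℕ} {H H' : Set (Submodule k V)}

/-- Flags of type `d` in `V_B` such that the members of dimensions `i` and `j` are orthogonal
whenever `R i j`. -/
def FlRel (w : LinearMap.BilinForm k V) (R : ℕ → ℕ → Prop) (B : Finset κ) (d : Finset ℕ) :
    Set (Set (Submodule k V)) :=
  {H | H ∈ FlFin e B d ∧ ∀ A ∈ H, ∀ C ∈ H, R (Module.finrank k A) (Module.finrank k C) →
    ∀ x ∈ A, ∀ y ∈ C, w x y = 0}

variable {e}

theorem FlFin.finiteDimensional (hH : H ∈ FlFin e B d) {A : Submodule k V} (hA : A ∈ H) :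
    FiniteDimensional k A :=
  Submodule.finiteDimensional_of_le (hH.2.1 A hA)

theorem FlFin.le_of_finrank_le (hH : H ∈ FlFin e B d) {A C : Submodule k V} (hA : A ∈ H)
    (hC : C ∈ H) (h : Module.finrank k A ≤ Module.finrank k C) : A ≤ C := by
  have := FlFin.finiteDimensional hH hA
  have := FlFin.finiteDimensional hH hC
  rcases eq_or_ne A C with rfl | hne
  · exact le_rfl
  rcases hH.1 hA hC hne with hle | hle
  · exact hle
  · exact (Submodule.eq_of_le_of_finrank_le hle h).ge

theorem FlFin.eq_of_finrank_eq (hH : H ∈ FlFin e B d) {A C : Submodule k V} (hA : A ∈ H)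
    (hC : C ∈ H) (h : Module.finrank k A = Module.finrank k C) : A = C :=
  le_antisymm (FlFin.le_of_finrank_le hH hA hC h.le) (FlFin.le_of_finrank_le hH hC hA h.ge)

theorem FlFin.finrank_mem (hH : H ∈ FlFin e B d) {A : Submodule k V} (hA : A ∈ H) :
    Module.finrank k A ∈ d := by
  have : Module.finrank k A ∈ (fun A : Submodule k V => Module.finrank k A) '' H := ⟨A, hA, rfl⟩
  rw [hH.2.2] at this
  exact this

theorem FlFin.exists_finrank_eq (hH : H ∈ FlFin e B d) {i : ℕ} (hi : i ∈ d) :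
    ∃ A ∈ H, Module.finrank k A = i := by
  have : i ∈ (d : Set ℕ) := hi
  rwa [← hH.2.2] at this

theorem exists_isPlueckerPoint (hH : H ∈ FlFin e B d) :
    ∃ s, IsPlueckerPoint e B d H s := by
  have hg : ∀ i : d, ∃ g : Fin i → V, LinearIndependent k g ∧
      Submodule.span k (Set.range g) ∈ H ∧ ∃ t : RationalPoints k (projSpace k (Fin i → B)),
      HasCoords t (minors e g) := by
    intro i
    obtain ⟨A, hA, hAi⟩ := FlFin.exists_finrank_eq hH i.2
    have := FlFin.finiteDimensional hH hA
    let b := Module.finBasisOfFinrankEq k A hAi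
    have hli : LinearIndependent k (fun a => (b a : V)) :=
      b.linearIndependent.map' A.subtype A.ker_subtype
    have hspan : Submodule.span k (Set.range fun a => (b a : V)) = A := by
      have h1 : (Set.range fun a => (b a : V)) = A.subtype '' Set.range b := by
        rw [← Set.range_comp]; rfl
      rw [h1, Submodule.span_image, b.span_eq, Submodule.map_top, Submodule.range_subtype]
    obtain ⟨I, hI⟩ := exists_minors_ne_zero e hli (fun a => hH.2.1 A hA (b a).2)
    refine ⟨_, hli, by rwa [hspan], exists_hasCoords fun h0 => hI (congrFun h0 I)⟩
  choose g hg1 hg2 t ht using hg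
  refine ⟨Pi.lift t, fun i => ⟨g i, hg1 i, hg2 i, ?_⟩⟩
  have h : Pi.lift t ≫ Pi.π (fun i : d => projSpace k (Fin i → B)) i = t i := limit.lift_π _ _
  have h2 := ht i
  rw [← h] at h2
  exact h2

theorem mem_of_span_mem (hH : H ∈ FlFin e B d) {i : ℕ} {g : Fin i → V}
    (hg : Submodule.span k (Set.range g) ∈ H) (a : Fin i) : g a ∈ spanOf e B :=
  hH.2.1 _ hg (Submodule.subset_span (Set.mem_range_self a))

/-- The factor is the determinant of the matrix expressing one family in the other. -/
theorem minors_eq_smul {i : ℕ} {g g' : Fin i → V}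
    (h : Submodule.span k (Set.range g') ≤ Submodule.span k (Set.range g)) :
    ∃ z : k, (minors e g' : (Fin i → B) → k) = z • minors e g := by
  have : ∀ a, ∃ m : Fin i → k, ∑ b, m b • g b = g' a := fun a =>
    (Submodule.mem_span_range_iff_exists_fun k).1 (h (Submodule.subset_span ⟨a, rfl⟩))
  choose m hm using this
  refine ⟨(Matrix.of fun b a => m a b).det, funext fun I => ?_⟩
  rw [Pi.smul_apply, smul_eq_mul, mul_comm, minors, minors, ← Matrix.det_mul]
  congr 1
  ext a b
  rw [Matrix.mul_apply, Matrix.of_apply, ← hm]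
  simp [mul_comm]

theorem IsPlueckerPoint.point_unique (hH : H ∈ FlFin e B d)
    {s s' : RationalPoints k (plueckerSpace k B d)} (hs : IsPlueckerPoint e B d H s)
    (hs' : IsPlueckerPoint e B d H s') : s = s' := by
  refine eq_of_hasCoords_pi fun i => ?_
  obtain ⟨g, hg1, hg2, hg3⟩ := hs i
  obtain ⟨g', hg1', hg2', hg3'⟩ := hs' i
  have heq := FlFin.eq_of_finrank_eq hH hg2' hg2
    (by rw [finrank_span_eq_card hg1, finrank_span_eq_card hg1'])
  obtain ⟨z, hz⟩ := minors_eq_smul (e := e) (B := B) heq.le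
  have hz0 : z ≠ 0 := by
    rintro rfl
    exact hg3'.ne_zero (hz.trans (zero_smul _ _))
  refine ⟨_, hg3, ?_⟩
  have := hg3'.smul (inv_ne_zero hz0)
  change HasCoords _ (z⁻¹ • minors e g') at this
  rwa [hz, inv_smul_smul₀ hz0] at this

/-- Recovers the members of a flag from its Plücker point, which gives injectivity of the embedding,
and collects the Grassmannian equations needed for its closedness. -/
theorem IsPlueckerPoint.normalized (hH : H ∈ FlFin e B d)
    {s : RationalPoints k (plueckerSpace k B d)} (hs : IsPlueckerPoint e B d H s) (i : d)
    {c : (Fin i → B) → k}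
    (hc : HasCoords (s ≫ Pi.π (fun i : d => projSpace k (Fin i → B)) i) c) {I : Fin i → B}
    (hI : c I = 1) :
    Submodule.span k (Set.range (column e c I)) ∈ H ∧
    (∀ a b, c (Function.update I b (I a)) = if a = b then 1 else 0) ∧
    (∀ J, c J = Matrix.det (Matrix.of fun a b => c (Function.update I b (J a)))) := by
  obtain ⟨g, hg1, hg2, hg3⟩ := hs i
  obtain ⟨z, -, hz⟩ := HasCoords.eq_smul (c := minors e g) hg3 hc
  rw [span_column_minors hg1 (mem_of_span_mem hH hg2) hz hI]
  exact ⟨hg2, minors_normalized hz hI⟩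

theorem IsPlueckerPoint.flag_le (hH : H ∈ FlFin e B d) (hH' : H' ∈ FlFin e B d)
    {s : RationalPoints k (plueckerSpace k B d)} (hs : IsPlueckerPoint e B d H s)
    (hs' : IsPlueckerPoint e B d H' s) : H ⊆ H' := by
  intro A hA
  obtain ⟨I, c, hc, hI⟩ := RationalPoints.exists_hasCoords_eq_one
    (s ≫ Pi.π (fun i : d => projSpace k (Fin i → B)) ⟨_, FlFin.finrank_mem hH hA⟩)
  obtain ⟨h1, h2, -⟩ := hs.normalized hH _ hc hI
  rw [FlFin.eq_of_finrank_eq hH hA h1 (finrank_span_column e h2).symm]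
  exact (hs'.normalized hH' _ hc hI).1

theorem IsPlueckerPoint.flag_unique (hH : H ∈ FlFin e B d) (hH' : H' ∈ FlFin e B d)
    {s : RationalPoints k (plueckerSpace k B d)} (hs : IsPlueckerPoint e B d H s)
    (hs' : IsPlueckerPoint e B d H' s) : H = H' :=
  (hs.flag_le hH hH' hs').antisymm (hs'.flag_le hH' hH hs)

/-- The set of the images of flags under the Plücker embedding is closed. -/
theorem exists_flag_of_mem_closure {w : LinearMap.BilinForm k V} {R : ℕ → ℕ → Prop}
    {s : RationalPoints k (plueckerSpace k B d)}
    (hs : s.pt ∈ closure (RationalPoints.pt ''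
      {s | ∃ H ∈ FlRel e w R B d, IsPlueckerPoint e B d H s})) :
    ∃ H ∈ FlRel e w R B d, IsPlueckerPoint e B d H s := by
  choose I c hc hI using fun i : d => RationalPoints.exists_hasCoords_eq_one
    (s ≫ Pi.π (fun i : d => projSpace k (Fin i → B)) i)
  -- The choice of `I` fixes a chart around `s`; an equation that holds at all flags in this chart
  -- holds at `s`. It is applied below to the equations of the Grassmannian (`h1`, `h2`), of
  -- incidence (`h3`) and of orthogonality (`h4`).
  have close : ∀ P : MvPolynomial (Σ i : d, Fin i → B) k,
      (∀ H ∈ FlRel e w R B d, ∀ t, IsPlueckerPoint e B d H t → ∀ c' : ∀ i : d, (Fin i → B) → k,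
        (∀ i : d, HasCoords (t ≫ Pi.π (fun i : d => projSpace k (Fin i → B)) i) (c' i)) →
        (∀ i, c' i (I i) = 1) →
        MvPolynomial.eval (fun x : Σ i : d, Fin i → B => c' x.1 x.2) P = 0) →
      MvPolynomial.eval (fun x : Σ i : d, Fin i → B => c x.1 x.2) P = 0 := by
    intro P hP
    refine eval_eq_zero_of_mem_closure
      (fun i : d => Pi.π (fun i : d => projSpace k (Fin i → B)) i) hs I c hc hI P ?_
    rintro t ⟨H, hH, ht⟩ c' hc' hI'
    exact hP H hH t ht c' hc' hI'
  have h1 : ∀ (i : d) a b,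
      c i (Function.update (I i) b (I i a)) = if a = b then 1 else 0 := by
    intro i a b
    have := close (MvPolynomial.X ⟨i, Function.update (I i) b (I i a)⟩ -
      MvPolynomial.C (if a = b then 1 else 0)) ?_
    · rwa [map_sub, MvPolynomial.eval_X, MvPolynomial.eval_C, sub_eq_zero] at this
    · intro H hH t ht c' hc' hI'
      rw [map_sub, MvPolynomial.eval_X, MvPolynomial.eval_C, sub_eq_zero]
      exact (ht.normalized hH.1 i (hc' i) (hI' i)).2.1 a b
  have h2 : ∀ (i : d) J,
      c i J = Matrix.det (Matrix.of fun a b => c i (Function.update (I i) b (J a))) := by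
    intro i J
    have hev : ∀ c' : ∀ i : d, (Fin i → B) → k,
        MvPolynomial.eval (fun x : Σ i : d, Fin i → B => c' x.1 x.2) (MvPolynomial.X ⟨i, J⟩ -
          Matrix.det (Matrix.of fun a b => MvPolynomial.X ⟨i, Function.update (I i) b (J a)⟩)) =
        c' i J - Matrix.det (Matrix.of fun a b => c' i (Function.update (I i) b (J a))) := by
      intro c'
      rw [map_sub, MvPolynomial.eval_X, RingHom.map_det]
      congr 2
      ext a b
      exact MvPolynomial.eval_X _
    rw [← sub_eq_zero, ← hev c]
    refine close _ fun H hH t ht c' hc' hI' => ?_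
    rw [hev, sub_eq_zero]
    exact (ht.normalized hH.1 i (hc' i) (hI' i)).2.2 J
  have h3 : ∀ (i j : d), (i : ℕ) ≤ j → ∀ a (x : B), c i (Function.update (I i) a x) =
      ∑ b, c i (Function.update (I i) a (I j b)) * c j (Function.update (I j) b x) := by
    intro i j hij a x
    have hev : ∀ c' : ∀ i : d, (Fin i → B) → k,
        MvPolynomial.eval (fun x : Σ i : d, Fin i → B => c' x.1 x.2)
          (MvPolynomial.X ⟨i, Function.update (I i) a x⟩ -
            ∑ b, MvPolynomial.X ⟨i, Function.update (I i) a (I j b)⟩ *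
              MvPolynomial.X ⟨j, Function.update (I j) b x⟩) =
        c' i (Function.update (I i) a x) - ∑ b, c' i (Function.update (I i) a (I j b)) *
          c' j (Function.update (I j) b x) := by
      intro c'
      simp only [map_sub, map_sum, map_mul, MvPolynomial.eval_X]
    rw [← sub_eq_zero, ← hev c]
    refine close _ fun H hH t ht c' hc' hI' => ?_
    rw [hev, sub_eq_zero]
    obtain ⟨m1, n1, -⟩ := ht.normalized hH.1 i (hc' i) (hI' i)
    obtain ⟨m2, n2, -⟩ := ht.normalized hH.1 j (hc' j) (hI' j)
    refine (span_column_le_iff e n2).1 (FlFin.le_of_finrank_le hH.1 m1 m2 ?_) a x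
    rwa [finrank_span_column e n1, finrank_span_column e n2]
  have h4 : ∀ (i j : d), R i j → ∀ a b, ∑ x : B, ∑ y : B, c i (Function.update (I i) a x) *
      c j (Function.update (I j) b y) * w (e x) (e y) = 0 := by
    intro i j hij a b
    have hev : ∀ c' : ∀ i : d, (Fin i → B) → k,
        MvPolynomial.eval (fun x : Σ i : d, Fin i → B => c' x.1 x.2)
          (∑ x : B, ∑ y : B, MvPolynomial.X ⟨i, Function.update (I i) a x⟩ *
            MvPolynomial.X ⟨j, Function.update (I j) b y⟩ * MvPolynomial.C (w (e x) (e y))) =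
        ∑ x : B, ∑ y : B, c' i (Function.update (I i) a x) *
          c' j (Function.update (I j) b y) * w (e x) (e y) := by
      intro c'
      simp only [map_sum, map_mul, MvPolynomial.eval_X, MvPolynomial.eval_C]
    rw [← hev c]
    refine close _ fun H hH t ht c' hc' hI' => ?_
    rw [hev]
    obtain ⟨m1, n1, -⟩ := ht.normalized hH.1 i (hc' i) (hI' i)
    obtain ⟨m2, n2, -⟩ := ht.normalized hH.1 j (hc' j) (hI' j)
    refine (orthogonal_span_column_iff e w).1 (hH.2 _ m1 _ m2 ?_) a b
    rwa [finrank_span_column e n1, finrank_span_column e n2]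
  -- The equations now say that the columns read off from `c` span the members of a flag with
  -- Plücker point `s`.
  let W : d → Submodule k V := fun i => Submodule.span k (Set.range (column e (c i) (I i)))
  have hW : ∀ i, Module.finrank k (W i) = i := fun i => finrank_span_column e (h1 i)
  have hmono : ∀ i j : d, (i : ℕ) ≤ j → W i ≤ W j := fun i j hij =>
    (span_column_le_iff e (h1 j)).2 (h3 i j hij)
  refine ⟨Set.range W, ⟨⟨?_, ?_, ?_⟩, ?_⟩, fun i => ⟨column e (c i) (I i),
    linearIndependent_column e (h1 i), ⟨i, rfl⟩, ?_⟩⟩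
  · rintro _ ⟨i, rfl⟩ _ ⟨j, rfl⟩ -
    exact (le_total (i : ℕ) j).imp (hmono i j) (hmono j i)
  · rintro _ ⟨i, rfl⟩
    rw [Submodule.span_le]
    rintro _ ⟨a, rfl⟩
    exact column_mem_spanOf e _ _ _
  · ext i
    simp only [Set.mem_image, Set.mem_range, exists_exists_eq_and, hW]
    simp
  · rintro _ ⟨i, rfl⟩ _ ⟨j, rfl⟩ hR
    rw [hW, hW] at hR
    exact (orthogonal_span_column_iff e w).2 (h4 i j hR)
  · have := hc i
    rw [← minors_column e (h2 i)] at this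
    exact this

/-- The `k`-points of the flag variety are the flags. -/
theorem exists_equiv_rationalPoints (w : LinearMap.BilinForm k V) (R : ℕ → ℕ → Prop) :
    ∃ f : FlRel e w R B d ≃ RationalPoints k (flagVariety e B d (FlRel e w R B d)),
      ∀ H : FlRel e w R B d, IsPointOfFlag e B d (FlRel e w R B d) H (f H) := by
  have hex : ∀ H : FlRel e w R B d,
      ∃ t : RationalPoints k (flagVariety e B d (FlRel e w R B d)),
        IsPointOfFlag e B d (FlRel e w R B d) H t := by
    intro H
    obtain ⟨s, hs⟩ := exists_isPlueckerPoint H.2.1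
    obtain ⟨t, ht⟩ := exists_lift_rationalPoint
      (subset_closure (Set.mem_image_of_mem RationalPoints.pt
        (show s ∈ {s | ∃ H ∈ FlRel e w R B d, IsPlueckerPoint e B d H s} from ⟨H, H.2, hs⟩)))
    refine ⟨t, ?_⟩
    change IsPlueckerPoint e B d H (t ≫ reducedClosureι _ _)
    rw [ht]
    exact hs
  choose f hf using hex
  refine ⟨Equiv.ofBijective f ⟨fun H H' h => ?_, fun t => ?_⟩, hf⟩
  · have h1 := hf H
    rw [h] at h1
    exact Subtype.ext (h1.flag_unique H.2.1 H'.2.1 (hf H'))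
  · obtain ⟨H, hH, ht⟩ := exists_flag_of_mem_closure t.pt_mem_closure
    have := mono_reducedClosureι (plueckerSpace k B d)
      {s | ∃ H ∈ FlRel e w R B d, IsPlueckerPoint e B d H s}
    refine ⟨⟨H, hH⟩, ?_⟩
    exact (cancel_mono (reducedClosureι _ _)).1 ((hf ⟨H, hH⟩).point_unique hH.1 ht)

end FlagPoints

/-! ### Closed immersions between flag varieties. -/

section Transition

variable {k : Type u} [Field k] {V : Type v} [AddCommGroup V] [Module k V] {κ : Type}
  {e : Module.Basis κ k V} {B B' : Finset κ}

theorem basis_mem_spanOf_iff {b : κ} : e b ∈ spanOf e B ↔ b ∈ B := by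
  rw [mem_spanOf_iff]
  constructor
  · intro h
    by_contra hb
    simpa using h b hb
  · classical
    rintro hb c hc
    rw [Module.Basis.repr_self, Finsupp.single_apply, if_neg]
    rintro rfl
    exact hc hb

theorem spanOf_mono (h : B ⊆ B') : spanOf e B ≤ spanOf e B' :=
  Submodule.span_mono (Set.image_mono h)

theorem span_image_le_spanOf (h : B ⊆ B') : Submodule.span k (e '' (B : Set κ)) ≤ spanOf e B' :=
  spanOf_mono h

/-- The minors of a basis enlarged by vectors `e_b`, `b ∈ N`, are linear forms in the minors of the
given basis. -/
theorem exists_linear_forms [DecidableEq κ] (hB : B ⊆ B') {i : ℕ} (N : Finset κ) (hN : N ⊆ B')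
    (hNB : Disjoint B N) (i' : ℕ) (hi' : i' = i + N.card) :
    ∃ ℓ : (Fin i' → B') → MvPolynomial (Fin i → B) k, (∀ J, (ℓ J).IsHomogeneous 1) ∧
      (∀ I, ∃ J : Fin i' → B', (∀ a, (J a : κ) ∈ B ∪ N) ∧ ℓ J = MvPolynomial.X I) ∧
      ∀ g : Fin i → V, LinearIndependent k g → (∀ a, g a ∈ spanOf e B) →
        ∃ g' : Fin i' → V, LinearIndependent k g' ∧ Submodule.span k (Set.range g') =
          Submodule.span k (Set.range g) ⊔ Submodule.span k (e '' (N : Set κ)) ∧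
          ∀ J, minors e g' J = MvPolynomial.eval (minors e g) (ℓ J) := by
  induction N using Finset.induction generalizing i' with
  | empty =>
    obtain rfl : i' = i := by simpa using hi'
    -- A minor with a row index outside `B` has a zero row, hence the default value 0.
    refine ⟨fun J => if h : ∀ a, (J a : κ) ∈ B then MvPolynomial.X fun a => ⟨J a, h a⟩ else 0,
      fun J => ?_, fun I => ⟨fun a => ⟨I a, hB (I a).2⟩, fun a => by simp, ?_⟩,
      fun g hg hgB => ⟨g, hg, by simp, fun J => ?_⟩⟩
    · dsimp only
      split_ifs
      · exact MvPolynomial.isHomogeneous_X _ _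
      · exact MvPolynomial.isHomogeneous_zero _ _ _
    · simp
    · dsimp only
      split_ifs with h
      · rw [MvPolynomial.eval_X]
        rfl
      · push Not at h
        obtain ⟨a, ha⟩ := h
        rw [map_zero, minors]
        refine Matrix.det_eq_zero_of_row_eq_zero a fun b => ?_
        exact (mem_spanOf_iff e).1 (hgB b) _ ha
  | insert c N hcN ih =>
    rw [Finset.card_insert_of_notMem hcN, ← add_assoc] at hi'
    subst hi'
    obtain ⟨ℓ, h1, h2, h3⟩ := ih ((Finset.subset_insert _ _).trans hN)
      (Finset.disjoint_of_subset_right (Finset.subset_insert _ _) hNB) _ rfl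
    have hcB : c ∉ B := fun h => Finset.disjoint_left.1 hNB h (Finset.mem_insert_self _ _)
    have hcBN : c ∉ B ∪ N := by simp [hcB, hcN]
    let c' : B' := ⟨c, hN (Finset.mem_insert_self _ _)⟩
    -- Laplace expansion along the last column, which holds the coordinates of the added vector `e
    -- c`.
    refine ⟨fun J => ∑ a : Fin (i + N.card + 1), MvPolynomial.C
        ((-1) ^ ((a : ℕ) + (Fin.last (i + N.card) : ℕ)) * e.repr (e c) (J a)) *
          ℓ (fun b => J (a.succAbove b)), fun J => ?_, fun I => ?_, fun g hg hgB => ?_⟩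
    · exact MvPolynomial.IsHomogeneous.sum _ _ _ fun a _ => (h1 _).C_mul _
    · obtain ⟨J, hJ, hJI⟩ := h2 I
      -- Appending the index `c` to the old rows leaves only the last term of the expansion, with an
      -- even power of -1. That `c` is not already among the rows is ensured by carrying the
      -- condition `J a ∈ B ∪ N` through the induction.
      refine ⟨Fin.snoc (α := fun _ => B') J c', fun a => ?_, ?_⟩
      · refine Fin.lastCases ?_ (fun b => ?_) a
        · simp [c']
        · rw [Fin.snoc_castSucc]
          exact Finset.union_subset_union_right (Finset.subset_insert _ _) (hJ b)
      · dsimp only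
        rw [Fin.sum_univ_castSucc, Finset.sum_eq_zero, zero_add]
        · rw [Fin.snoc_last, Module.Basis.repr_self]
          simp only [c', Finsupp.single_eq_same, Fin.succAbove_last, Fin.snoc_castSucc]
          rw [← two_mul, pow_mul]
          simp [hJI]
        · intro b _
          rw [Fin.snoc_castSucc, Module.Basis.repr_self, Finsupp.single_apply, if_neg]
          · simp
          · rintro rfl
            exact hcBN (hJ b)
    · obtain ⟨g', hg', hspan, hmin⟩ := h3 g hg hgB
      refine ⟨Fin.snoc (α := fun _ => V) g' (e c), ?_, ?_, fun J => ?_⟩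
      · refine linearIndependent_finSnoc.2 ⟨hg', fun hmem => hcBN ?_⟩
        rw [← basis_mem_spanOf_iff (e := e)]
        rw [hspan] at hmem
        have hle : Submodule.span k (Set.range g) ⊔ Submodule.span k (e '' (N : Set κ)) ≤
            spanOf e (B ∪ N) := by
          refine sup_le ?_ (span_image_le_spanOf Finset.subset_union_right)
          rw [Submodule.span_le]
          rintro _ ⟨a, rfl⟩
          exact spanOf_mono Finset.subset_union_left (hgB a)
        exact hle hmem
      · rw [Fin.range_snoc, Set.insert_eq, Submodule.span_union, hspan, Finset.coe_insert,
          Set.image_insert_eq, Set.insert_eq, Submodule.span_union]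
        ac_rfl
      · rw [minors, Matrix.det_succ_column _ (Fin.last _), map_sum]
        refine Finset.sum_congr rfl fun a _ => ?_
        rw [map_mul, MvPolynomial.eval_C, ← hmin]
        simp only [Matrix.of_apply, Fin.snoc_last, minors]
        congr 2
        ext b b'
        simp [Fin.succAbove_last]

/-- The closed immersion of flag varieties given by adding vectors `e_b`, `b ∈ N i'`, to the
member of dimension `a i'` of a flag. -/
theorem exists_closedImmersion_flagVariety {d d' : Finset ℕ} {𝓗 𝓗' : Set (Set (Submodule k V))}
    (hB : B ⊆ B') (h𝓗 : 𝓗 ⊆ FlFin e B d) (a : d' → d) (ha : Function.Surjective a)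
    (N : d' → Finset κ) (hN : ∀ i', N i' ⊆ B') (hNB : ∀ i', Disjoint B (N i'))
    (hcard : ∀ i' : d', (i' : ℕ) = a i' + (N i').card) (φ : Set (Submodule k V) → Set (Submodule k V))
    (hφ : ∀ H ∈ 𝓗, φ H ∈ 𝓗')
    (hφ' : ∀ H ∈ 𝓗, ∀ i' : d', ∀ C ∈ H, Module.finrank k C = a i' →
      C ⊔ Submodule.span k (e '' (N i' : Set κ)) ∈ φ H) :
    ∃ j : flagVariety e B d 𝓗 ⟶ flagVariety e B' d' 𝓗', IsClosedImmersion j.left ∧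
      ∀ H ∈ 𝓗, ∀ s, IsPointOfFlag e B d 𝓗 H s → IsPointOfFlag e B' d' 𝓗' (φ H) (s ≫ j) := by
  classical
  choose ℓ h1 h2 h3 using fun i' : d' =>
    exists_linear_forms (e := e) hB (N i') (hN i') (hNB i') i' (hcard i')
  have h2' : ∀ i' I, ∃ J, ℓ i' J = MvPolynomial.X I := fun i' I =>
    let ⟨J, hJ⟩ := h2 i' I
    ⟨J, hJ.2⟩
  let p : ∀ i : d, plueckerSpace k B d ⟶ projSpace k (Fin i → B) :=
    fun i => Pi.π (fun i : d => projSpace k (Fin i → B)) i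
  let p' : ∀ i : d', plueckerSpace k B' d' ⟶ projSpace k (Fin i → B') :=
    fun i => Pi.π (fun i : d' => projSpace k (Fin i → B')) i
  obtain ⟨Λ, hΛ⟩ : ∃ Λ : plueckerSpace k B d ⟶ plueckerSpace k B' d',
      ∀ i', Λ ≫ p' i' = p (a i') ≫ linearMap (ℓ i') (h1 i') (h2' i') :=
    ⟨Pi.lift fun i' => p (a i') ≫ linearMap (ℓ i') (h1 i') (h2' i'), fun i' => limit.lift_π _ _⟩
  -- Every factor of the source is seen by some factor of the target, because `a` is surjective,
  -- through a linear embedding.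
  have hmono : Mono Λ := by
    refine ⟨fun f g hfg => Pi.hom_ext _ _ fun i => ?_⟩
    obtain ⟨i', rfl⟩ := ha i
    have hm := mono_linearMap (hℓ := h1 i') (hsurj := h2' i')
    rw [← cancel_mono (linearMap (ℓ i') (h1 i') (h2' i'))]
    have := congr($hfg ≫ p' i')
    rw [Category.assoc, Category.assoc, hΛ, ← Category.assoc, ← Category.assoc] at this
    exact this
  have hpt : ∀ H ∈ 𝓗, ∀ s, IsPlueckerPoint e B d H s → IsPlueckerPoint e B' d' (φ H) (s ≫ Λ) := by
    intro H hH s hs i'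
    obtain ⟨g, hg1, hg2, hg3⟩ := hs (a i')
    obtain ⟨g', hg1', hg2', hg3'⟩ := h3 i' g hg1 (mem_of_span_mem (h𝓗 hH) hg2)
    refine ⟨g', hg1', ?_, ?_⟩
    · rw [hg2']
      refine hφ' H hH i' _ hg2 ?_
      rw [finrank_span_eq_card hg1, Fintype.card_fin]
    · have h4 : (s ≫ Λ) ≫ p' i' = (s ≫ p (a i')) ≫ linearMap (ℓ i') (h1 i') (h2' i') := by
        rw [Category.assoc, hΛ, Category.assoc]
      have h5 := HasCoords.comp_linearMap (hℓ := h1 i') (hsurj := h2' i') hg3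
      have h6 : minors e g' = fun J => MvPolynomial.eval (minors e g) (ℓ i' J) :=
        funext hg3'
      change HasCoords ((s ≫ Λ) ≫ p' i') (minors e g')
      rw [h4, h6]
      exact h5
  set Z : Set (RationalPoints k (plueckerSpace k B d)) :=
    {s | ∃ H ∈ 𝓗, IsPlueckerPoint e B d H s}
  set Z' : Set (RationalPoints k (plueckerSpace k B' d')) :=
    {s | ∃ H ∈ 𝓗', IsPlueckerPoint e B' d' H s}
  have hpr := isProper_plueckerSpace (k := k) B d
  have hpr' := isProper_plueckerSpace (k := k) B' d'
  have hv := isVariety_reducedClosure (plueckerSpace k B d) Z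
  have hred := hv.reduced
  have hproper := isProper_reducedClosure (plueckerSpace k B d) Z
  have hproper' := isProper_reducedClosure (plueckerSpace k B' d') Z'
  have hmono1 := mono_reducedClosureι (plueckerSpace k B d) Z
  have hmaps : ∀ x, Λ.left x ∈ closure (RationalPoints.pt '' Z') ∨
      x ∉ closure (RationalPoints.pt '' Z) := by
    intro x
    refine or_iff_not_imp_right.2 fun hx => ?_
    refine map_mem_closure Λ.left.continuous (not_not.1 hx) ?_
    rintro _ ⟨s, ⟨H, hH, hs⟩, rfl⟩
    exact ⟨s ≫ Λ, ⟨φ H, hφ H hH, hpt H hH s hs⟩, rfl⟩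
  obtain ⟨j, hj⟩ := exists_lift_reducedClosure (Z := Z') (reducedClosureι _ Z ≫ Λ) (by
    intro x
    refine (hmaps ((reducedClosureι _ Z).left x)).resolve_right (not_not.2 ?_)
    rw [← range_reducedClosureι]
    exact Set.mem_range_self _)
  -- The source is proper and the target separated, so being a monomorphism is all that has to be
  -- checked for a closed immersion.
  have hmonoj : Mono j := by
    have : Mono (j ≫ reducedClosureι (plueckerSpace k B' d') Z') := by
      rw [hj]
      exact mono_comp _ _
    exact mono_of_mono j (reducedClosureι (plueckerSpace k B' d') Z')
  refine ⟨j, isClosedImmersion_left_of_mono j, fun H hH s hs => ?_⟩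
  have hcomp : ∀ t : RationalPoints k (reducedClosure (plueckerSpace k B d) Z),
      (t ≫ j) ≫ reducedClosureι (plueckerSpace k B' d') Z' =
        (t ≫ reducedClosureι (plueckerSpace k B d) Z) ≫ Λ := by
    intro t
    rw [Category.assoc, hj, Category.assoc]
  have := hpt H hH _ hs
  exact Eq.mpr (congrArg (IsPlueckerPoint e B' d' (φ H)) (hcomp s)) this

end Transition

/-! ### Maps out of sequential limits. -/

section SequentialLimit

variable {X : ℕ → Type v} {f : ∀ n, X n → X (n + 1)}

theorem SeqLim.of_map (n : ℕ) (x : X n) : SeqLim.of f (n + 1) (f n x) = SeqLim.of f n x :=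
  (@Quot.sound _ (fun a b : (Σ n, X n) => b = ⟨a.1 + 1, f a.1 a.2⟩) ⟨n, x⟩
    ⟨n + 1, f n x⟩ rfl).symm

theorem SeqLim.exists_rep (z : SeqLim X f) : ∃ n x, SeqLim.of f n x = z := by
  induction z using Quot.ind with
  | mk a => exact ⟨a.1, a.2, rfl⟩

theorem SeqLim.exists_of_eq_of_le {m n : ℕ} (h : m ≤ n) (x : X m) :
    ∃ y : X n, SeqLim.of f n y = SeqLim.of f m x := by
  induction n, h using Nat.le_induction with
  | base => exact ⟨x, rfl⟩
  | succ n _ ih =>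
    obtain ⟨y, hy⟩ := ih
    exact ⟨f n y, (SeqLim.of_map n y).trans hy⟩

/-- Compatible maps on the terms of a sequence define a map on its direct limit. -/
def SeqLim.desc {Y : Type*} (p : ∀ n, X n → Y) (hp : ∀ n x, p (n + 1) (f n x) = p n x) :
    SeqLim X f → Y :=
  Quot.lift (fun a => p a.1 a.2) (by
    rintro ⟨n, x⟩ _ rfl
    exact (hp n x).symm)

theorem SeqLim.desc_bijective {Y : Type*} {p : ∀ n, X n → Y}
    {hp : ∀ n x, p (n + 1) (f n x) = p n x} (hinj : ∀ n, Function.Injective (p n))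
    (hsurj : ∀ y, ∃ n x, p n x = y) : Function.Bijective (SeqLim.desc p hp) := by
  constructor
  · intro z z' h
    obtain ⟨m, x, rfl⟩ := SeqLim.exists_rep z
    obtain ⟨n, y, rfl⟩ := SeqLim.exists_rep z'
    obtain ⟨x', hx'⟩ := SeqLim.exists_of_eq_of_le (le_max_left m n) x (f := f)
    obtain ⟨y', hy'⟩ := SeqLim.exists_of_eq_of_le (le_max_right m n) y (f := f)
    rw [← hx', ← hy'] at h ⊢
    exact congrArg _ (hinj _ h)
  · intro y
    obtain ⟨n, x, rfl⟩ := hsurj y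
    exact ⟨SeqLim.of f n x, rfl⟩

end SequentialLimit

/-! ### From truncation and extension to the ind-variety. -/

section IndVariety

variable {k : Type u} [Field k] {V : Type v} [AddCommGroup V] [Module k V] {κ : Type}
  {e : Module.Basis κ k V}

theorem finrank_inf_spanOf_mem_flagType {B : Finset κ} {F : Set (Submodule k V)}
    {A : Submodule k V} (hA : A ∈ F) :
    Module.finrank k ↥(A ⊓ spanOf e B) ∈ flagType e B F := by
  classical
  rw [flagType, Finset.mem_filter, Finset.mem_range, Nat.lt_succ_iff]
  refine ⟨(Submodule.finrank_mono inf_le_right).trans ?_, A, hA, rfl⟩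
  have h := finrank_span_finset_le_card (R := k) (B.image e)
  rw [Finset.coe_image] at h
  exact h.trans Finset.card_image_le

theorem inf_spanOf_eq_of_finrank_eq {F : Set (Submodule k V)} (hF : IsChain (· ≤ ·) F)
    {A C : Submodule k V} (hA : A ∈ F) (hC : C ∈ F) {B : Finset κ}
    (h : Module.finrank k ↥(A ⊓ spanOf e B) = Module.finrank k ↥(C ⊓ spanOf e B)) :
    A ⊓ spanOf e B = C ⊓ spanOf e B := by
  have hfd : ∀ D : Submodule k V, FiniteDimensional k ↥(D ⊓ spanOf e B) := fun D =>
    Submodule.finiteDimensional_of_le inf_le_right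
  rcases eq_or_ne A C with rfl | hne
  · rfl
  rcases hF hA hC hne with hle | hle
  · have := hfd C
    exact Submodule.eq_of_le_of_finrank_eq (inf_le_inf_right _ hle) h
  · have := hfd A
    exact (Submodule.eq_of_le_of_finrank_eq (inf_le_inf_right _ hle) h.symm).symm

theorem IsPointOfFlag.unique {B : Finset κ} {d : Finset ℕ} {𝓗 : Set (Set (Submodule k V))}
    {H : Set (Submodule k V)} (hH : H ∈ FlFin e B d)
    {s t : RationalPoints k (flagVariety e B d 𝓗)} (hs : IsPointOfFlag e B d 𝓗 H s)
    (ht : IsPointOfFlag e B d 𝓗 H t) : s = t := by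
  have := mono_reducedClosureι (plueckerSpace k B d) {s | ∃ H ∈ 𝓗, IsPlueckerPoint e B d H s}
  exact (cancel_mono (reducedClosureι _ _)).1 (IsPlueckerPoint.point_unique hH hs ht)

/-- The formal part. The maps `ψ m` are injective with left inverse the truncation, compatible with
the transition maps, and jointly exhaust `X`. They induce a bijection from the direct limit to `X`,
whose inverse is `θ`; the pieces are the images of the `ψ m`. -/
theorem isIndVarietyOfFlags_of_truncate {S : ℕ → Finset κ} {F : Set (Submodule k V)}
    {X : Set (Set (Submodule k V))} {𝓗 : ℕ → Set (Set (Submodule k V))}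
    (w : LinearMap.BilinForm k V) (R : ℕ → ℕ → ℕ → Prop)
    (h𝓗 : ∀ m, 𝓗 m = FlRel e w (R m) (S m) (flagType e (S m) F))
    (hS : ∀ m, S m ⊆ S (m + 1)) (hF : IsChain (· ≤ ·) F)
    (hdim : ∀ m, ∀ A ∈ F, Module.finrank k ↥(A ⊓ spanOf e (S (m + 1))) =
      Module.finrank k ↥(A ⊓ spanOf e (S m)) +
        Set.ncard {b | b ∈ S (m + 1) ∧ b ∉ S m ∧ e b ∈ A})
    (hι : ∀ m, ∀ H ∈ 𝓗 m, extendFlag e F (S m) (S (m + 1)) H ∈ 𝓗 (m + 1))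
    (ψ : ℕ → Set (Submodule k V) → Set (Submodule k V))
    (hψX : ∀ m, ∀ H ∈ 𝓗 m, ψ m H ∈ X)
    (htrunc : ∀ m, ∀ H ∈ 𝓗 m, truncate e (S m) (ψ m H) = H)
    (hψι : ∀ m, ∀ H ∈ 𝓗 m, ψ (m + 1) (extendFlag e F (S m) (S (m + 1)) H) = ψ m H)
    (hX : ∀ G ∈ X, ∀ᶠ m in Filter.atTop,
      truncate e (S m) G ∈ 𝓗 m ∧ ψ m (truncate e (S m) G) = G) :
    IsIndVarietyOfFlags e S F X 𝓗 := by
  classical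
  have hfin : ∀ m, 𝓗 m ⊆ FlFin e (S m) (flagType e (S m) F) := by
    intro m H hH
    rw [h𝓗] at hH
    exact hH.1
  have hj : ∀ m, ∃ j : flagVariety e (S m) (flagType e (S m) F) (𝓗 m) ⟶
      flagVariety e (S (m + 1)) (flagType e (S (m + 1)) F) (𝓗 (m + 1)),
      IsClosedImmersion j.left ∧ ∀ H ∈ 𝓗 m, ∀ s,
        IsPointOfFlag e (S m) (flagType e (S m) F) (𝓗 m) H s →
        IsPointOfFlag e (S (m + 1)) (flagType e (S (m + 1)) F) (𝓗 (m + 1))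
          (extendFlag e F (S m) (S (m + 1)) H) (s ≫ j) := by
    intro m
    have hex : ∀ i' : flagType e (S (m + 1)) F, ∃ A ∈ F,
        Module.finrank k ↥(A ⊓ spanOf e (S (m + 1))) = i' := fun i' =>
      (Finset.mem_filter.1 i'.2).2
    -- A member of `F` is picked for each dimension in the larger type; it determines the dimension
    -- in the smaller type and the vectors to be added.
    choose A hA hAi using hex
    have hset : ∀ i', {b | b ∈ S (m + 1) ∧ b ∉ S m ∧ e b ∈ A i'} =
        (((S (m + 1)).filter fun b => b ∉ S m ∧ e b ∈ A i' : Finset κ) : Set κ) := by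
      intro i'
      ext b
      simp
    refine exists_closedImmersion_flagVariety (hS m) (hfin m)
      (fun i' => ⟨_, finrank_inf_spanOf_mem_flagType (hA i')⟩) ?_
      (fun i' => (S (m + 1)).filter fun b => b ∉ S m ∧ e b ∈ A i')
      (fun i' => Finset.filter_subset _ _) ?_ ?_ _ (hι m) ?_
    -- Surjectivity: if `C` realizes `i`, the member picked for the dimension of `C ∩ V_{m+1}` has
    -- the same trace as `C` on `V_{m+1}`, hence on `V_m`.
    · rintro ⟨i, hi⟩
      obtain ⟨C, hC, hCi⟩ := (Finset.mem_filter.1 hi).2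
      refine ⟨⟨_, finrank_inf_spanOf_mem_flagType hC⟩, Subtype.ext ?_⟩
      have h1 := hAi ⟨_, finrank_inf_spanOf_mem_flagType hC⟩
      have h2 := inf_spanOf_eq_of_finrank_eq hF (hA _) hC h1
      have h3 : spanOf e (S (m + 1)) ⊓ spanOf e (S m) = spanOf e (S m) :=
        inf_eq_right.2 (spanOf_mono (hS m))
      dsimp only
      rw [← hCi, ← h3, ← inf_assoc, h2, inf_assoc]
    · intro i'
      rw [Finset.disjoint_left]
      intro b hb hb'
      exact (Finset.mem_filter.1 hb').2.1 hb
    · intro i'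
      rw [← Set.ncard_coe_finset, ← hset, ← hdim m _ (hA i'), hAi]
    · intro H hH i' C hC hCi
      refine ⟨A i', hA i', C, hC, hCi, ?_⟩
      congr 2
      ext x
      simp only [Set.mem_image, Finset.coe_filter, Set.mem_ofPred_eq]
      exact ⟨fun ⟨b, h, hb⟩ => ⟨b, h.1, h.2.1, h.2.2, hb.symm⟩,
        fun ⟨b, h1, h2, h3, hb⟩ => ⟨b, ⟨h1, h2, h3⟩, hb.symm⟩⟩
  choose j hj1 hj2 using hj
  have hf : ∀ m, ∃ f : 𝓗 m ≃ RationalPoints k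
      (flagVariety e (S m) (flagType e (S m) F) (𝓗 m)),
      ∀ H : 𝓗 m, IsPointOfFlag e (S m) (flagType e (S m) F) (𝓗 m) H (f H) := by
    intro m
    rw [h𝓗]
    exact exists_equiv_rationalPoints w (R m)
  choose f hf using hf
  let p : ∀ m, 𝓗 m → X := fun m H => ⟨ψ m H, hψX m H H.2⟩
  have hpinj : ∀ m, Function.Injective (p m) := by
    intro m H H' h
    have := congrArg Subtype.val h
    apply Subtype.ext
    rw [← htrunc m H H.2, ← htrunc m H' H'.2]
    exact congrArg (truncate e (S m)) this
  let Ψ := Equiv.ofBijective (SeqLim.desc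
    (f := fun m (H : 𝓗 m) => (⟨_, hι m H.1 H.2⟩ : 𝓗 (m + 1))) p
    (fun m H => Subtype.ext (hψι m H H.2))) (SeqLim.desc_bijective hpinj (fun G => by
      obtain ⟨m, hm⟩ := (hX G G.2).exists
      exact ⟨m, ⟨_, hm.1⟩, Subtype.ext hm.2⟩))
  have hΨ : ∀ m (H : 𝓗 m), Ψ (SeqLim.of _ m H) = p m H := fun m H => rfl
  have hpiece : ∀ m (G : X), G ∈ Ψ.symm ⁻¹' Set.range (SeqLim.of _ m) ↔ G ∈ Set.range (p m) := by
    intro m G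
    rw [Set.mem_preimage, Set.mem_range, Set.mem_range]
    refine exists_congr fun H => ?_
    rw [Equiv.eq_symm_apply, hΨ]
  let g : ∀ m, ↥(Ψ.symm ⁻¹' Set.range (SeqLim.of
      (fun m (H : 𝓗 m) => (⟨_, hι m H.1 H.2⟩ : 𝓗 (m + 1))) m)) ≃ 𝓗 m := fun m =>
    ((Equiv.ofInjective (p m) (hpinj m)).trans
      (Equiv.subtypeEquivRight fun G => (hpiece m G).symm)).symm
  have hg : ∀ m G (hG) (H : 𝓗 m), p m H = G → g m ⟨G, hG⟩ = H := by
    rintro m _ hG H rfl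
    rw [Equiv.symm_apply_eq]
    rfl
  have hp : IsProper (plueckerSpace k (S 0) (flagType e (S 0) F)).hom := isProper_plueckerSpace _ _
  refine ⟨hι, j, Ψ.symm,
    { piece := fun m => Ψ.symm ⁻¹' Set.range (SeqLim.of _ m)
      mono := ?_
      exhaust := ?_
      var := fun m => flagVariety e (S m) (flagType e (S m) F) (𝓗 m)
      isVariety := fun m => ?_
      pts := fun m => (g m).trans (f m)
      dense := fun m => dense_rationalPoints_reducedClosure _ _
      incl := j
      isClosedImmersion := hj1
      pts_incl := ?_ }, fun m => Iso.refl _, hj1, ?_, ?_, Ψ.symm.bijective, fun _ => rfl, ?_, ?_⟩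
  · rintro m G ⟨H, hH⟩
    exact ⟨_, (SeqLim.of_map m H).trans hH⟩
  · rw [Set.eq_univ_iff_forall]
    intro G
    obtain ⟨m, H, h⟩ := SeqLim.exists_rep (Ψ.symm G)
    exact Set.mem_iUnion.2 ⟨m, H, h⟩
  · have := isProper_plueckerSpace (k := k) (S m) (flagType e (S m) F)
    exact isVariety_reducedClosure _ _
  · intro m G hG
    obtain ⟨H, hH⟩ := (hpiece m G).1 hG
    have h1 : g m ⟨G, hG⟩ = H := hg m G _ H hH
    have h2 : ∀ hG', g (m + 1) ⟨G, hG'⟩ = ⟨_, hι m H.1 H.2⟩ := fun hG' =>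
      hg (m + 1) G _ _ (Eq.trans (Subtype.ext (hψι m H H.2)) hH)
    rw [Equiv.trans_apply, Equiv.trans_apply, h1, h2]
    exact IsPointOfFlag.unique (hfin _ (hι m H.1 H.2)) (hj2 m H H.2 _ (hf m H))
      (hf (m + 1) ⟨_, hι m H.1 H.2⟩)
  · intro m H hH
    exact ⟨f m ⟨H, hH⟩, hf m ⟨H, hH⟩, hj2 m H hH _ (hf m ⟨H, hH⟩)⟩
  · intro G
    filter_upwards [hX G G.2] with m hm
    refine ⟨hm.1, ?_⟩
    rw [Equiv.symm_apply_eq, hΨ]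
    exact Subtype.ext hm.2.symm
  · intro m G hG H hGH
    have h1 : g m ⟨G, hG⟩ = H := hg m G _ H (by
      rw [Equiv.symm_apply_eq, hΨ] at hGH
      exact hGH.symm)
    change IsPointOfFlag _ _ _ _ _ (f m (g m ⟨G, hG⟩) ≫ 𝟙 _)
    rw [h1, Category.comp_id]
    exact hf m H
  · intro m
    change j m ≫ 𝟙 _ = 𝟙 _ ≫ j m
    rw [Category.comp_id, Category.id_comp]

end IndVariety

/-! ### Generalized flags compatible with bases. -/

section Compatibility

variable {k : Type u} [Field k] {V : Type v} [AddCommGroup V] [Module k V]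

/-- The basis of `V` indexed by a set of vectors. -/
noncomputable def IsBasisSet.basis {L : Set V} (hL : IsBasisSet k L) : Module.Basis L k V :=
  Module.Basis.mk (v := fun x : L => (x : V)) hL.1 (by
    rw [Subtype.range_coe_subtype, Set.ofPred_mem_eq, hL.2])

@[simp]
theorem IsBasisSet.basis_apply {L : Set V} (hL : IsBasisSet k L) (α : L) : hL.basis α = α :=
  Module.Basis.mk_apply _ _ _

theorem isBasisSet_range {ι : Type*} (b : Module.Basis ι k V) : IsBasisSet k (Set.range b) :=
  ⟨b.linearIndependent.linearIndepOn_id, b.span_eq⟩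

theorem mem_spanBelow_iff {L : Set V} (hL : IsBasisSet k L) (r : L → L → Prop) (β : L) (v : V) :
    v ∈ spanBelow k r β ↔ ∀ α, hL.basis.repr v α ≠ 0 → r α β := by
  have : {x : V | ∃ α : L, r α β ∧ (α : V) = x} = hL.basis '' {α | r α β} := by
    ext x
    simp
  rw [spanBelow, this, Module.Basis.mem_span_image]
  exact ⟨fun h α hα => h (Finsupp.mem_support_iff.2 hα),
    fun h α hα => h α (Finsupp.mem_support_iff.1 hα)⟩

theorem exists_leading {ι : Type*} (r : ι → ι → Prop) [IsStrictOrder ι r] (s : Finset ι)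
    (hs : s.Nonempty) : ∃ a ∈ s, ∀ b ∈ s, ¬ r a b := by
  have hwf := s.finite_toSet.wellFoundedOn (r := Function.swap r)
  obtain ⟨⟨a, ha⟩, -, h⟩ := WellFounded.has_min hwf (Set.univ : Set (s : Set ι))
    (let ⟨a, ha⟩ := hs; ⟨⟨a, ha⟩, trivial⟩)
  exact ⟨a, ha, fun b hb => h ⟨b, hb⟩ trivial⟩

/-- The members of a generalized flag compatible with a basis are spanned by basis vectors. -/
theorem IsCompatible.mem_of_repr_ne_zero {F : Set (Submodule k V)} {L : Set V}
    (hL : IsBasisSet k L) (h : IsCompatible F L) {A : Submodule k V} (hA : A ∈ F) {v : V}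
    (hv : v ∈ A) (α : L) (hα : hL.basis.repr v α ≠ 0) : (α : V) ∈ A := by
  obtain ⟨r, hr, hsucc, hgen, hpart⟩ := h
  -- In a weak order, incomparable elements have the same elements above them.
  have hrel : ∀ a b c : L, ¬ r a b → ¬ r b a → r a c → r b c := by
    intro a b c h1 h2 h3
    by_contra h4
    have h5 : ¬ r c b := fun h => h1 (_root_.trans h3 h)
    exact (hr.incomp_trans a b c ⟨h1, h2⟩ ⟨h4, h5⟩).1 h3
  obtain ⟨l, hl, hmax⟩ := exists_leading r (hL.basis.repr v).support
    ⟨α, Finsupp.mem_support_iff.2 hα⟩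
  have hlt : ∀ a, hL.basis.repr v a ≠ 0 → ¬ r l a := fun a ha =>
    hmax a (Finsupp.mem_support_iff.2 ha)
  have hbasis : ∀ a b : L, (a : V) ∈ spanBelow k r b ↔ r a b := by
    intro a b
    rw [mem_spanBelow_iff hL, ← hL.basis_apply a]
    simp only [Module.Basis.repr_self]
    constructor
    · intro h
      exact h a (by simp)
    · intro h c hc
      obtain rfl : a = c := by
        by_contra hne
        exact hc (by simp [Ne.symm hne])
      exact h
  -- With `l` maximal in the support, `v` and `l` lie in the same members of the chain, and so in
  -- the same members of `F`.
  have hvl : ∀ b, v ∈ spanBelow k r b ↔ r l b := by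
    intro b
    rw [mem_spanBelow_iff hL]
    refine ⟨fun h => h l (Finsupp.mem_support_iff.1 hl), fun h a ha => ?_⟩
    by_cases h1 : r a l
    · exact _root_.trans h1 h
    · exact hrel l a b (hlt a ha) h1 h
  have hlA : (l : V) ∈ A := by
    refine ((hpart v l).1 ?_ A hA).1 hv
    rintro _ ⟨b, rfl⟩
    rw [hvl, hbasis]
  -- If `α ≺ l`, then `α` lies in `F'_l`, which is contained in `A` because `l` lies in `A` but not
  -- in `F'_l`. Otherwise `α` and `l` are incomparable and lie in the same part.
  by_cases h1 : r α l
  · obtain ⟨F'', hF, -, hnot⟩ := hsucc l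
    rcases eq_or_ne (spanBelow k r l) A with rfl | hne
    · exact absurd hlA hnot
    rcases hgen.chain hF.1 hA hne with hle | hle
    · exact hle ((hbasis α l).2 h1)
    · exact absurd (hle hlA) hnot
  · refine ((hpart l α).1 ?_ A hA).1 hlA
    rintro _ ⟨b, rfl⟩
    rw [hbasis, hbasis]
    exact ⟨hrel l α b (hlt α hα) h1, hrel α l b h1 (hlt α hα)⟩

variable {κ : Type} {e : Module.Basis κ k V}

/-- The subspace `A` is the sum of `A ∩ V_B` and of the span of vectors `e_b`, `b ∉ B`. -/
def IsSplit (e : Module.Basis κ k V) (B : Finset κ) (A : Submodule k V) : Prop :=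
  ∀ x ∈ A, ∀ b, b ∉ B → e.repr x b ≠ 0 → e b ∈ A

theorem IsAdapted.isSplit {adm : Set V → Prop} (hadm : ∀ L, adm L → IsBasisSet k L)
    {F : Set (Submodule k V)} {B : Finset κ} (h : IsAdapted e adm F B) {A : Submodule k V}
    (hA : A ∈ F) : IsSplit e B A := by
  classical
  obtain ⟨L, hL, hF, h1, h2⟩ := h
  intro x hx b hb hxb
  have hL := hadm L hL
  refine hF.mem_of_repr_ne_zero hL hA hx ⟨e b, h1 b hb⟩ ?_
  -- Both coordinate functionals are 1 at `e b` and vanish on all other elements of `L`, which are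
  -- in `V_B` or among the remaining `e b'`.
  have key : hL.basis.coord ⟨e b, h1 b hb⟩ = e.coord b := by
    refine hL.basis.ext fun α => ?_
    rw [Module.Basis.coord_apply, Module.Basis.repr_self, Module.Basis.coord_apply,
      IsBasisSet.basis_apply]
    rcases h2 α α.2 with hα | ⟨b', -, hα⟩
    · rw [(mem_spanOf_iff e).1 hα b hb, Finsupp.single_apply, if_neg]
      intro hαb
      have h3 : (α : V) = e b := congrArg Subtype.val hαb
      have h4 := (mem_spanOf_iff e).1 hα b hb
      rw [h3] at h4
      simp at h4
    · rw [hα, Module.Basis.repr_self, Finsupp.single_apply, Finsupp.single_apply]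
      refine if_congr ?_ rfl rfl
      rw [Subtype.ext_iff]
      simp only [hα]
      exact e.injective.eq_iff
  have := congr($key x)
  rw [Module.Basis.coord_apply, Module.Basis.coord_apply] at this
  rwa [this]

theorem IsAdapted.mono {adm : Set V → Prop} {F : Set (Submodule k V)} {B B' : Finset κ}
    (hB : B ⊆ B') (h : IsAdapted e adm F B) : IsAdapted e adm F B' := by
  obtain ⟨L, hL, hF, h1, h2⟩ := h
  refine ⟨L, hL, hF, fun b hb => h1 b fun h => hb (hB h), fun x hx => ?_⟩
  rcases h2 x hx with h | ⟨b, hb, rfl⟩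
  · exact Or.inl (spanOf_mono hB h)
  · by_cases hb' : b ∈ B'
    · exact Or.inl (basis_mem_spanOf_iff.2 hb')
    · exact Or.inr ⟨b, hb', rfl⟩

theorem exists_finset_mem_spanOf {T : Set V} (hT : T.Finite) :
    ∃ B : Finset κ, ∀ x ∈ T, x ∈ spanOf e B := by
  classical
  refine ⟨hT.toFinset.biUnion fun x => (e.repr x).support, fun x hx => ?_⟩
  rw [mem_spanOf_iff]
  intro b hb
  by_contra hne
  exact hb (Finset.mem_biUnion.2 ⟨x, hT.mem_toFinset.2 hx, Finsupp.mem_support_iff.2 hne⟩)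

/-- Finitely many vectors `T` of `L` span the finite set of vectors of `E` outside `L`. Together
with `E ∩ L` they span `V`, so a vector of `L` outside `E` has to belong to `T`. -/
theorem IsBasisSet.finite_diff {L E : Set V} (hL : IsBasisSet k L) (hE : IsBasisSet k E)
    (h : (E \ (E ∩ L)).Finite) : (L \ E).Finite := by
  obtain ⟨T, hTL, hT⟩ := Submodule.subset_span_finite_of_subset_span
    (show (h.toFinset : Set V) ⊆ Submodule.span k L by rw [hL.2]; exact Set.subset_univ _)
  refine T.finite_toSet.subset fun x hx => ?_
  by_contra hxT
  have htop : Submodule.span k ((T : Set V) ∪ (E ∩ L)) = ⊤ := by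
    rw [eq_top_iff, ← hE.2, Submodule.span_le]
    intro y hy
    by_cases hyL : y ∈ L
    · exact Submodule.subset_span (Or.inr ⟨hy, hyL⟩)
    · exact Submodule.span_mono Set.subset_union_left (hT
        (h.mem_toFinset.2 ⟨hy, fun h' => hyL h'.2⟩))
  have hsub : (T : Set V) ∪ (E ∩ L) ⊆ L \ {x} := by
    rintro y (hy | hy)
    · exact ⟨hTL hy, fun h => hxT (h ▸ hy)⟩
    · exact ⟨hy.2, fun h => hx.2 (h ▸ hy.1)⟩
  have hx2 : x ∈ Submodule.span k ((T : Set V) ∪ (E ∩ L)) := by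
    rw [htop]
    trivial
  have h3 := linearIndepOn_iff_notMem_span.1 hL.1 x hx.1
  rw [Set.image_id] at h3
  exact h3 (Submodule.span_mono hsub hx2)

/-- A generalized flag which is weakly compatible with the basis is compatible with a basis
obtained from it by changing only vectors of a finite-dimensional space. -/
theorem IsWeaklyCompatible.exists_isAdapted {adm : Set V → Prop}
    (hadm : ∀ L, adm L → IsBasisSet k L) {F : Set (Submodule k V)}
    (h : IsWeaklyCompatible adm (Set.range e) F) : ∃ B : Finset κ, IsAdapted e adm F B := by
  classical
  obtain ⟨L, hL, hF, hfin⟩ := h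
  have hfin2 := (hadm L hL).finite_diff (isBasisSet_range e) hfin
  obtain ⟨B, hB⟩ := exists_finset_mem_spanOf (e := e) (hfin.union hfin2)
  refine ⟨B, L, hL, hF, fun b hb => ?_, fun x hx => ?_⟩
  · by_contra hbL
    exact hb (basis_mem_spanOf_iff.1 (hB _ (Or.inl ⟨⟨b, rfl⟩, fun h => hbL h.2⟩)))
  · by_cases hxE : x ∈ Set.range e
    · obtain ⟨b, rfl⟩ := hxE
      by_cases hb : b ∈ B
      · exact Or.inl (basis_mem_spanOf_iff.2 hb)
      · exact Or.inr ⟨b, hb, rfl⟩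
    · exact Or.inl (hB _ (Or.inr ⟨hx, hxE⟩))

end Compatibility

/-! ### Split subspaces and local automorphisms. -/

section Splitting

variable {k : Type u} [Field k] {V : Type v} [AddCommGroup V] [Module k V] {κ : Type}
  {e : Module.Basis κ k V} {B B' : Finset κ}

variable (e B) in
/-- The projection of `V` onto `V_B`. -/
noncomputable def projOf : V →ₗ[k] V := ∑ b ∈ B, (e.coord b).smulRight (e b)

theorem projOf_mem (x : V) : projOf e B x ∈ spanOf e B := by
  rw [projOf, LinearMap.sum_apply]
  exact Submodule.sum_mem _ fun b hb => Submodule.smul_mem _ _ (basis_mem_spanOf_iff.2 hb)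

theorem repr_projOf_of_mem (x : V) {b : κ} (hb : b ∈ B) :
    e.repr (projOf e B x) b = e.repr x b := by
  classical
  simp only [projOf, LinearMap.sum_apply, LinearMap.smulRight_apply, map_sum, map_smul,
    Module.Basis.coord_apply, Module.Basis.repr_self, Finsupp.coe_finsetSum, Finset.sum_apply,
    Finsupp.smul_single, smul_eq_mul, mul_one, Finsupp.single_apply]
  rw [Finset.sum_ite_eq' B b, if_pos hb]

theorem projOf_of_mem {x : V} (hx : x ∈ spanOf e B) : projOf e B x = x :=
  ext_of_mem_spanOf e (projOf_mem x) hx fun b => repr_projOf_of_mem x b.2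

theorem projOf_eq_zero {x : V} (hx : ∀ b ∈ B, e.repr x b = 0) : projOf e B x = 0 :=
  ext_of_mem_spanOf e (projOf_mem x) (Submodule.zero_mem _) fun b => by
    rw [repr_projOf_of_mem x b.2, hx b b.2]
    simp

theorem sub_projOf_mem {x : V} {T : Set κ} (h : ∀ b, b ∉ B → e.repr x b ≠ 0 → b ∈ T) :
    x - projOf e B x ∈ Submodule.span k (e '' T) := by
  rw [Module.Basis.mem_span_image]
  intro b hb
  have hb : e.repr (x - projOf e B x) b ≠ 0 := Finsupp.mem_support_iff.1 hb
  by_cases hbB : b ∈ B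
  · simp [repr_projOf_of_mem x hbB] at hb
  · refine h b hbB ?_
    rwa [map_sub, Finsupp.sub_apply, (mem_spanOf_iff e).1 (projOf_mem x) b hbB, sub_zero] at hb

theorem mem_sup_span_iff {C : Submodule k V} (hC : C ≤ spanOf e B) {T : Set κ}
    (hT : ∀ b ∈ T, b ∉ B) {x : V} :
    x ∈ C ⊔ Submodule.span k (e '' T) ↔
      projOf e B x ∈ C ∧ ∀ b, b ∉ B → e.repr x b ≠ 0 → b ∈ T := by
  constructor
  · intro h
    obtain ⟨y, hy, z, hz, rfl⟩ := Submodule.mem_sup.1 h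
    rw [Module.Basis.mem_span_image] at hz
    have hz' : ∀ b, e.repr z b ≠ 0 → b ∈ T := fun b hb => hz (Finsupp.mem_support_iff.2 hb)
    refine ⟨?_, fun b hb hne => ?_⟩
    · rw [map_add, projOf_of_mem (hC hy), projOf_eq_zero, add_zero]
      · exact hy
      · intro b hb
        by_contra hne
        exact hT b (hz' b hne) hb
    · rw [map_add, Finsupp.add_apply, (mem_spanOf_iff e).1 (hC hy) b hb, zero_add] at hne
      exact hz' b hne
  · rintro ⟨h1, h2⟩
    rw [← add_sub_cancel (projOf e B x) x]
    exact Submodule.add_mem_sup h1 (sub_projOf_mem h2)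

theorem IsSplit.sub_projOf_mem {A : Submodule k V} (hA : IsSplit e B A) {x : V} (hx : x ∈ A) :
    x - projOf e B x ∈ A := by
  have h : x - projOf e B x ∈ Submodule.span k (e '' {b | e b ∈ A}) :=
    IndFlag.sub_projOf_mem fun b hb hne => hA x hx b hb hne
  refine Submodule.span_le.2 ?_ h
  rintro _ ⟨b, hb, rfl⟩
  exact hb

theorem IsSplit.projOf_mem {A : Submodule k V} (hA : IsSplit e B A) {x : V} (hx : x ∈ A) :
    projOf e B x ∈ A := by
  have := A.sub_mem hx (hA.sub_projOf_mem hx)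
  rwa [sub_sub_cancel] at this

theorem IsSplit.eq_sup {A : Submodule k V} (hA : IsSplit e B A) :
    A = A ⊓ spanOf e B ⊔ Submodule.span k (e '' {b | b ∉ B ∧ e b ∈ A}) := by
  ext x
  rw [mem_sup_span_iff inf_le_right fun b hb => hb.1]
  constructor
  · exact fun hx => ⟨⟨hA.projOf_mem hx, IndFlag.projOf_mem x⟩, fun b hb hne => ⟨hb, hA x hx b hb hne⟩⟩
  · rintro ⟨h1, h2⟩
    rw [← add_sub_cancel (projOf e B x) x]
    refine A.add_mem h1.1 (Submodule.span_le.2 ?_ (IndFlag.sub_projOf_mem h2))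
    rintro _ ⟨b, hb, rfl⟩
    exact hb.2

/-- This is the decomposition that the transition map `extendFlag` imitates. -/
theorem IsSplit.inf_spanOf {A : Submodule k V} (hA : IsSplit e B A) (hB : B ⊆ B') :
    A ⊓ spanOf e B' =
      A ⊓ spanOf e B ⊔ Submodule.span k (e '' {b | b ∈ B' ∧ b ∉ B ∧ e b ∈ A}) := by
  apply le_antisymm
  · rintro x ⟨hx, hx'⟩
    rw [mem_sup_span_iff inf_le_right fun b hb => hb.2.1]
    refine ⟨⟨hA.projOf_mem hx, IndFlag.projOf_mem x⟩, fun b hb hne => ⟨?_, hb, hA x hx b hb hne⟩⟩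
    by_contra hb'
    exact hne ((mem_spanOf_iff e).1 hx' b hb')
  · refine sup_le (inf_le_inf_left _ (spanOf_mono hB)) (Submodule.span_le.2 ?_)
    rintro _ ⟨b, hb, rfl⟩
    exact ⟨hb.2.2, basis_mem_spanOf_iff.2 hb.1⟩

theorem finrank_sup_span {C : Submodule k V} (hC : C ≤ spanOf e B) {T : Set κ} (hT : T.Finite)
    (hTB : ∀ b ∈ T, b ∉ B) :
    Module.finrank k ↥(C ⊔ Submodule.span k (e '' T)) = Module.finrank k C + T.ncard := by
  have : FiniteDimensional k C := Submodule.finiteDimensional_of_le hC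
  have : FiniteDimensional k (Submodule.span k (e '' T)) :=
    FiniteDimensional.span_of_finite k (hT.image e)
  have h1 := Submodule.finrank_sup_add_finrank_inf_eq C (Submodule.span k (e '' T))
  have h2 : C ⊓ Submodule.span k (e '' T) = ⊥ := by
    rw [eq_bot_iff]
    rintro x ⟨hx, hx'⟩
    rw [SetLike.mem_coe, Module.Basis.mem_span_image] at hx'
    rw [Submodule.mem_bot, ← projOf_of_mem (hC hx)]
    refine projOf_eq_zero fun b hb => ?_
    by_contra hne
    exact hTB b (hx' (Finsupp.mem_support_iff.2 hne)) hb
  have h3 : Module.finrank k (Submodule.span k (e '' T)) = T.ncard := by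
    have := hT.fintype
    have hli : LinearIndependent k (fun b : T => e b) :=
      e.linearIndependent.comp _ Subtype.val_injective
    have h4 := finrank_span_eq_card hli
    have h5 : Set.range (fun b : T => e b) = e '' T := by
      rw [Set.image_eq_range]
    rw [h5] at h4
    rw [h4, ← Nat.card_eq_fintype_card, Nat.card_coe_set_eq]
  rw [h2, finrank_bot, add_zero, h3] at h1
  exact h1

theorem IsSplit.finrank_inf_spanOf {A : Submodule k V} (hA : IsSplit e B A) (hB : B ⊆ B') :
    Module.finrank k ↥(A ⊓ spanOf e B') = Module.finrank k ↥(A ⊓ spanOf e B) +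
      Set.ncard {b | b ∈ B' ∧ b ∉ B ∧ e b ∈ A} := by
  rw [hA.inf_spanOf hB]
  exact finrank_sup_span inf_le_right (B'.finite_toSet.subset fun b hb => hb.1) fun b hb => hb.2.1

/-- The automorphism `g` of `V` preserves `V_B` and fixes the basis vectors `e_b`, `b ∉ B`. -/
structure IsLocal (e : Module.Basis κ k V) (B : Finset κ) (g : V ≃ₗ[k] V) : Prop where
  fix : ∀ b, b ∉ B → g (e b) = e b
  map : (spanOf e B).map g.toLinearMap = spanOf e B

theorem IsLocal.symm {g : V ≃ₗ[k] V} (hg : IsLocal e B g) : IsLocal e B g.symm where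
  fix b hb := by rw [LinearEquiv.symm_apply_eq, hg.fix b hb]
  map := by
    conv_lhs => rw [← hg.map]
    rw [← Submodule.map_comp]
    simp

theorem IsLocal.trans {g h : V ≃ₗ[k] V} (hg : IsLocal e B g) (hh : IsLocal e B h) :
    IsLocal e B (g.trans h) where
  fix b hb := by rw [LinearEquiv.trans_apply, hg.fix b hb, hh.fix b hb]
  map := by
    have : (g.trans h).toLinearMap = h.toLinearMap ∘ₗ g.toLinearMap := rfl
    rw [this, Submodule.map_comp, hg.map, hh.map]

theorem spanOf_eq_sup (hB : B ⊆ B') :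
    spanOf e B' = spanOf e B ⊔ Submodule.span k (e '' {b | b ∈ B' ∧ b ∉ B}) := by
  -- The case in which the split subspace is all of `V`.
  have h := IsSplit.inf_spanOf (e := e) (A := ⊤) (fun _ _ _ _ _ => trivial) hB
  simpa using h

theorem IsLocal.map_span {g : V ≃ₗ[k] V} (hg : IsLocal e B g) {T : Set κ} (hT : ∀ b ∈ T, b ∉ B) :
    (Submodule.span k (e '' T)).map g.toLinearMap = Submodule.span k (e '' T) := by
  rw [Submodule.map_span, Set.image_image]
  congr 1
  exact Set.image_congr fun b hb => hg.fix b (hT b hb)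

theorem IsLocal.mono {g : V ≃ₗ[k] V} (hg : IsLocal e B g) (hB : B ⊆ B') : IsLocal e B' g where
  fix b hb := hg.fix b fun h => hb (hB h)
  map := by
    rw [spanOf_eq_sup hB, Submodule.map_sup, hg.map, hg.map_span fun b hb => hb.2]

theorem IsLocal.map_inf_spanOf {g : V ≃ₗ[k] V} (hg : IsLocal e B g) (A : Submodule k V) :
    A.map g.toLinearMap ⊓ spanOf e B = (A ⊓ spanOf e B).map g.toLinearMap := by
  rw [Submodule.map_inf _ g.injective, hg.map]

/-- A local automorphism moves only the part of `A` inside `V_B`, so the trace of the image on `V_B`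
determines the image. -/
theorem IsLocal.map_eq_sup {g : V ≃ₗ[k] V} (hg : IsLocal e B g) {A : Submodule k V}
    (hA : IsSplit e B A) : A.map g.toLinearMap = (A ⊓ spanOf e B).map g.toLinearMap ⊔
      Submodule.span k (e '' {b | b ∉ B ∧ e b ∈ A}) := by
  conv_lhs => rw [hA.eq_sup]
  rw [Submodule.map_sup, hg.map_span fun b hb => hb.1]

theorem isCompl_spanOf (B : Finset κ) :
    IsCompl (spanOf e B) (Submodule.span k (e '' {b | b ∉ B})) := by
  constructor
  · rw [disjoint_iff, eq_bot_iff]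
    rintro x ⟨hx, hx'⟩
    rw [SetLike.mem_coe, Module.Basis.mem_span_image] at hx'
    rw [Submodule.mem_bot, ← projOf_of_mem hx]
    refine projOf_eq_zero fun b hb => ?_
    by_contra hne
    exact hx' (Finsupp.mem_support_iff.2 hne) hb
  · rw [codisjoint_iff, eq_top_iff]
    rintro x -
    refine (mem_sup_span_iff le_rfl (T := {b | b ∉ B}) fun b hb => hb).2 ⟨projOf_mem x, fun b hb _ => hb⟩

/-- The extension of an automorphism of `V_B` by the identity. -/
theorem exists_isLocal_extension (g₀ : spanOf e B ≃ₗ[k] spanOf e B) :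
    ∃ g : V ≃ₗ[k] V, IsLocal e B g ∧ ∀ x : spanOf e B, g x = g₀ x := by
  let p := Submodule.prodEquivOfIsCompl _ _ (isCompl_spanOf (e := e) B)
  let g : V ≃ₗ[k] V := p.symm.trans ((g₀.prodCongr (LinearEquiv.refl _ _)).trans p)
  have h1 : ∀ x : spanOf e B, g x = g₀ x := by
    intro x
    have : p.symm (x : V) = (x, 0) := Submodule.prodEquivOfIsCompl_symm_apply_left _ _ _ x
    simp [g, this, p]
  refine ⟨g, ⟨fun b hb => ?_, ?_⟩, h1⟩
  · have : p.symm (e b) = (0, ⟨e b, Submodule.subset_span ⟨b, hb, rfl⟩⟩) :=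
      Submodule.prodEquivOfIsCompl_symm_apply_right _ _ _
        (⟨e b, Submodule.subset_span ⟨b, hb, rfl⟩⟩ : Submodule.span k (e '' {b | b ∉ B}))
    simp [g, this, p]
  · ext x
    constructor
    · rintro ⟨y, hy, rfl⟩
      have := h1 ⟨y, hy⟩
      change g y ∈ _
      rw [this]
      exact (g₀ _).2
    · intro hx
      refine ⟨g₀.symm ⟨x, hx⟩, (g₀.symm _).2, ?_⟩
      change g _ = x
      rw [h1, LinearEquiv.apply_symm_apply]

end Splitting

/-! ### Images of generalized flags under automorphisms. -/

section Transport

variable {k : Type u} [Field k] {V : Type v} [AddCommGroup V] [Module k V]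

/-- The image of a set of subspaces under an automorphism. -/
def mapFlag (g : V ≃ₗ[k] V) (F : Set (Submodule k V)) : Set (Submodule k V) :=
  Submodule.map g.toLinearMap '' F

theorem map_le_map_iff' (g : V ≃ₗ[k] V) {A C : Submodule k V} :
    A.map g.toLinearMap ≤ C.map g.toLinearMap ↔ A ≤ C :=
  Submodule.map_le_map_iff_of_injective g.injective A C

theorem map_lt_map_iff (g : V ≃ₗ[k] V) {A C : Submodule k V} :
    A.map g.toLinearMap < C.map g.toLinearMap ↔ A < C := by
  rw [lt_iff_le_not_ge, lt_iff_le_not_ge, map_le_map_iff', map_le_map_iff']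

theorem map_mem_mapFlag (g : V ≃ₗ[k] V) {F : Set (Submodule k V)} {A : Submodule k V} :
    A.map g.toLinearMap ∈ mapFlag g F ↔ A ∈ F :=
  (Submodule.map_injective_of_injective g.injective).mem_set_image

theorem mem_map_equiv (g : V ≃ₗ[k] V) {A : Submodule k V} {x : V} :
    x ∈ A.map g.toLinearMap ↔ g.symm x ∈ A :=
  Submodule.mem_map_equiv A

theorem ImmSucc.mapFlag_iff (g : V ≃ₗ[k] V) {F : Set (Submodule k V)} {A C : Submodule k V} :
    ImmSucc (mapFlag g F) (A.map g.toLinearMap) (C.map g.toLinearMap) ↔ ImmSucc F A C := by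
  simp only [ImmSucc, map_mem_mapFlag, map_lt_map_iff]
  refine and_congr_right fun _ => and_congr_right fun _ => and_congr_right fun _ => ?_
  constructor
  · intro h G hG
    have := h _ ((map_mem_mapFlag g).2 hG)
    rwa [map_lt_map_iff, map_lt_map_iff] at this
  · rintro h _ ⟨G, hG, rfl⟩
    rw [map_lt_map_iff, map_lt_map_iff]
    exact h G hG

theorem IsGeneralizedFlag.mapFlag {F : Set (Submodule k V)} (hF : IsGeneralizedFlag F)
    (g : V ≃ₗ[k] V) : IsGeneralizedFlag (mapFlag g F) where
  chain := by
    rintro _ ⟨A, hA, rfl⟩ _ ⟨C, hC, rfl⟩ hne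
    rcases hF.chain hA hC (fun h => hne (h ▸ rfl)) with h | h
    · exact Or.inl ((map_le_map_iff' g).2 h)
    · exact Or.inr ((map_le_map_iff' g).2 h)
  adjacent := by
    rintro _ ⟨A, hA, rfl⟩
    rcases hF.adjacent A hA with ⟨C, hC⟩ | ⟨C, hC⟩
    · exact Or.inl ⟨_, (ImmSucc.mapFlag_iff g).2 hC⟩
    · exact Or.inr ⟨_, (ImmSucc.mapFlag_iff g).2 hC⟩
  cover v := by
    rw [← g.symm.map_ne_zero_iff, hF.cover]
    constructor
    · rintro ⟨A, C, h, h1, h2⟩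
      exact ⟨_, _, (ImmSucc.mapFlag_iff g).2 h, (mem_map_equiv g).2 h1,
        fun h => h2 ((mem_map_equiv g).1 h)⟩
    · rintro ⟨_, _, h, h1, h2⟩
      obtain ⟨A, hA, rfl⟩ := h.1
      obtain ⟨C, hC, rfl⟩ := h.2.1
      exact ⟨A, C, (ImmSucc.mapFlag_iff g).1 h, (mem_map_equiv g).1 h1,
        fun h => h2 ((mem_map_equiv g).2 h)⟩

theorem SamePartition.mapFlag {C D : Set (Submodule k V)} (h : SamePartition C D)
    (g : V ≃ₗ[k] V) : SamePartition (mapFlag g C) (mapFlag g D) := by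
  intro v w
  simp only [IndFlag.mapFlag, Set.forall_mem_image, mem_map_equiv]
  exact h _ _

theorem IsCompatible.mapFlag {F : Set (Submodule k V)} {L : Set V} (h : IsCompatible F L)
    (g : V ≃ₗ[k] V) : IsCompatible (mapFlag g F) (g '' L) := by
  obtain ⟨r, hr, h1, h2, h3⟩ := h
  let ε : L ≃ (g '' L : Set V) := g.toEquiv.image L
  have hε : ∀ α : L, (ε α : V) = g α := fun α => rfl
  have hspan : ∀ α, spanBelow k (fun x y => r (ε.symm x) (ε.symm y)) (ε α) =
      (spanBelow k r α).map g.toLinearMap := by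
    intro α
    rw [spanBelow, spanBelow, Submodule.map_span]
    congr 1
    ext x
    constructor
    · rintro ⟨β, hβ, rfl⟩
      refine ⟨ε.symm β, ⟨ε.symm β, by simpa using hβ, rfl⟩, ?_⟩
      exact (hε _).symm.trans (by simp)
    · rintro ⟨_, ⟨β, hβ, rfl⟩, rfl⟩
      exact ⟨ε β, by simpa using hβ, hε β⟩
  refine ⟨fun x y => r (ε.symm x) (ε.symm y), ?_, ?_, h2.mapFlag g, ?_⟩
  · exact { irrefl := fun a => irrefl_of r _
            trans := fun a b c => hr.trans _ _ _
            incomp_trans := fun a b c => hr.incomp_trans _ _ _ }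
  · intro β
    obtain ⟨α, rfl⟩ := ε.surjective β
    rw [hspan, hε]
    obtain ⟨A, hA, hA1, hA2⟩ := h1 α
    refine ⟨_, (ImmSucc.mapFlag_iff g).2 hA, (mem_map_equiv g).2 ?_, fun h => hA2 ?_⟩
    · simpa using hA1
    · simpa using (mem_map_equiv g).1 h
  · have : Set.range (spanBelow k fun x y => r (ε.symm x) (ε.symm y)) =
        IndFlag.mapFlag g (Set.range (spanBelow k r)) := by
      rw [IndFlag.mapFlag, ← Set.range_comp]
      rw [← ε.surjective.range_comp]
      congr 1
      funext α
      exact hspan α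
    rw [this]
    exact h3.mapFlag g

theorem IsBasisSet.image {L : Set V} (hL : IsBasisSet k L) (g : V ≃ₗ[k] V) :
    IsBasisSet k (g '' L) := by
  have : g '' L = Set.range (hL.basis.map g) := by
    ext x
    simp
  rw [this]
  exact isBasisSet_range _

theorem IsAdapted.mapFlag {κ : Type} {e : Module.Basis κ k V} {B : Finset κ} {adm : Set V → Prop}
    {F : Set (Submodule k V)} (h : IsAdapted e adm F B) {g : V ≃ₗ[k] V} (hg : IsLocal e B g)
    (hadm : ∀ L, adm L → adm (g '' L)) : IsAdapted e adm (mapFlag g F) B := by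
  obtain ⟨L, hL, hF, h1, h2⟩ := h
  refine ⟨g '' L, hadm L hL, hF.mapFlag g, fun b hb => ⟨e b, h1 b hb, hg.fix b hb⟩, ?_⟩
  rintro _ ⟨x, hx, rfl⟩
  rcases h2 x hx with h | ⟨b, hb, rfl⟩
  · left
    rw [← hg.map]
    exact Submodule.mem_map_of_mem h
  · exact Or.inr ⟨b, hb, hg.fix b hb⟩

end Transport

/-! ### The ind-variety structure from transitivity. -/

section Core

variable {k : Type u} [Field k] {V : Type v} [AddCommGroup V] [Module k V] {κ : Type}
  {e : Module.Basis κ k V} {B B' : Finset κ} {F G H : Set (Submodule k V)}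

variable (e F B H) in
/-- The flag in `V` obtained from a flag `H` in `V_B` by adding to the member of `H` corresponding
to `A ∈ F` all vectors `e_b ∈ A`, `b ∉ B`. -/
def extendAll : Set (Submodule k V) :=
  {K | ∃ A ∈ F, ∃ C ∈ H, Module.finrank k C = Module.finrank k ↥(A ⊓ spanOf e B) ∧
    K = C ⊔ Submodule.span k (e '' {b | b ∉ B ∧ e b ∈ A})}

theorem extendFlag_eq : extendFlag e F B B' H =
    {K | ∃ A ∈ F, ∃ C ∈ H, Module.finrank k C = Module.finrank k ↥(A ⊓ spanOf e B) ∧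
      K = C ⊔ Submodule.span k (e '' {b | b ∈ B' ∧ b ∉ B ∧ e b ∈ A})} := by
  have : ∀ A : Submodule k V, {x | ∃ b ∈ B', b ∉ B ∧ e b ∈ A ∧ x = e b} =
      e '' {b | b ∈ B' ∧ b ∉ B ∧ e b ∈ A} := by
    intro A
    ext x
    constructor
    · rintro ⟨b, h1, h2, h3, rfl⟩
      exact ⟨b, ⟨h1, h2, h3⟩, rfl⟩
    · rintro ⟨b, ⟨h1, h2, h3⟩, rfl⟩
      exact ⟨b, h1, h2, h3, rfl⟩
  simp only [extendFlag, this]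

theorem finrank_map_equiv (g : V ≃ₗ[k] V) (A : Submodule k V) :
    Module.finrank k (A.map g.toLinearMap) = Module.finrank k A :=
  (g.submoduleMap A).finrank_eq.symm

theorem eq_map_of_finrank_eq {d : Finset ℕ} (hH : H ∈ FlFin e B d) {g : V ≃ₗ[k] V}
    {A C : Submodule k V} (hA : (A ⊓ spanOf e B).map g.toLinearMap ∈ H) (hC : C ∈ H)
    (h : Module.finrank k C = Module.finrank k ↥(A ⊓ spanOf e B)) :
    C = (A ⊓ spanOf e B).map g.toLinearMap :=
  FlFin.eq_of_finrank_eq hH hC hA (h.trans (finrank_map_equiv g _).symm)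

/-- A flag has only one member of each dimension, so the member matched with `A` is `g (A ∩ V_B)`;
adding the fixed vectors of `A` yields `g A`. Thus extended flags inherit the properties of `F`. -/
theorem extendAll_eq_mapFlag {d : Finset ℕ} (hH : H ∈ FlFin e B d) (hF : ∀ A ∈ F, IsSplit e B A)
    {g : V ≃ₗ[k] V} (hg : IsLocal e B g)
    (hgH : ∀ A ∈ F, (A ⊓ spanOf e B).map g.toLinearMap ∈ H) :
    extendAll e B F H = mapFlag g F := by
  ext K
  constructor
  · rintro ⟨A, hA, C, hC, hCA, rfl⟩
    refine ⟨A, hA, ?_⟩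
    rw [eq_map_of_finrank_eq hH (hgH A hA) hC hCA, hg.map_eq_sup (hF A hA)]
  · rintro ⟨A, hA, rfl⟩
    exact ⟨A, hA, _, hgH A hA, finrank_map_equiv g _, hg.map_eq_sup (hF A hA)⟩

theorem truncate_mapFlag {g : V ≃ₗ[k] V} (hg : IsLocal e B g) :
    truncate e B (mapFlag g F) = {K | ∃ A ∈ F, K = (A ⊓ spanOf e B).map g.toLinearMap} := by
  ext K
  constructor
  · rintro ⟨_, ⟨A, hA, rfl⟩, rfl⟩
    exact ⟨A, hA, hg.map_inf_spanOf A⟩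
  · rintro ⟨A, hA, rfl⟩
    exact ⟨_, ⟨A, hA, rfl⟩, (hg.map_inf_spanOf A).symm⟩

theorem flagType_mapFlag {g : V ≃ₗ[k] V} (hg : IsLocal e B g) :
    flagType e B (mapFlag g F) = flagType e B F := by
  classical
  ext i
  simp only [flagType, Finset.mem_filter]
  refine and_congr_right fun _ => ?_
  constructor
  · rintro ⟨_, ⟨A, hA, rfl⟩, h⟩
    refine ⟨A, hA, ?_⟩
    rw [hg.map_inf_spanOf, finrank_map_equiv] at h
    exact h
  · rintro ⟨A, hA, h⟩
    refine ⟨_, ⟨A, hA, rfl⟩, ?_⟩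
    rw [hg.map_inf_spanOf, finrank_map_equiv]
    exact h

theorem truncate_eq_of_map_mem (hH : H ∈ FlFin e B (flagType e B F)) {g : V ≃ₗ[k] V}
    (hg : IsLocal e B g) (hgH : ∀ A ∈ F, (A ⊓ spanOf e B).map g.toLinearMap ∈ H) :
    truncate e B (mapFlag g F) = H := by
  classical
  rw [truncate_mapFlag hg]
  ext K
  constructor
  · rintro ⟨A, hA, rfl⟩
    exact hgH A hA
  · intro hK
    obtain ⟨A, hA, h⟩ := (Finset.mem_filter.1 (FlFin.finrank_mem hH hK)).2
    exact ⟨A, hA, eq_map_of_finrank_eq hH (hgH A hA) hK h.symm⟩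

theorem extendFlag_eq_truncate (hH : H ∈ FlFin e B (flagType e B F)) (hB : B ⊆ B')
    (hF : ∀ A ∈ F, IsSplit e B A) {g : V ≃ₗ[k] V} (hg : IsLocal e B g)
    (hgH : ∀ A ∈ F, (A ⊓ spanOf e B).map g.toLinearMap ∈ H) :
    extendFlag e F B B' H = truncate e B' (mapFlag g F) := by
  rw [truncate_mapFlag (hg.mono hB), extendFlag_eq]
  have key : ∀ A ∈ F, (A ⊓ spanOf e B').map g.toLinearMap = (A ⊓ spanOf e B).map g.toLinearMap ⊔
      Submodule.span k (e '' {b | b ∈ B' ∧ b ∉ B ∧ e b ∈ A}) := by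
    intro A hA
    rw [(hF A hA).inf_spanOf hB, Submodule.map_sup, hg.map_span fun b hb => hb.2.1]
  ext K
  constructor
  · rintro ⟨A, hA, C, hC, h, rfl⟩
    refine ⟨A, hA, ?_⟩
    rw [key A hA, eq_map_of_finrank_eq hH (hgH A hA) hC h]
  · rintro ⟨A, hA, rfl⟩
    exact ⟨A, hA, _, hgH A hA, finrank_map_equiv g _, key A hA⟩

/-- By the modular law, `dim ((D + U) ∩ W) + dim (D ∩ U) = dim (D ∩ W) + dim U`, and `A + U = C +
U`. Hence the subspace in the definition of commensurability may be enlarged to any `V_m` containing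
it. -/
theorem finrank_eq_of_commensurable {A C U W : Submodule k V} [FiniteDimensional k W]
    (hU : U ≤ W) (h1 : A ≤ C ⊔ U) (h2 : C ≤ A ⊔ U)
    (h3 : Module.finrank k ↥(A ⊓ U) = Module.finrank k ↥(C ⊓ U)) :
    Module.finrank k ↥(A ⊓ W) = Module.finrank k ↥(C ⊓ W) := by
  have hUfd : FiniteDimensional k U := Submodule.finiteDimensional_of_le hU
  have hfd : ∀ D : Submodule k V, FiniteDimensional k ↥(D ⊓ W) := fun D =>
    Submodule.finiteDimensional_of_le inf_le_right
  have key : ∀ D : Submodule k V, Module.finrank k ↥((D ⊔ U) ⊓ W) +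
      Module.finrank k ↥(D ⊓ U) = Module.finrank k ↥(D ⊓ W) + Module.finrank k U := by
    intro D
    have := hfd D
    have h := Submodule.finrank_sup_add_finrank_inf_eq (D ⊓ W) U
    rwa [inf_assoc, inf_eq_right.2 hU, sup_comm, ← sup_inf_assoc_of_le D hU, sup_comm U] at h
  have hsup : A ⊔ U = C ⊔ U :=
    le_antisymm (sup_le h1 le_sup_right) (sup_le h2 le_sup_right)
  have hA := key A
  have hC := key C
  rw [hsup, h3] at hA
  omega

variable {w : LinearMap.BilinForm k V}

/-- The conditions under which the generalized flags which are commensurable with a given one are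
an ind-variety. -/
theorem isIndVarietyOfFlags_of_transitive {S : ℕ → Finset κ} (hS : Monotone S)
    (hexh : ∀ B : Finset κ, ∃ m, B ⊆ S m) {adm : Set V → Prop}
    (hadm : ∀ L, adm L → IsBasisSet k L) {Iso : Set (Submodule k V) → Prop}
    (hadm_map : ∀ (g : V ≃ₗ[k] V), (∀ x y, w (g x) (g y) = w x y) → ∀ L, adm L → adm (g '' L))
    (hIso_map : ∀ (g : V ≃ₗ[k] V), (∀ x y, w (g x) (g y) = w x y) →
      ∀ G, Iso G → Iso (mapFlag g G))
    (R : ℕ → ℕ → ℕ → Prop)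
    (htrunc : ∀ G, IsGeneralizedFlag G → Iso G → ∀ m, IsAdapted e adm G (S m) →
      truncate e (S m) G ∈ FlRel e w (R m) (S m) (flagType e (S m) G))
    (hF : IsGeneralizedFlag F) (hFI : Iso F) (hFad : IsAdapted e adm F (S 0))
    (htrans : ∀ m, ∃ std : ℕ → Submodule k V,
      ∀ H ∈ FlRel e w (R m) (S m) (flagType e (S m) F), ∃ g : V ≃ₗ[k] V, IsLocal e (S m) g ∧
        (∀ x y, w (g x) (g y) = w x y) ∧
        ∀ C ∈ H, (std (Module.finrank k C)).map g.toLinearMap = C) :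
    IsIndVarietyOfFlags e S F
      {G | IsGeneralizedFlag G ∧ Iso G ∧ IsCommensurable adm (Set.range e) F G}
      (fun m => FlRel e w (R m) (S m) (flagType e (S m) F)) := by
  classical
  have had : ∀ m, IsAdapted e adm F (S m) := fun m => hFad.mono (hS (Nat.zero_le m))
  have hsplit : ∀ m, ∀ A ∈ F, IsSplit e (S m) A := fun m A hA => (had m).isSplit hadm hA
  have hloc : ∀ m, ∀ H ∈ FlRel e w (R m) (S m) (flagType e (S m) F), ∃ g : V ≃ₗ[k] V,
      IsLocal e (S m) g ∧ (∀ x y, w (g x) (g y) = w x y) ∧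
      ∀ A ∈ F, (A ⊓ spanOf e (S m)).map g.toLinearMap ∈ H := by
    intro m H hH
    obtain ⟨std, hstd⟩ := htrans m
    obtain ⟨g, hg, hgw, hgH⟩ := hstd H hH
    obtain ⟨f, hf, hfw, hfF⟩ := hstd _ (htrunc F hF hFI m (had m))
    -- Here `f` carries the standard flag to the trace of `F` and `g` carries it to `H`; the
    -- composite carries the trace of `F` to `H`.
    refine ⟨f.symm.trans g, hf.symm.trans hg, fun x y => ?_, fun A hA => ?_⟩
    · rw [LinearEquiv.trans_apply, LinearEquiv.trans_apply, hgw, ← hfw, f.apply_symm_apply,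
        f.apply_symm_apply]
    · obtain ⟨C, hC, hCA⟩ := FlFin.exists_finrank_eq hH.1
        (finrank_inf_spanOf_mem_flagType (B := S m) hA)
      have h1 := hfF _ ⟨A, hA, rfl⟩
      have h2 := hgH C hC
      rw [hCA] at h2
      have h3 : (A ⊓ spanOf e (S m)).map (f.symm.trans g).toLinearMap = C := by
        conv_lhs => rw [← h1]
        rw [← Submodule.map_comp, ← h2]
        congr 1
        ext x
        simp
      rwa [h3]
  have hmem : ∀ m, ∀ H ∈ FlRel e w (R m) (S m) (flagType e (S m) F), ∀ n, m ≤ n →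
      ∀ g : V ≃ₗ[k] V, IsLocal e (S m) g → (∀ x y, w (g x) (g y) = w x y) →
      truncate e (S n) (mapFlag g F) ∈ FlRel e w (R n) (S n) (flagType e (S n) F) := by
    intro m H hH n hmn g hg hgw
    have hg' := hg.mono (hS hmn)
    have := htrunc _ (hF.mapFlag g) (hIso_map g hgw F hFI) n
      ((had n).mapFlag hg' (hadm_map g hgw))
    rwa [flagType_mapFlag hg'] at this
  have hweak : ∀ m G, IsAdapted e adm G (S m) → IsWeaklyCompatible adm (Set.range e) G := by
    rintro m G ⟨L, hL, hLG, h1, -⟩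
    refine ⟨L, hL, hLG, ((S m).finite_toSet.image e).subset ?_⟩
    rintro _ ⟨⟨b, rfl⟩, hb⟩
    refine ⟨b, ?_, rfl⟩
    by_contra hbS
    exact hb ⟨⟨b, rfl⟩, h1 b hbS⟩
  refine isIndVarietyOfFlags_of_truncate w R (fun _ => rfl) (fun m => hS (Nat.le_succ m))
    hF.chain (fun m A hA => (hsplit m A hA).finrank_inf_spanOf (hS (Nat.le_succ m)))
    ?_ (fun m H => extendAll e (S m) F H) ?_ ?_ ?_ ?_
  · intro m H hH
    obtain ⟨g, hg, hgw, hgH⟩ := hloc m H hH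
    rw [extendFlag_eq_truncate hH.1 (hS (Nat.le_succ m)) (hsplit m) hg hgH]
    exact hmem m H hH _ (Nat.le_succ m) g hg hgw
  · intro m H hH
    obtain ⟨g, hg, hgw, hgH⟩ := hloc m H hH
    rw [extendAll_eq_mapFlag hH.1 (hsplit m) hg hgH]
    refine ⟨hF.mapFlag g, hIso_map g hgw F hFI, hweak m F (had m),
      hweak m _ ((had m).mapFlag hg (hadm_map g hgw)), ?_⟩
    let φ : F ≃o mapFlag g F :=
      { Equiv.Set.image _ F (Submodule.map_injective_of_injective g.injective) with
        map_rel_iff' := map_le_map_iff' g }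
    have hle : ∀ A ∈ F, A ≤ A.map g.toLinearMap ⊔ spanOf e (S m) ∧
        A.map g.toLinearMap ≤ A ⊔ spanOf e (S m) := by
      intro A hA
      have h1 := (hsplit m A hA).eq_sup
      have h2 := hg.map_eq_sup (hsplit m A hA)
      constructor
      · conv_lhs => rw [h1]
        rw [h2]
        exact sup_le (inf_le_right.trans le_sup_right) (le_sup_right.trans le_sup_left)
      · rw [h2]
        refine sup_le ?_ ?_
        · refine (Submodule.map_mono inf_le_right).trans ?_
          rw [hg.map]
          exact le_sup_right
        · conv_rhs => rw [h1]
          exact le_sup_right.trans le_sup_left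
    -- `V_m` serves as `U`: each `A` and `gA` contain the same basis vectors outside it, and `g`
    -- preserves it.
    refine ⟨φ, spanOf e (S m), inferInstance, fun A => ⟨(hle A A.2).1, (hle A A.2).2, ?_⟩⟩
    change _ = Module.finrank k ↥((A : Submodule k V).map g.toLinearMap ⊓ _)
    rw [hg.map_inf_spanOf, finrank_map_equiv]
  · intro m H hH
    obtain ⟨g, hg, hgw, hgH⟩ := hloc m H hH
    rw [extendAll_eq_mapFlag hH.1 (hsplit m) hg hgH]
    exact truncate_eq_of_map_mem hH.1 hg hgH
  · intro m H hH
    obtain ⟨g, hg, hgw, hgH⟩ := hloc m H hH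
    have hle := hS (Nat.le_succ m)
    have h1 := hmem m H hH _ (Nat.le_succ m) g hg hgw
    rw [extendAll_eq_mapFlag hH.1 (hsplit m) hg hgH,
      extendFlag_eq_truncate hH.1 hle (hsplit m) hg hgH]
    refine extendAll_eq_mapFlag h1.1 (hsplit (m + 1)) (hg.mono hle) fun A hA => ?_
    rw [truncate_mapFlag (hg.mono hle)]
    exact ⟨A, hA, rfl⟩
  -- Here `m` is taken so large that `V_m` contains `U` and `G` is adapted to it as well.
  · rintro G ⟨hG, hGI, -, hGw, φ, U, hUfd, hφ⟩
    obtain ⟨B₁, hB₁⟩ := hGw.exists_isAdapted hadm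
    obtain ⟨T, hT⟩ := (Submodule.fg_iff_finiteDimensional U).2 hUfd
    obtain ⟨B₂, hB₂⟩ := exists_finset_mem_spanOf (e := e) T.finite_toSet
    obtain ⟨m₀, hm₀⟩ := hexh (B₁ ∪ B₂)
    filter_upwards [Filter.eventually_ge_atTop m₀] with m hm
    have hm' := hm₀.trans (hS hm)
    have hGad : IsAdapted e adm G (S m) := hB₁.mono (Finset.union_subset_left hm')
    have hGsplit : ∀ A ∈ G, IsSplit e (S m) A := fun A hA => hGad.isSplit hadm hA
    have hU : U ≤ spanOf e (S m) := by
      rw [← hT, Submodule.span_le]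
      exact fun x hx => spanOf_mono (Finset.union_subset_right hm') (hB₂ x hx)
    have hdim : ∀ A : F, Module.finrank k ↥((A : Submodule k V) ⊓ spanOf e (S m)) =
        Module.finrank k ↥((φ A : Submodule k V) ⊓ spanOf e (S m)) := fun A =>
      finrank_eq_of_commensurable hU (hφ A).1 (hφ A).2.1 (hφ A).2.2
    -- Writing `e b = y + z` with `y ∈ C` and `z ∈ U`, the vector `z` has no `b`-coordinate. So that
    -- of `y` is 1, and splitness of `C` applies.
    have hmem_of : ∀ A C : Submodule k V, IsSplit e (S m) C → A ≤ C ⊔ U →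
        ∀ b, b ∉ S m → e b ∈ A → e b ∈ C := by
      intro A C hC hle b hb hbA
      obtain ⟨y, hy, z, hz, hyz⟩ := Submodule.mem_sup.1 (hle hbA)
      refine hC y hy b hb ?_
      have h1 : e.repr (e b) b = e.repr y b + e.repr z b := by
        rw [← hyz, map_add, Finsupp.add_apply]
      rw [(mem_spanOf_iff e).1 (hU hz) b hb, add_zero, Module.Basis.repr_self,
        Finsupp.single_eq_same] at h1
      rw [← h1]
      exact one_ne_zero
    have hset : ∀ A : F, {b | b ∉ S m ∧ e b ∈ (A : Submodule k V)} =
        {b | b ∉ S m ∧ e b ∈ (φ A : Submodule k V)} := by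
      intro A
      ext b
      exact and_congr_right fun hb => ⟨hmem_of _ _ (hGsplit _ (φ A).2) (hφ A).1 b hb,
        hmem_of _ _ (hsplit m _ A.2) (hφ A).2.1 b hb⟩
    have htype : flagType e (S m) G = flagType e (S m) F := by
      ext i
      simp only [flagType, Finset.mem_filter]
      refine and_congr_right fun _ => ⟨?_, ?_⟩
      · rintro ⟨A, hA, h⟩
        refine ⟨φ.symm ⟨A, hA⟩, (φ.symm ⟨A, hA⟩).2, ?_⟩
        rw [hdim, φ.apply_symm_apply]
        exact h
      · rintro ⟨A, hA, h⟩
        exact ⟨φ ⟨A, hA⟩, (φ ⟨A, hA⟩).2, by rw [← hdim]; exact h⟩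
    have ht := htrunc G hG hGI m hGad
    rw [htype] at ht
    refine ⟨ht, ?_⟩
    have hsum : ∀ A : F, (φ A : Submodule k V) = (φ A : Submodule k V) ⊓ spanOf e (S m) ⊔
        Submodule.span k (e '' {b | b ∉ S m ∧ e b ∈ (A : Submodule k V)}) := fun A => by
      rw [hset]
      exact (hGsplit _ (φ A).2).eq_sup
    ext K
    constructor
    · rintro ⟨A, hA, C, hC, h, rfl⟩
      have h2 : C = (φ ⟨A, hA⟩ : Submodule k V) ⊓ spanOf e (S m) :=
        FlFin.eq_of_finrank_eq ht.1 hC ⟨_, (φ ⟨A, hA⟩).2, rfl⟩ (h.trans (hdim ⟨A, hA⟩))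
      rw [h2, ← hsum ⟨A, hA⟩]
      exact (φ ⟨A, hA⟩).2
    · intro hK
      refine ⟨φ.symm ⟨K, hK⟩, (φ.symm ⟨K, hK⟩).2, K ⊓ spanOf e (S m), ⟨K, hK, rfl⟩, ?_, ?_⟩
      · rw [hdim, φ.apply_symm_apply]
      · have := hsum (φ.symm ⟨K, hK⟩)
        rwa [φ.apply_symm_apply] at this

theorem truncate_mem_flFin (hG : IsGeneralizedFlag G) :
    truncate e B G ∈ FlFin e B (flagType e B G) := by
  classical
  refine ⟨?_, ?_, ?_⟩
  · rintro _ ⟨A, hA, rfl⟩ _ ⟨C, hC, rfl⟩ hne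
    rcases hG.chain hA hC (fun h => hne (h ▸ rfl)) with h | h
    · exact Or.inl (inf_le_inf_right _ h)
    · exact Or.inr (inf_le_inf_right _ h)
  · rintro _ ⟨A, -, rfl⟩
    exact inf_le_right
  · ext i
    constructor
    · rintro ⟨_, ⟨A, hA, rfl⟩, rfl⟩
      exact finrank_inf_spanOf_mem_flagType hA
    · intro hi
      obtain ⟨A, hA, h⟩ := (Finset.mem_filter.1 (Finset.mem_coe.1 hi)).2
      exact ⟨_, ⟨A, hA, rfl⟩, h⟩

end Core

/-! ### Bases adapted to finite-dimensional flags. -/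

section AdaptedBases

variable {k : Type u} [Field k] {V : Type v} [AddCommGroup V] [Module k V]

/-- The hyperplane is the kernel of a nonzero linear form on `W` that vanishes on `C`. -/
theorem exists_hyperplane {C W : Submodule k V} [FiniteDimensional k W] (h : C < W) :
    ∃ W' : Submodule k V, C ≤ W' ∧ W' ≤ W ∧ Module.finrank k W = Module.finrank k W' + 1 := by
  have hlt : C.comap W.subtype < ⊤ := by
    rw [lt_top_iff_ne_top, Ne, Submodule.comap_subtype_eq_top]
    exact h.not_ge
  obtain ⟨f, hf, hle⟩ := Submodule.exists_le_ker_of_lt_top _ hlt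
  refine ⟨(LinearMap.ker f).map W.subtype, fun x hx => ?_, ?_, ?_⟩
  · exact ⟨⟨x, h.le hx⟩, hle (show (⟨x, h.le hx⟩ : W) ∈ C.comap W.subtype from hx), rfl⟩
  · exact Submodule.map_subtype_le _ _
  · rw [Submodule.finrank_map_subtype_eq, Module.Dual.finrank_ker_add_one_of_ne_zero hf]

/-- A chain of subspaces of a finite-dimensional space is compatible with some basis. -/
theorem exists_adapted_family (N : ℕ) (W : Submodule k V) [FiniteDimensional k W]
    (hN : Module.finrank k W = N) (H : Set (Submodule k V)) (hH : IsChain (· ≤ ·) H)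
    (hHW : ∀ C ∈ H, C ≤ W) :
    ∃ f : Fin N → V, LinearIndependent k f ∧ Submodule.span k (Set.range f) = W ∧
      ∀ C ∈ H, Submodule.span k (f '' {j | (j : ℕ) < Module.finrank k C}) = C := by
  classical
  induction N generalizing W H with
  | zero =>
    have hW : W = ⊥ := Submodule.finrank_eq_zero.1 hN
    subst hW
    refine ⟨Fin.elim0, linearIndependent_empty_type, by simp, fun C hC => ?_⟩
    rw [eq_bot_iff.2 (hHW C hC)]
    simp
  | succ N ih =>
    have hfd : ∀ C ∈ H, FiniteDimensional k C := fun C hC =>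
      Submodule.finiteDimensional_of_le (hHW C hC)
    -- `C₀` is the largest member other than `W`, or zero if there is none. Induction applies to a
    -- hyperplane containing it, and the last basis vector is any vector of `W` outside this
    -- hyperplane.
    obtain ⟨C₀, hC₀, hmax⟩ : ∃ C₀ < W, ∀ C ∈ H, C ≠ W → C ≤ C₀ := by
      by_cases hne : ∃ C ∈ H, C ≠ W
      · have hfin : ((fun C : Submodule k V => Module.finrank k C) '' {C | C ∈ H ∧ C ≠ W}).Finite := by
          refine (Set.finite_Iic (N + 1)).subset ?_
          rintro _ ⟨C, hC, rfl⟩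
          have := Submodule.finrank_mono (hHW C hC.1)
          rw [hN] at this
          exact this
        obtain ⟨C₁, h1⟩ := hne
        obtain ⟨C₀, hC₀, hmax⟩ := hfin.exists_maximalFor' _ _ ⟨C₁, h1⟩
        refine ⟨C₀, lt_of_le_of_ne (hHW _ hC₀.1) hC₀.2, fun C hC hCW => ?_⟩
        rcases eq_or_ne C C₀ with rfl | hne
        · exact le_rfl
        rcases hH hC hC₀.1 hne with h | h
        · exact h
        · have := hfd C hC
          exact (Submodule.eq_of_le_of_finrank_le h
            (hmax (show C ∈ {C | C ∈ H ∧ C ≠ W} from ⟨hC, hCW⟩) (Submodule.finrank_mono h))).ge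
      · push Not at hne
        refine ⟨⊥, ?_, fun C hC hCW => absurd (hne C hC) hCW⟩
        rw [bot_lt_iff_ne_bot]
        rintro rfl
        simp at hN
    obtain ⟨W', hCW', hW'W, hfr⟩ := exists_hyperplane hC₀
    have hN' : Module.finrank k W' = N := by omega
    have : FiniteDimensional k W' := Submodule.finiteDimensional_of_le hW'W
    obtain ⟨f, hf, hspan, hadapt⟩ := ih W' hN' {C | C ∈ H ∧ C ≠ W}
      (hH.mono fun C hC => hC.1) (fun C hC => (hmax C hC.1 hC.2).trans hCW')
    have hlt : W' < W := lt_of_le_of_ne hW'W (by rintro rfl; omega)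
    obtain ⟨x, hxW, hxW'⟩ := SetLike.exists_of_lt hlt
    have hli : LinearIndependent k (Fin.snoc (α := fun _ => V) f x) :=
      linearIndependent_finSnoc.2 ⟨hf, by rwa [hspan]⟩
    have hspan' : Submodule.span k (Set.range (Fin.snoc (α := fun _ => V) f x)) = W := by
      refine Submodule.eq_of_le_of_finrank_eq ?_ ?_
      · rw [Fin.range_snoc, Submodule.span_le]
        rintro y (rfl | hy)
        · exact hxW
        · exact hW'W (hspan ▸ Submodule.subset_span hy)
      · rw [finrank_span_eq_card hli, Fintype.card_fin, hN]
    refine ⟨Fin.snoc (α := fun _ => V) f x, hli, hspan', fun C hC => ?_⟩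
    by_cases hCW : C = W
    · subst hCW
      have : {j : Fin (N + 1) | (j : ℕ) < Module.finrank k C} = Set.univ :=
        Set.eq_univ_of_forall fun j => by
          change (j : ℕ) < _
          rw [hN]
          exact j.2
      rw [this, Set.image_univ, hspan']
    · have hle : Module.finrank k C ≤ N := by
        rw [← hN']
        exact Submodule.finrank_mono ((hmax C hC hCW).trans hCW')
      conv_rhs => rw [← hadapt C ⟨hC, hCW⟩]
      congr 1
      ext y
      constructor
      · rintro ⟨j, hj, rfl⟩
        have hj' : (j : ℕ) < Module.finrank k C := hj
        obtain ⟨i, rfl⟩ : ∃ i : Fin N, i.castSucc = j :=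
          ⟨⟨j, by omega⟩, rfl⟩
        rw [Fin.snoc_castSucc]
        exact ⟨i, hj', rfl⟩
      · rintro ⟨i, hi, rfl⟩
        exact ⟨i.castSucc, hi, Fin.snoc_castSucc (α := fun _ => V) x f i⟩

theorem exists_equiv_of_families {ι : Type*} {W : Submodule k V} {f f' : ι → V}
    (hf : LinearIndependent k f) (hspan : Submodule.span k (Set.range f) = W)
    (hf' : LinearIndependent k f') (hspan' : Submodule.span k (Set.range f') = W) :
    ∃ g : W ≃ₗ[k] W, ∀ i (h : f i ∈ W), (g ⟨f i, h⟩ : V) = f' i := by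
  let b := (Module.Basis.span hf).map (LinearEquiv.ofEq _ _ hspan)
  let b' := (Module.Basis.span hf').map (LinearEquiv.ofEq _ _ hspan')
  have hb : ∀ i, (b i : V) = f i := fun i => by simp [b, Module.Basis.span_apply]
  have hb' : ∀ i, (b' i : V) = f' i := fun i => by simp [b', Module.Basis.span_apply]
  refine ⟨b.equiv b' (Equiv.refl _), fun i h => ?_⟩
  have h1 : (⟨f i, h⟩ : W) = b i := Subtype.ext (hb i).symm
  rw [h1, Module.Basis.equiv_apply, Equiv.refl_apply, hb']

theorem finrank_spanOf {κ : Type} {e : Module.Basis κ k V} {B : Finset κ} :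
    Module.finrank k (spanOf e B) = B.card := by
  have := finrank_sup_span (e := e) (B := ∅) (C := ⊥) bot_le B.finite_toSet (fun b _ => by simp)
  rwa [bot_sup_eq, finrank_bot, zero_add, Set.ncard_coe_finset] at this

end AdaptedBases

/-! ### The case without a form. -/

section GeneralLinear

variable {k : Type u} [Field k] {V : Type v} [AddCommGroup V] [Module k V]

theorem flRel_false {κ : Type} {e : Module.Basis κ k V} {B : Finset κ} {d : Finset ℕ}
    (w : LinearMap.BilinForm k V) : FlRel e w (fun _ _ => False) B d = FlFin e B d :=
  Set.ext fun _ => ⟨fun h => h.1, fun h => ⟨h, fun _ _ _ _ h => h.elim⟩⟩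

/-- The first `N` basis vectors are sent to a basis adapted to `H`; the initial segments spanned by
them depend only on dimensions. -/
theorem exists_transitive_flFin (e : Module.Basis ℕ k V) (N : ℕ) (d : Finset ℕ) :
    ∃ std : ℕ → Submodule k V, ∀ H ∈ FlFin e (Finset.range N) d, ∃ g : V ≃ₗ[k] V,
      IsLocal e (Finset.range N) g ∧
        ∀ C ∈ H, (std (Module.finrank k C)).map g.toLinearMap = C := by
  refine ⟨fun i => Submodule.span k (e '' {j | j < i}), fun H hH => ?_⟩
  have hdim : Module.finrank k (spanOf e (Finset.range N)) = N := by
    rw [finrank_spanOf, Finset.card_range]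
  obtain ⟨f, hf, hspan, hadapt⟩ := exists_adapted_family N _ hdim H hH.1 hH.2.1
  have he : LinearIndependent k (fun j : Fin N => e j) :=
    e.linearIndependent.comp _ Fin.val_injective
  have hespan : Submodule.span k (Set.range fun j : Fin N => e j) = spanOf e (Finset.range N) := by
    rw [spanOf]
    congr 1
    ext x
    constructor
    · rintro ⟨j, rfl⟩
      exact ⟨j, by simp, rfl⟩
    · rintro ⟨j, hj, rfl⟩
      exact ⟨⟨j, by simpa using hj⟩, rfl⟩
  obtain ⟨g₀, hg₀⟩ := exists_equiv_of_families he hespan hf hspan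
  obtain ⟨g, hg, hgg₀⟩ := exists_isLocal_extension g₀
  have hge : ∀ j : Fin N, g (e j) = f j := by
    intro j
    have hmem : e j ∈ spanOf e (Finset.range N) := basis_mem_spanOf_iff.2 (by simp)
    rw [← hg₀ j hmem]
    exact hgg₀ ⟨e j, hmem⟩
  refine ⟨g, hg, fun C hC => ?_⟩
  conv_rhs => rw [← hadapt C hC]
  have hle : Module.finrank k C ≤ N := by
    rw [← hdim]
    exact Submodule.finrank_mono (hH.2.1 C hC)
  rw [Submodule.map_span]
  congr 1
  ext x
  constructor
  · rintro ⟨_, ⟨j, hj, rfl⟩, rfl⟩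
    exact ⟨⟨j, lt_of_lt_of_le hj hle⟩, hj, (hge ⟨j, lt_of_lt_of_le hj hle⟩).symm⟩
  · rintro ⟨j, hj, rfl⟩
    exact ⟨_, ⟨j, hj, rfl⟩, hge j⟩

theorem exists_isAdapted_range {e : Module.Basis ℕ k V} {F : Set (Submodule k V)}
    (h : IsWeaklyCompatible (IsBasisSet k) (Set.range e) F) :
    ∃ n, IsAdapted e (IsBasisSet k) F (Finset.range n) := by
  obtain ⟨B, hB⟩ := h.exists_isAdapted fun _ hL => hL
  obtain ⟨n, hn⟩ := B.exists_nat_subset_range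
  exact ⟨n, hB.mono hn⟩

/-- The general result for the zero form, of which every automorphism is an isometry, with no
orthogonality conditions. -/
theorem isIndVarietyOfFlags_fl {e : Module.Basis ℕ k V} {F : Set (Submodule k V)}
    (hF : IsGeneralizedFlag F) {n : ℕ}
    (hn : IsAdapted e (IsBasisSet k) F (Finset.range n)) :
    IsIndVarietyOfFlags e (fun m => Finset.range (n + m)) F (Fl F (Set.range e))
      (fun m => FlFin e (Finset.range (n + m)) (flagType e (Finset.range (n + m)) F)) := by
  have h1 : Fl F (Set.range e) = {G | IsGeneralizedFlag G ∧ True ∧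
      IsCommensurable (IsBasisSet k) (Set.range e) F G} := by
    simp only [true_and]
    rfl
  have h2 : (fun m => FlFin e (Finset.range (n + m)) (flagType e (Finset.range (n + m)) F)) =
      fun m => FlRel e 0 (fun _ _ => False) (Finset.range (n + m))
        (flagType e (Finset.range (n + m)) F) :=
    funext fun m => (flRel_false 0).symm
  rw [h1, h2]
  refine isIndVarietyOfFlags_of_transitive (S := fun m => Finset.range (n + m))
    (adm := IsBasisSet k) (Iso := fun _ => True) ?_ ?_ (fun _ h => h)
    (fun g _ L hL => hL.image g) (fun _ _ _ _ => trivial) (fun _ _ _ => False) ?_ hF trivial hn ?_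
  · exact fun a b hab => Finset.range_mono (by omega)
  · intro B
    obtain ⟨m, hm⟩ := B.exists_nat_subset_range
    exact ⟨m, hm.trans (Finset.range_mono (by omega))⟩
  · intro G hG _ m _
    rw [flRel_false]
    exact truncate_mem_flFin hG
  · intro m
    rw [flRel_false]
    obtain ⟨std, h⟩ := exists_transitive_flFin e (n + m)
      (flagType e (Finset.range (n + m)) F)
    refine ⟨std, fun H hH => ?_⟩
    obtain ⟨g, hg, hgH⟩ := h H hH
    exact ⟨g, hg, fun _ _ => rfl, hgH⟩

end GeneralLinear

/-! ### Orthogonal complements in a non-degenerate subspace. -/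

section FormOnSubspace

variable {k : Type u} [Field k] {V : Type v} [AddCommGroup V] [Module k V]
  {w : LinearMap.BilinForm k V} {W : Submodule k V}

theorem finrank_orthogonal_inf [FiniteDimensional k W] (hW : (w.restrict W).Nondegenerate) {A : Submodule k V}
    (hA : A ≤ W) :
    Module.finrank k ↥(w.orthogonal A ⊓ W) + Module.finrank k A = Module.finrank k W := by
  have h1 : (w.restrict W).orthogonal (A.comap W.subtype) = (w.orthogonal A).comap W.subtype := by
    ext x
    constructor
    · intro h y hy
      exact h ⟨y, hA hy⟩ hy
    · intro h y hy
      exact h y hy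
  have h2 := LinearMap.BilinForm.finrank_orthogonal hW (A.comap W.subtype)
  have h3 : ∀ C : Submodule k V, Module.finrank k (C.comap W.subtype) =
      Module.finrank k ↥(C ⊓ W) := by
    intro C
    rw [← Submodule.finrank_map_subtype_eq, Submodule.map_comap_subtype, inf_comm]
  have h4 := Submodule.finrank_mono hA
  rw [h1, h3, h3, inf_eq_left.2 hA] at h2
  omega

theorem le_orthogonal_orthogonal_inf (hw : w.IsRefl) {A : Submodule k V} (hA : A ≤ W) :
    A ≤ w.orthogonal (w.orthogonal A ⊓ W) ⊓ W :=
  fun x hx => ⟨fun y hy => hw x y (hy.1 x hx), hA hx⟩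

theorem orthogonal_orthogonal_inf [FiniteDimensional k W] (hw : w.IsRefl)
    (hW : (w.restrict W).Nondegenerate)
    {A : Submodule k V} (hA : A ≤ W) : w.orthogonal (w.orthogonal A ⊓ W) ⊓ W = A := by
  have h1 := finrank_orthogonal_inf hW hA
  have h2 := finrank_orthogonal_inf hW (A := w.orthogonal A ⊓ W) inf_le_right
  have : FiniteDimensional k ↥(w.orthogonal (w.orthogonal A ⊓ W) ⊓ W) :=
    Submodule.finiteDimensional_of_le inf_le_right
  exact (Submodule.eq_of_le_of_finrank_eq (le_orthogonal_orthogonal_inf hw hA) (by omega)).symm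

end FormOnSubspace

/-! ### Traces of isotropic generalized flags. -/

section IsotropicFlags

variable {k : Type u} [Field k] {V : Type v} [AddCommGroup V] [Module k V]
  {w : LinearMap.BilinForm k V} {κ : Type} {e : Module.Basis κ k V} {B : Finset κ}
  {d : Finset ℕ} {G H : Set (Submodule k V)}

/-- The component of a vector of `A` outside `V_B` is orthogonal to `V_B` and imposes no condition.
-/
theorem IsSplit.orthogonal_inf_spanOf (hperp : ∀ b, b ∉ B → ∀ x ∈ spanOf e B, w (e b) x = 0)
    {A : Submodule k V} (hA : IsSplit e B A) :
    w.orthogonal (A ⊓ spanOf e B) ⊓ spanOf e B = w.orthogonal A ⊓ spanOf e B := by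
  apply le_antisymm
  · rintro x ⟨hx, hxB⟩
    refine ⟨fun y hy => ?_, hxB⟩
    have h1 : w (projOf e B y) x = 0 := hx _ ⟨hA.projOf_mem hy, IndFlag.projOf_mem y⟩
    have h2 : y - projOf e B y ∈ LinearMap.ker (w.flip x) := by
      refine Submodule.span_le.2 ?_ (IndFlag.sub_projOf_mem (T := {b | b ∉ B}) fun b hb _ => hb)
      rintro _ ⟨b, hb, rfl⟩
      exact hperp b hb x hxB
    have h3 : w (y - projOf e B y) x = 0 := h2
    rw [map_sub, LinearMap.sub_apply, h1, sub_zero] at h3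
    exact h3
  · exact inf_le_inf_right _ (LinearMap.BilinForm.orthogonal_le inf_le_left)

/-- In an isotropic generalized flag, a member is an orthogonal complement of a member, or its
orthogonal complement is a member. -/
theorem IsIsotropic.orthogonal_mem_or (hw : w.IsRefl) (hG : IsGeneralizedFlag G)
    (h : IsIsotropic w G) {A : Submodule k V} (hA : A ∈ G) :
    w.orthogonal A ∈ G ∨ ∃ C ∈ G, A = w.orthogonal C := by
  obtain ⟨τ, hτ, hτG⟩ := h
  have hmem : ∀ C : G, (∃ C'', ImmSucc G C C'') → w.orthogonal (C : Submodule k V) ∈ G := by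
    intro C hC
    rw [← (hτG C hC).1]
    exact (τ C).2
  by_cases hsucc : ∃ A'', ImmSucc G A A''
  · exact Or.inl (hmem ⟨A, hA⟩ hsucc)
  right
  -- The candidate `C` is the predecessor `B'` of `A'^⊥`, where `A'` is the predecessor of `A`; `D`
  -- is the predecessor of `B'^⊥`.
  obtain ⟨A', hA'⟩ := (hG.adjacent A hA).resolve_left hsucc
  let a' : G := ⟨A', hA'.1⟩
  obtain ⟨ha', B', hB'⟩ := hτG a' ⟨A, hA'⟩
  let b' : G := ⟨B', hB'.1⟩
  obtain ⟨hb', D, hD⟩ := hτG b' ⟨_, hB'⟩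
  let δ : G := ⟨D, hD.1⟩
  refine ⟨B', hB'.1, ?_⟩
  have hchain : ∀ C₁ C₂ : Submodule k V, C₁ ∈ G → C₂ ∈ G → C₁ ≤ C₂ ∨ C₂ < C₁ := by
    intro C₁ C₂ h1 h2
    rcases eq_or_ne C₁ C₂ with rfl | hne
    · exact Or.inl le_rfl
    · exact (hG.chain h1 h2 hne).imp_right fun h => lt_of_le_of_ne h hne.symm
  have h1 : A' ≤ τ b' := by
    rw [hb']
    refine (LinearMap.BilinForm.le_orthogonal_orthogonal hw).trans
      (LinearMap.BilinForm.orthogonal_le ?_)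
    rw [← ha']
    exact hB'.2.2.1.le
  have h2 : A' ≠ τ b' := by
    intro h
    have h3 : τ a' = b' := by
      rw [show a' = τ b' from Subtype.ext h, hτ]
    have h4 := hB'.2.2.1
    rw [h3] at h4
    exact lt_irrefl _ h4
  -- `A'` lies strictly below `B'^⊥`, so its immediate successor `A` lies below it too.
  have h3 : A ≤ τ b' := by
    rcases hchain A (τ b') hA (τ b').2 with h | h
    · exact h
    · exact absurd ⟨lt_of_le_of_ne h1 h2, h⟩ (hA'.2.2.2 _ (τ b').2)
  rcases h3.eq_or_lt with h4 | h4
  · exact h4.trans hb'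
  -- If `A` is strictly smaller than `B'^⊥`, then `A ≤ D`, and `D^⊥` is squeezed between `B'` and
  -- its immediate successor `A'^⊥`. Equality with `B'` would give `τ b' = δ`, and equality with
  -- `A'^⊥` would give `D = A' < A`.
  exfalso
  have h5 : A ≤ D := by
    rcases hchain A D hA hD.1 with h | h
    · exact h
    · exact absurd ⟨h, h4⟩ (hD.2.2.2 A hA)
  have hδ := (hτG δ ⟨_, hD⟩).1
  have h6 : (τ δ : Submodule k V) ≤ τ a' := by
    rw [hδ, ha']
    exact LinearMap.BilinForm.orthogonal_le (hA'.2.2.1.le.trans h5)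
  have h7 : B' ≤ τ δ := by
    rw [hδ]
    refine (LinearMap.BilinForm.le_orthogonal_orthogonal hw).trans
      (LinearMap.BilinForm.orthogonal_le ?_)
    have := hD.2.2.1.le
    rwa [hb'] at this
  rcases h7.eq_or_lt with h8 | h8
  · have h9 : τ b' = δ := by
      rw [show b' = τ δ from Subtype.ext h8, hτ]
    have h10 := hD.2.2.1
    rw [h9] at h10
    exact lt_irrefl _ h10
  · rcases h6.eq_or_lt with h9 | h9
    · have h10 : δ = a' := hτ.injective (Subtype.ext h9)
      have h11 : D = A' := congrArg Subtype.val h10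
      rw [h11] at h5
      exact lt_irrefl _ (hA'.2.2.1.trans_le h5)
    · exact hB'.2.2.2 _ (τ δ).2 ⟨h8, h9⟩

/-- If the complement of `A` is a member, its trace is the required one by splitness. If `A` is the
complement of a member `C`, taking complements twice inside `V_B` returns the trace of `C`. -/
theorem orthogonal_inf_mem_truncate (hw : w.IsRefl) (hB : (w.restrict (spanOf e B)).Nondegenerate)
    (hperp : ∀ b, b ∉ B → ∀ x ∈ spanOf e B, w (e b) x = 0) (hG : IsGeneralizedFlag G)
    (hGw : IsIsotropic w G) (hsplit : ∀ A ∈ G, IsSplit e B A) {A : Submodule k V}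
    (hA : A ∈ truncate e B G) : w.orthogonal A ⊓ spanOf e B ∈ truncate e B G := by
  obtain ⟨A, hA, rfl⟩ := hA
  rcases hGw.orthogonal_mem_or hw hG hA with h | ⟨C, hC, rfl⟩
  · exact ⟨_, h, (hsplit A hA).orthogonal_inf_spanOf hperp⟩
  · refine ⟨C, hC, ?_⟩
    rw [← (hsplit C hC).orthogonal_inf_spanOf hperp, orthogonal_orthogonal_inf hw hB inf_le_right]

theorem truncate_mem_flIsoFin (hw : w.IsRefl) (hB : (w.restrict (spanOf e B)).Nondegenerate)
    (hperp : ∀ b, b ∉ B → ∀ x ∈ spanOf e B, w (e b) x = 0) (hG : IsGeneralizedFlag G)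
    (hGw : IsIsotropic w G) (hsplit : ∀ A ∈ G, IsSplit e B A) :
    truncate e B G ∈ FlIsoFin e w B (flagType e B G) :=
  ⟨truncate_mem_flFin hG, fun _ hA => orthogonal_inf_mem_truncate hw hB hperp hG hGw hsplit hA⟩

theorem FlIsoFin.finrank_orthogonal (hB : (w.restrict (spanOf e B)).Nondegenerate)
    (hH : H ∈ FlIsoFin e w B d) {A : Submodule k V} (hA : A ∈ H) :
    Module.finrank k ↥(w.orthogonal A ⊓ spanOf e B) + Module.finrank k A = B.card := by
  rw [finrank_orthogonal_inf hB (hH.1.2.1 A hA), finrank_spanOf]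

theorem FlIsoFin.subset_flRel (hB : (w.restrict (spanOf e B)).Nondegenerate) :
    FlIsoFin e w B d ⊆ FlRel e w (fun i j => i + j = B.card) B d := by
  intro H hH
  refine ⟨hH.1, fun A hA C hC h x hx y hy => ?_⟩
  have h1 := FlIsoFin.finrank_orthogonal hB hH hA
  have h2 : C = w.orthogonal A ⊓ spanOf e B :=
    FlFin.eq_of_finrank_eq hH.1 hC (hH.2 A hA) (by omega)
  rw [h2] at hy
  exact hy.1 x hx

/-- Replaces stability under complements by orthogonality of members of complementary dimensions, a
polynomial condition; a dimension count gives the converse. Non-emptiness makes `d` symmetric,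
without which the orthogonality condition could be vacuous. -/
theorem flIsoFin_eq_flRel (hB : (w.restrict (spanOf e B)).Nondegenerate)
    (hne : (FlIsoFin e w B d).Nonempty) :
    FlIsoFin e w B d = FlRel e w (fun i j => i + j = B.card) B d := by
  refine (FlIsoFin.subset_flRel hB).antisymm fun H hH => ⟨hH.1, fun A hA => ?_⟩
  obtain ⟨H', hH'⟩ := hne
  obtain ⟨A', hA', hd⟩ := FlFin.exists_finrank_eq hH'.1 (FlFin.finrank_mem hH.1 hA)
  have h1 := FlIsoFin.finrank_orthogonal hB hH' hA'
  obtain ⟨C, hC, hCd⟩ := FlFin.exists_finrank_eq hH.1 (FlFin.finrank_mem hH'.1 (hH'.2 A' hA'))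
  have h2 := finrank_orthogonal_inf hB (hH.1.2.1 A hA)
  rw [finrank_spanOf] at h2
  have h3 : C = w.orthogonal A ⊓ spanOf e B := by
    have : FiniteDimensional k ↥(w.orthogonal A ⊓ spanOf e B) :=
      Submodule.finiteDimensional_of_le inf_le_right
    refine Submodule.eq_of_le_of_finrank_eq (le_inf (fun y hy x hx => ?_) (hH.1.2.1 C hC))
      (by omega)
    exact hH.2 A hA C hC (by omega) x hx y hy
  rwa [← h3]

theorem orthogonal_map (g : V ≃ₗ[k] V) (hg : ∀ x y, w (g x) (g y) = w x y) (A : Submodule k V) :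
    w.orthogonal (A.map g.toLinearMap) = (w.orthogonal A).map g.toLinearMap := by
  ext x
  rw [mem_map_equiv]
  have : ∀ y, w y (g.symm x) = w (g y) x := fun y => by
    rw [← hg, g.apply_symm_apply]
  constructor
  · intro h y hy
    change w y _ = 0
    rw [this]
    exact h _ (Submodule.mem_map_of_mem hy)
  · rintro h _ ⟨y, hy, rfl⟩
    change w (g y) x = 0
    rw [← this]
    exact h y hy

theorem IsIsotropic.mapFlag (h : IsIsotropic w G) (g : V ≃ₗ[k] V)
    (hg : ∀ x y, w (g x) (g y) = w x y) : IsIsotropic w (mapFlag g G) := by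
  obtain ⟨τ, hτ, hτG⟩ := h
  let ε : G ≃ IndFlag.mapFlag g G :=
    Equiv.Set.image _ G (Submodule.map_injective_of_injective g.injective)
  have hε : ∀ A : G, (ε A : Submodule k V) = (A : Submodule k V).map g.toLinearMap := fun A => rfl
  refine ⟨fun A => ε (τ (ε.symm A)), fun A => by simp [hτ _], fun A hA => ?_⟩
  obtain ⟨A, rfl⟩ := ε.surjective A
  dsimp only
  rw [ε.symm_apply_apply, hε, hε, orthogonal_map g hg]
  obtain ⟨C, hC⟩ := hA
  obtain ⟨C, hCG, rfl⟩ := hC.2.1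
  rw [hε, ImmSucc.mapFlag_iff] at hC
  obtain ⟨h1, D, h2⟩ := hτG A ⟨C, hC⟩
  exact ⟨by rw [h1], _, (ImmSucc.mapFlag_iff g).2 h2⟩

theorem IsIsotropicBasisSet.image {L : Set V} (h : IsIsotropicBasisSet w L) (g : V ≃ₗ[k] V)
    (hg : ∀ x y, w (g x) (g y) = w x y) : IsIsotropicBasisSet w (g '' L) := by
  obtain ⟨ε, b, hb, rfl⟩ := h
  refine ⟨ε, b.map g, ?_, ?_⟩
  · exact
      { kind := hb.kind
        lower := fun i j => by simp only [Module.Basis.map_apply, hg, hb.lower]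
        upper := fun i j => by simp only [Module.Basis.map_apply, hg, hb.upper]
        pairing := fun i j => by simp only [Module.Basis.map_apply, hg, hb.pairing]
        zero_lower := fun z i => by simp only [Module.Basis.map_apply, hg, hb.zero_lower]
        zero_upper := fun z i => by simp only [Module.Basis.map_apply, hg, hb.zero_upper]
        zero_zero := fun z => by simp only [Module.Basis.map_apply, hg, hb.zero_zero] }
  · rw [← Set.range_comp]
    rfl

end IsotropicFlags

/-! ### Isotropic bases, Lagrangian subspaces and dual families. -/

section IsotropicBases

variable {k : Type u} [Field k] {V : Type v} [AddCommGroup V] [Module k V]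
  {w : LinearMap.BilinForm k V} {ε : ℕ} {e : Module.Basis ((ℕ ⊕ ℕ) ⊕ Fin ε) k V}

/-- The involution which interchanges the indices of `e_i` and `e^i`. -/
def dualIndex {ε : ℕ} : (ℕ ⊕ ℕ) ⊕ Fin ε → (ℕ ⊕ ℕ) ⊕ Fin ε
  | .inl (.inl i) => .inl (.inr i)
  | .inl (.inr i) => .inl (.inl i)
  | .inr z => .inr z

theorem dualIndex_dualIndex (b : (ℕ ⊕ ℕ) ⊕ Fin ε) : dualIndex (dualIndex b) = b := by
  rcases b with (i | i) | z <;> rfl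

theorem dualIndex_mem_isoSupport {n : ℕ} {b : (ℕ ⊕ ℕ) ⊕ Fin ε} :
    dualIndex b ∈ isoSupport ε n ↔ b ∈ isoSupport ε n := by
  rcases b with (i | i) | z <;> simp [dualIndex, isoSupport]

theorem card_isoSupport (n : ℕ) : (isoSupport ε n).card = 2 * n + ε := by
  simp [isoSupport, two_mul]

theorem IsBasisOfTypeBCD.le_one (hb : IsBasisOfTypeBCD w e) : ε ≤ 1 := by
  rcases hb.kind with ⟨-, h⟩ | ⟨-, h | h⟩ <;> omega

theorem IsBasisOfTypeBCD.exists_sign (hb : IsBasisOfTypeBCD w e) :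
    ∃ σ : k, σ * σ = 1 ∧ (∀ x y, w y x = σ * w x y) ∧ (ε = 0 ∨ σ = 1) := by
  rcases hb.kind with ⟨h, hε⟩ | ⟨h, -⟩
  · exact ⟨-1, by ring, fun x y => by rw [h y x]; ring, Or.inl hε⟩
  · exact ⟨1, by ring, fun x y => by rw [h y x]; ring, Or.inr rfl⟩

theorem IsBasisOfTypeBCD.isRefl (hb : IsBasisOfTypeBCD w e) : w.IsRefl := by
  obtain ⟨σ, -, h, -⟩ := hb.exists_sign
  intro x y hxy
  rw [h x y, hxy, mul_zero]

theorem IsBasisOfTypeBCD.apply_eq_zero (hb : IsBasisOfTypeBCD w e) {a b : (ℕ ⊕ ℕ) ⊕ Fin ε}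
    (h : b ≠ dualIndex a) : w (e a) (e b) = 0 := by
  have hr : ∀ x y, w x y = 0 → w y x = 0 := hb.isRefl
  rcases a with (i | i) | z <;> rcases b with (j | j) | z'
  · exact hb.lower i j
  · rw [hb.pairing, if_neg]
    rintro rfl
    exact h rfl
  · exact hr _ _ (hb.zero_lower _ _)
  · refine hr _ _ ?_
    rw [hb.pairing, if_neg]
    rintro rfl
    exact h rfl
  · exact hb.upper i j
  · exact hr _ _ (hb.zero_upper _ _)
  · exact hb.zero_lower _ _
  · exact hb.zero_upper _ _
  · have := hb.le_one
    exact absurd (congrArg Sum.inr (Fin.ext (by omega))) h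

theorem IsBasisOfTypeBCD.apply_ne_zero (hb : IsBasisOfTypeBCD w e) (a : (ℕ ⊕ ℕ) ⊕ Fin ε) :
    w (e a) (e (dualIndex a)) ≠ 0 := by
  have hr : ∀ x y, w x y = 0 → w y x = 0 := hb.isRefl
  rcases a with (i | i) | z
  · rw [dualIndex, hb.pairing, if_pos rfl]
    exact one_ne_zero
  · intro h
    have := hr _ _ h
    rw [dualIndex, hb.pairing, if_pos rfl] at this
    exact one_ne_zero this
  · rw [dualIndex, hb.zero_zero]
    exact one_ne_zero

/-- Pairing with the dual basis vector reads off a coordinate up to a nonzero factor; non-degeneracy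
on `V_n` and orthogonality of the remaining vectors to `V_n` follow. -/
theorem IsBasisOfTypeBCD.apply_dual_eq (hb : IsBasisOfTypeBCD w e) (x : V)
    (a : (ℕ ⊕ ℕ) ⊕ Fin ε) :
    w x (e (dualIndex a)) = e.repr x a * w (e a) (e (dualIndex a)) := by
  conv_lhs => rw [← e.linearCombination_repr x, Finsupp.linearCombination_apply, Finsupp.sum]
  rw [map_sum, LinearMap.sum_apply, Finset.sum_eq_single a]
  · rw [map_smul, LinearMap.smul_apply, smul_eq_mul]
  · intro b _ hba
    rw [map_smul, LinearMap.smul_apply, hb.apply_eq_zero, smul_zero]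
    intro h
    have := congrArg dualIndex h
    rw [dualIndex_dualIndex, dualIndex_dualIndex] at this
    exact hba this.symm
  · intro h
    rw [Finsupp.notMem_support_iff.1 h, zero_smul, map_zero, LinearMap.zero_apply]

theorem IsBasisOfTypeBCD.perp (hb : IsBasisOfTypeBCD w e) {n : ℕ} {b : (ℕ ⊕ ℕ) ⊕ Fin ε}
    (hbn : b ∉ isoSupport ε n) {x : V} (hx : x ∈ spanOf e (isoSupport ε n)) : w (e b) x = 0 := by
  refine hb.isRefl _ _ ?_
  rw [← dualIndex_dualIndex b, hb.apply_dual_eq, (mem_spanOf_iff e).1 hx, zero_mul]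
  rwa [dualIndex_mem_isoSupport]

theorem IsBasisOfTypeBCD.eq_zero_of_apply (hb : IsBasisOfTypeBCD w e) {x : V}
    (h : ∀ b, w x (e b) = 0) : x = 0 := by
  apply e.repr.injective
  ext a
  have := h (dualIndex a)
  rw [hb.apply_dual_eq] at this
  simpa using (mul_eq_zero.1 this).resolve_right (hb.apply_ne_zero a)

theorem IsBasisOfTypeBCD.restrict_nondegenerate (hb : IsBasisOfTypeBCD w e) (n : ℕ) :
    (w.restrict (spanOf e (isoSupport ε n))).Nondegenerate := by
  have key : ∀ x : spanOf e (isoSupport ε n),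
      (∀ y : spanOf e (isoSupport ε n), w x y = 0) → x = 0 := by
    intro x h
    refine Subtype.ext (hb.eq_zero_of_apply fun b => ?_)
    by_cases hbn : b ∈ isoSupport ε n
    · exact h ⟨e b, basis_mem_spanOf_iff.2 hbn⟩
    · exact hb.isRefl _ _ (hb.perp hbn x.2)
  exact ⟨key, fun y h => key y fun x => hb.isRefl _ _ (h x)⟩

/-! ### Isotropic subspaces -/

/-- `A` lies in its complement, so twice its dimension is at most `2n + ε`, where `ε ≤ 1`. -/
theorem IsBasisOfTypeBCD.finrank_le_of_isotropic (hb : IsBasisOfTypeBCD w e) {n : ℕ}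
    {A : Submodule k V} (hA : A ≤ spanOf e (isoSupport ε n))
    (hAw : ∀ x ∈ A, ∀ y ∈ A, w x y = 0) : Module.finrank k A ≤ n := by
  have h1 := finrank_orthogonal_inf (hb.restrict_nondegenerate n) hA
  rw [finrank_spanOf, card_isoSupport] at h1
  have : FiniteDimensional k ↥(w.orthogonal A ⊓ spanOf e (isoSupport ε n)) :=
    Submodule.finiteDimensional_of_le inf_le_right
  have h2 : Module.finrank k A ≤
      Module.finrank k ↥(w.orthogonal A ⊓ spanOf e (isoSupport ε n)) :=
    Submodule.finrank_mono fun x hx => ⟨fun y hy => hAw y hy x hx, hA hx⟩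
  have := hb.le_one
  omega

/-- With `Λ` the span of the `e_i` in `V_n`, the space `(Λ ∩ C^⊥) + C` is isotropic. As `Λ ∩ C^⊥` is
the complement of `Λ^⊥ + C`, a dimension count gives it dimension `n + dim (Λ^⊥ ∩ C) - dim (Λ ∩ C)`,
which is at least `n`. -/
theorem IsBasisOfTypeBCD.exists_lagrangian (hb : IsBasisOfTypeBCD w e) {n : ℕ}
    {C : Submodule k V} (hC : C ≤ spanOf e (isoSupport ε n))
    (hCw : ∀ x ∈ C, ∀ y ∈ C, w x y = 0) : ∃ M : Submodule k V, C ≤ M ∧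
      M ≤ spanOf e (isoSupport ε n) ∧ (∀ x ∈ M, ∀ y ∈ M, w x y = 0) ∧ Module.finrank k M = n := by
  have hnd := hb.restrict_nondegenerate n
  set W := spanOf e (isoSupport ε n) with hW
  have hw := hb.isRefl
  let T : Finset ((ℕ ⊕ ℕ) ⊕ Fin ε) :=
    ((Finset.range n).disjSum ∅).disjSum ∅
  have hTc : T.card = n := by simp [T]
  set Λ := spanOf e T with hΛ
  have hΛW : Λ ≤ W := spanOf_mono fun b hb => by
    rcases b with (i | i) | z <;> simp [T] at hb
    simpa [isoSupport] using hb
  have hΛw : ∀ x ∈ Λ, ∀ y ∈ Λ, w x y = 0 := by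
    intro x hx y hy
    have h1 : ∀ b ∈ T, w x (e b) = 0 := by
      intro b hbT
      obtain ⟨i, rfl⟩ : ∃ i, b = Sum.inl (Sum.inl i) := by
        rcases b with (i | i) | z <;> simp [T] at hbT
        exact ⟨i, rfl⟩
      have h2 := hb.apply_dual_eq x (Sum.inl (Sum.inr i))
      rw [(mem_spanOf_iff e).1 hx _ (by simp [T]), zero_mul] at h2
      exact h2
    have h2 : Λ ≤ LinearMap.ker (w x) := by
      rw [hΛ, spanOf, Submodule.span_le]
      rintro _ ⟨b, hbT, rfl⟩
      exact h1 b hbT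
    exact h2 hy
  have hfd : ∀ A : Submodule k V, A ≤ W → FiniteDimensional k A := fun A hA =>
    Submodule.finiteDimensional_of_le hA
  have hMW : Λ ⊓ w.orthogonal C ⊔ C ≤ W := sup_le (inf_le_left.trans hΛW) hC
  have hMw : ∀ x ∈ Λ ⊓ w.orthogonal C ⊔ C, ∀ y ∈ Λ ⊓ w.orthogonal C ⊔ C, w x y = 0 := by
    intro x hx y hy
    obtain ⟨x₁, hx₁, x₂, hx₂, rfl⟩ := Submodule.mem_sup.1 hx
    obtain ⟨y₁, hy₁, y₂, hy₂, rfl⟩ := Submodule.mem_sup.1 hy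
    have h1 : w x₂ y₁ = 0 := hy₁.2 _ hx₂
    have h2 : w x₁ y₂ = 0 := hw _ _ (hx₁.2 _ hy₂)
    simp only [map_add, LinearMap.add_apply, hΛw _ hx₁.1 _ hy₁.1, hCw _ hx₂ _ hy₂, h1, h2,
      add_zero]
  refine ⟨Λ ⊓ w.orthogonal C ⊔ C, le_sup_right, hMW, hMw, le_antisymm
    (hb.finrank_le_of_isotropic hMW hMw) ?_⟩
  have hD : w.orthogonal Λ ⊓ W ⊔ C ≤ W := sup_le inf_le_right hC
  have heq : w.orthogonal (w.orthogonal Λ ⊓ W ⊔ C) ⊓ W = Λ ⊓ w.orthogonal C := by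
    apply le_antisymm
    · rintro x ⟨hx, hxW⟩
      refine ⟨?_, fun y hy => hx y (Submodule.mem_sup_right hy)⟩
      rw [← orthogonal_orthogonal_inf hw hnd hΛW]
      exact ⟨fun y hy => hx y (Submodule.mem_sup_left hy), hxW⟩
    · rintro x ⟨hx, hxC⟩
      refine ⟨fun y hy => ?_, hΛW hx⟩
      obtain ⟨y₁, hy₁, y₂, hy₂, rfl⟩ := Submodule.mem_sup.1 hy
      have h1 : w y₁ x = 0 := hw _ _ (hy₁.1 x hx)
      have h2 : w y₂ x = 0 := hxC _ hy₂
      change w (y₁ + y₂) x = 0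
      rw [map_add, LinearMap.add_apply, h1, h2, add_zero]
  have i1 := hfd (w.orthogonal Λ ⊓ W) inf_le_right
  have i2 := hfd C hC
  have i3 := hfd (Λ ⊓ w.orthogonal C) (inf_le_left.trans hΛW)
  have i4 : FiniteDimensional k ↥(w.orthogonal Λ ⊓ W ⊓ C) :=
    Submodule.finiteDimensional_of_le inf_le_right
  have h1 := finrank_orthogonal_inf hnd hD
  have h2 := finrank_orthogonal_inf hnd hΛW
  have h3 := Submodule.finrank_sup_add_finrank_inf_eq (w.orthogonal Λ ⊓ W) C
  have h4 := Submodule.finrank_sup_add_finrank_inf_eq (Λ ⊓ w.orthogonal C) C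
  have h5 : Module.finrank k ↥(Λ ⊓ w.orthogonal C ⊓ C) ≤
      Module.finrank k ↥(w.orthogonal Λ ⊓ W ⊓ C) :=
    Submodule.finrank_mono fun x hx =>
      ⟨⟨fun y hy => hΛw y hy x hx.1.1, hC hx.2⟩, hx.2⟩
  have h6 : Module.finrank k Λ = n := by rw [hΛ, finrank_spanOf, hTc]
  rw [heq] at h1
  omega

variable {n : ℕ}

theorem IsBasisOfTypeBCD.exists_dual_family [CharZero k] (hb : IsBasisOfTypeBCD w e)
    {f : Fin n → V} (hf : LinearIndependent k f) (hfW : ∀ i, f i ∈ spanOf e (isoSupport ε n))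
    (hfw : ∀ i j, w (f i) (f j) = 0) :
    ∃ f' : Fin n → V, (∀ i, f' i ∈ spanOf e (isoSupport ε n)) ∧
      (∀ i j, w (f i) (f' j) = if i = j then 1 else 0) ∧ ∀ i j, w (f' i) (f' j) = 0 := by
  classical
  have hnd := hb.restrict_nondegenerate n
  set W := spanOf e (isoSupport ε n) with hW
  let T : W →ₗ[k] (Fin n → k) := LinearMap.pi fun i => (w (f i)).comp W.subtype
  have hspanW : Submodule.span k (Set.range f) ≤ W := by
    rw [Submodule.span_le]
    rintro _ ⟨i, rfl⟩
    exact hfW i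
  have hker : (LinearMap.ker T).map W.subtype =
      w.orthogonal (Submodule.span k (Set.range f)) ⊓ W := by
    ext x
    constructor
    · rintro ⟨y, hy, rfl⟩
      refine ⟨?_, y.2⟩
      have h1 : Submodule.span k (Set.range f) ≤ LinearMap.ker (w.flip y) := by
        rw [Submodule.span_le]
        rintro _ ⟨i, rfl⟩
        exact congrFun (LinearMap.mem_ker.1 hy) i
      exact fun z hz => h1 hz
    · rintro ⟨hx, hxW⟩
      refine ⟨⟨x, hxW⟩, ?_, rfl⟩
      exact LinearMap.mem_ker.2 (funext fun i => hx _ (Submodule.subset_span ⟨i, rfl⟩))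
  -- The kernel is the complement of the span of `f`, so the rank is `n` by non-degeneracy;
  -- preimages of the unit vectors are dual to `f`.
  have hsurj : Function.Surjective T := by
    rw [← LinearMap.range_eq_top]
    apply Submodule.eq_top_of_finrank_eq
    have h1 := LinearMap.finrank_range_add_finrank_ker T
    have h2 := finrank_orthogonal_inf hnd hspanW
    rw [← hker, Submodule.finrank_map_subtype_eq, finrank_span_eq_card hf,
      Fintype.card_fin] at h2
    rw [Module.finrank_fin_fun]
    omega
  choose h hh using fun j => hsurj (Pi.single j 1)
  have hfh : ∀ i j, w (f i) (h j) = if i = j then 1 else 0 := by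
    intro i j
    have h1 : w (f i) (h j) = T (h j) i := rfl
    rw [h1, hh, Pi.single_apply]
  obtain ⟨σ, hσ, hsym, -⟩ := hb.exists_sign
  -- Subtracting half of the Gram matrix of `h`, as a combination of the isotropic `f l`, kills the
  -- mutual products of the `h j` without changing their products with `f`. This requires 2 to be
  -- invertible.
  refine ⟨fun j => h j - (σ / 2) • ∑ l, w (h l) (h j) • f l, fun j => ?_, fun i j => ?_,
    fun i j => ?_⟩
  · exact W.sub_mem (h j).2 (W.smul_mem _ (W.sum_mem fun l _ => W.smul_mem _ (hfW l)))
  · simp only [map_sub, map_smul, map_sum, hfh, hfw, smul_zero, Finset.sum_const_zero, sub_zero]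
  · have hhf : ∀ i j, w (h i : V) (f j) = σ * if j = i then 1 else 0 := fun i j => by
      rw [hsym (f j) (h i), hfh]
    simp only [map_sub, map_smul, map_sum, LinearMap.sub_apply, LinearMap.smul_apply,
      LinearMap.sum_apply, hfh, hfw, hhf, smul_eq_mul, mul_ite, mul_one, mul_zero,
      Finset.sum_ite_eq', Finset.mem_univ, if_true, Finset.sum_const_zero,
      sub_zero]
    rw [hsym (h i) (h j)]
    linear_combination (-(1/2) * w (h i : V) (h j)) * hσ - (w (h i : V) (h j) / 2) * hσ

end IsotropicBases

/-! ### Witt-type transitivity on isotropic flags. -/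

section Witt

variable {k : Type u} [Field k] {V : Type v} [AddCommGroup V] [Module k V]
  {w : LinearMap.BilinForm k V}

theorem apply_eq_zero_of_mem_span {s t : Set V} (h : ∀ x ∈ s, ∀ y ∈ t, w x y = 0) {x y : V}
    (hx : x ∈ Submodule.span k s) (hy : y ∈ Submodule.span k t) : w x y = 0 := by
  have h1 : ∀ x ∈ s, w x y = 0 := fun x hx => by
    have : Submodule.span k t ≤ LinearMap.ker (w x) := Submodule.span_le.2 (h x hx)
    exact this hy
  have h2 : Submodule.span k s ≤ LinearMap.ker (w.flip y) := Submodule.span_le.2 h1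
  exact h2 hx

variable {ε : ℕ} {e : Module.Basis ((ℕ ⊕ ℕ) ⊕ Fin ε) k V} {n : ℕ}

/-- The Gram determinants of two families spanning the same space differ by a square. -/
theorem IsBasisOfTypeBCD.exists_mul_self_eq_prod (hb : IsBasisOfTypeBCD w e)
    {φ : (ℕ ⊕ ℕ) ⊕ Fin ε → V} {δ : (ℕ ⊕ ℕ) ⊕ Fin ε → k}
    (hφ : ∀ a ∈ isoSupport ε n, φ a ∈ spanOf e (isoSupport ε n))
    (hw : ∀ a ∈ isoSupport ε n, ∀ b ∈ isoSupport ε n, w (φ a) (φ b) = δ a * w (e a) (e b)) :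
    ∃ r : k, r * r = ∏ a ∈ isoSupport ε n, δ a := by
  classical
  let G : Matrix (isoSupport ε n) (isoSupport ε n) k := .of fun a b => w (e a) (e b)
  let P : Matrix (isoSupport ε n) (isoSupport ε n) k := .of fun a b => e.repr (φ a) b
  have hsum : ∀ a : isoSupport ε n, φ a = ∑ c : isoSupport ε n, P a c • e c := by
    intro a
    conv_lhs => rw [← e.linearCombination_repr (φ a), Finsupp.linearCombination_apply]
    rw [Finsupp.sum_of_support_subset _ (s := isoSupport ε n)]
    · exact (Finset.sum_coe_sort (isoSupport ε n) fun c => e.repr (φ a) c • e c).symm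
    · intro c hc
      by_contra hcn
      exact Finsupp.mem_support_iff.1 hc ((mem_spanOf_iff e).1 (hφ a a.2) c hcn)
    · intro c _
      exact zero_smul _ _
  -- Taking determinants, the square of `det P` is the product of the factors `δ a`, once `det G` is
  -- cancelled.
  have hPG : P * G * P.transpose = .of fun a b : isoSupport ε n => δ a * G a b := by
    ext a b
    change (P * G * P.transpose) a b = δ a * w (e a) (e b)
    rw [← hw a a.2 b b.2, hsum a, hsum b, Matrix.mul_apply]
    simp only [map_sum, map_smul, LinearMap.sum_apply, LinearMap.smul_apply, smul_eq_mul,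
      Matrix.mul_apply, Matrix.transpose_apply, Finset.sum_mul, Finset.mul_sum]
    refine Finset.sum_congr rfl fun c _ => Finset.sum_congr rfl fun d _ => ?_
    change P a d * w (e d) (e c) * P b c = P b c * (P a d * w (e d) (e c))
    ring
  -- Each row of `G` has exactly one nonzero entry, at the dual index.
  have hG : G.det ≠ 0 := by
    intro h0
    obtain ⟨v, hv, hGv⟩ := Matrix.exists_mulVec_eq_zero_iff.2 h0
    refine hv (funext fun a => ?_)
    let a' : isoSupport ε n := ⟨dualIndex a, dualIndex_mem_isoSupport.2 a.2⟩
    have h1 := congrFun hGv a'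
    rw [Matrix.mulVec, dotProduct, Finset.sum_eq_single a] at h1
    · refine (mul_eq_zero.1 h1).resolve_left ?_
      have h2 := hb.apply_ne_zero (dualIndex a)
      rwa [dualIndex_dualIndex] at h2
    · intro b _ hba
      have : G a' b = 0 := hb.apply_eq_zero fun h => hba (Subtype.ext (by
        rw [h, dualIndex_dualIndex]))
      rw [this, zero_mul]
    · exact fun h => absurd (Finset.mem_univ _) h
  refine ⟨P.det, mul_right_cancel₀ hG ?_⟩
  have h1 := congrArg Matrix.det hPG
  rw [Matrix.det_mul, Matrix.det_mul, Matrix.det_transpose, Matrix.det_mul_column] at h1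
  rw [← Finset.prod_coe_sort, ← h1]
  ring

/-- The family obtained from `e` by replacing the vectors with index in `isoSupport ε n`. -/
noncomputable def replaceFamily (e : Module.Basis ((ℕ ⊕ ℕ) ⊕ Fin ε) k V) (f f' : Fin n → V)
    (u : V) : (ℕ ⊕ ℕ) ⊕ Fin ε → V
  | .inl (.inl i) => if h : i < n then f ⟨i, h⟩ else e (.inl (.inl i))
  | .inl (.inr i) => if h : i < n then f' ⟨i, h⟩ else e (.inl (.inr i))
  | .inr _ => u

theorem replaceFamily_of_notMem {f f' : Fin n → V} {u : V} {b : (ℕ ⊕ ℕ) ⊕ Fin ε}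
    (hbn : b ∉ isoSupport ε n) : replaceFamily e f f' u b = e b := by
  rcases b with (i | i) | z
  · exact dif_neg fun h => hbn (by simpa [isoSupport] using h)
  · exact dif_neg fun h => hbn (by simpa [isoSupport] using h)
  · exact absurd (by simp [isoSupport]) hbn

theorem replaceFamily_mem {f f' : Fin n → V} {u : V}
    (hf : ∀ i, f i ∈ spanOf e (isoSupport ε n)) (hf' : ∀ i, f' i ∈ spanOf e (isoSupport ε n))
    (hu : u ∈ spanOf e (isoSupport ε n)) {b : (ℕ ⊕ ℕ) ⊕ Fin ε} (hbn : b ∈ isoSupport ε n) :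
    replaceFamily e f f' u b ∈ spanOf e (isoSupport ε n) := by
  rcases b with (i | i) | z
  · have hi : i < n := by simpa [isoSupport] using hbn
    simpa only [replaceFamily, dif_pos hi] using hf _
  · have hi : i < n := by simpa [isoSupport] using hbn
    simpa only [replaceFamily, dif_pos hi] using hf' _
  · exact hu

/-- Used with `q = 1` to build isometries and with unknown `q` to compare discriminants. The
hypothesis `huu` is stated as a function on `Fin ε` so that it is void when there is no vector
`e_0`. -/
theorem IsBasisOfTypeBCD.apply_replaceFamily (hb : IsBasisOfTypeBCD w e) {f f' : Fin n → V}
    {u : V} {q : k}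
    (hf : ∀ i, f i ∈ spanOf e (isoSupport ε n)) (hf' : ∀ i, f' i ∈ spanOf e (isoSupport ε n))
    (hu : u ∈ spanOf e (isoSupport ε n)) (hff : ∀ i j, w (f i) (f j) = 0)
    (hff' : ∀ i j, w (f i) (f' j) = if i = j then 1 else 0) (hf'f' : ∀ i j, w (f' i) (f' j) = 0)
    (huf : ∀ i, w u (f i) = 0) (huf' : ∀ i, w u (f' i) = 0) (huu : Fin ε → w u u = q)
    (a b : (ℕ ⊕ ℕ) ⊕ Fin ε) :
    w (replaceFamily e f f' u a) (replaceFamily e f f' u b) =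
      Sum.elim (fun _ => 1) (fun _ => q) a * w (e a) (e b) := by
  obtain ⟨σ, -, hσ, -⟩ := hb.exists_sign
  have hr : ∀ x y, w x y = 0 → w y x = 0 := hb.isRefl
  by_cases ha : a ∈ isoSupport ε n
  · by_cases hbn : b ∈ isoSupport ε n
    · rcases a with (i | i) | z <;> rcases b with (j | j) | z'
      · have hi : i < n := by simpa [isoSupport] using ha
        have hj : j < n := by simpa [isoSupport] using hbn
        simp only [replaceFamily, dif_pos hi, dif_pos hj, hff, hb.lower, mul_zero]
      · have hi : i < n := by simpa [isoSupport] using ha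
        have hj : j < n := by simpa [isoSupport] using hbn
        simp only [replaceFamily, dif_pos hi, dif_pos hj, hff', hb.pairing, Sum.elim_inl, one_mul,
          Fin.mk.injEq]
      · have hi : i < n := by simpa [isoSupport] using ha
        simp only [replaceFamily, dif_pos hi]
        rw [hr _ _ (huf _), hr _ _ (hb.zero_lower _ _), mul_zero]
      · have hi : i < n := by simpa [isoSupport] using ha
        have hj : j < n := by simpa [isoSupport] using hbn
        simp only [replaceFamily, dif_pos hi, dif_pos hj, Sum.elim_inl, one_mul]
        rw [hσ, hσ (e _), hff', hb.pairing]
        simp only [Fin.mk.injEq]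
      · have hi : i < n := by simpa [isoSupport] using ha
        have hj : j < n := by simpa [isoSupport] using hbn
        simp only [replaceFamily, dif_pos hi, dif_pos hj, hf'f', hb.upper, mul_zero]
      · have hi : i < n := by simpa [isoSupport] using ha
        simp only [replaceFamily, dif_pos hi]
        rw [hr _ _ (huf' _), hr _ _ (hb.zero_upper _ _), mul_zero]
      · have hj : j < n := by simpa [isoSupport] using hbn
        simp only [replaceFamily, dif_pos hj, huf, hb.zero_lower, mul_zero]
      · have hj : j < n := by simpa [isoSupport] using hbn
        simp only [replaceFamily, dif_pos hj, huf', hb.zero_upper, mul_zero]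
      · have := hb.le_one
        obtain rfl : z = z' := Fin.ext (by omega)
        simp only [replaceFamily, huu z, hb.zero_zero, Sum.elim_inr, mul_one]
    · rw [replaceFamily_of_notMem hbn, hr _ _ (hb.perp hbn (replaceFamily_mem hf hf' hu ha)),
        hr _ _ (hb.perp hbn (basis_mem_spanOf_iff.2 ha)), mul_zero]
  · rw [replaceFamily_of_notMem ha]
    have hδ : (Sum.elim (fun _ => 1) (fun _ => q) a : k) = 1 := by
      rcases a with a | z
      · rfl
      · exact absurd (by simp [isoSupport]) ha
    rw [hδ, one_mul]
    by_cases hbn : b ∈ isoSupport ε n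
    · rw [hb.perp ha (replaceFamily_mem hf hf' hu hbn),
        hb.perp ha (basis_mem_spanOf_iff.2 hbn)]
    · rw [replaceFamily_of_notMem hbn]

/-- In type `B`, the orthogonal complement in `V_n` of `n` hyperbolic pairs contains a vector `u` with
`w u u = 1`. -/
theorem IsBasisOfTypeBCD.exists_unit_orthogonal (hb : IsBasisOfTypeBCD w e) {f f' : Fin n → V}
    (hfi : LinearIndependent k f)
    (hf : ∀ i, f i ∈ spanOf e (isoSupport ε n)) (hf' : ∀ i, f' i ∈ spanOf e (isoSupport ε n))
    (hff : ∀ i j, w (f i) (f j) = 0)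
    (hff' : ∀ i j, w (f i) (f' j) = if i = j then 1 else 0)
    (hf'f' : ∀ i j, w (f' i) (f' j) = 0) :
    ∃ u ∈ spanOf e (isoSupport ε n), (∀ i, w u (f i) = 0) ∧ (∀ i, w u (f' i) = 0) ∧
      (Fin ε → w u u = 1) := by
  classical
  have hr : ∀ x y, w x y = 0 → w y x = 0 := hb.isRefl
  rcases Nat.eq_zero_or_pos ε with rfl | hε
  -- Without a vector `e_0` the condition `w u u = 1` is void, and zero will do.
  · exact ⟨0, Submodule.zero_mem _, fun i => by simp, fun i => by simp, fun z => z.elim0⟩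
  have hε1 : ε = 1 := by
    have := hb.le_one
    omega
  subst hε1
  have hK : Submodule.span k (Set.range (Sum.elim f f')) ≤ spanOf e (isoSupport 1 n) := by
    rw [Submodule.span_le]
    rintro _ ⟨i | i, rfl⟩
    · exact hf i
    · exact hf' i
  have h1 := finrank_orthogonal_inf (hb.restrict_nondegenerate n) hK
  have h2 := finrank_range_le_card (R := k) (Sum.elim f f')
  rw [Set.finrank, Fintype.card_sum, Fintype.card_fin] at h2
  rw [finrank_spanOf, card_isoSupport] at h1
  obtain ⟨u, hu, hu0⟩ := (Submodule.ne_bot_iff _).1 (show w.orthogonal (Submodule.span k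
    (Set.range (Sum.elim f f'))) ⊓ spanOf e (isoSupport 1 n) ≠ ⊥ by
      intro h
      rw [h, finrank_bot] at h1
      omega)
  have huf : ∀ i, w u (f i) = 0 := fun i => hr _ _ (hu.1 _ (Submodule.subset_span ⟨.inl i, rfl⟩))
  have huf' : ∀ i, w u (f' i) = 0 := fun i =>
    hr _ _ (hu.1 _ (Submodule.subset_span ⟨.inr i, rfl⟩))
  -- Otherwise `u` and the `f i` would span an isotropic space of dimension `n + 1`.
  have hq : w u u ≠ 0 := by
    intro h0
    have hnot : u ∉ Submodule.span k (Set.range f) := by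
      intro h
      obtain ⟨c, rfl⟩ := (Submodule.mem_span_range_iff_exists_fun k).1 h
      refine hu0 (Finset.sum_eq_zero fun j _ => ?_)
      have h3 := huf' j
      simp only [map_sum, map_smul, LinearMap.sum_apply, LinearMap.smul_apply, hff', smul_eq_mul,
        mul_ite, mul_one, mul_zero, Finset.sum_ite_eq', Finset.mem_univ, if_true] at h3
      rw [h3, zero_smul]
    have hli : LinearIndependent k (Fin.cons u f : Fin (n + 1) → V) :=
      linearIndependent_finCons.2 ⟨hfi, hnot⟩
    have h3 := hb.finrank_le_of_isotropic (n := n)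
      (A := Submodule.span k (Set.range (Fin.cons u f : Fin (n + 1) → V))) (by
        rw [Submodule.span_le]
        rintro _ ⟨i, rfl⟩
        refine Fin.cases ?_ (fun i => ?_) i
        · exact hu.2
        · exact hf i) (fun x hx y hy => by
        refine apply_eq_zero_of_mem_span ?_ hx hy
        rintro _ ⟨i, rfl⟩ _ ⟨j, rfl⟩
        refine Fin.cases ?_ (fun i => ?_) i <;> refine Fin.cases ?_ (fun j => ?_) j
        · exact h0
        · exact huf j
        · exact hr _ _ (huf i)
        · exact hff i j)
    rw [finrank_span_eq_card hli, Fintype.card_fin] at h3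
    omega
  -- The discriminants of the two families differ by the factor `w u u`, which is therefore a square
  -- in `k`. So `u` can be normalized over an arbitrary field `k`, without extracting roots.
  obtain ⟨r, hrq⟩ := hb.exists_mul_self_eq_prod
    (fun a ha => replaceFamily_mem hf hf' hu.2 ha)
    (fun a _ b _ => hb.apply_replaceFamily hf hf' hu.2 hff hff' hf'f' huf huf' (fun _ => rfl) a b)
  rw [isoSupport, Finset.prod_disjSum] at hrq
  simp only [Sum.elim_inl, Finset.prod_const_one, one_mul, Sum.elim_inr, Finset.univ_unique,
    Finset.prod_singleton] at hrq
  have hr0 : r ≠ 0 := by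
    rintro rfl
    exact hq (by rw [← hrq, mul_zero])
  refine ⟨r⁻¹ • u, Submodule.smul_mem _ _ hu.2, fun i => ?_, fun i => ?_, fun _ => ?_⟩
  · rw [map_smul, LinearMap.smul_apply, huf, smul_zero]
  · rw [map_smul, LinearMap.smul_apply, huf', smul_zero]
  · rw [map_smul, map_smul, LinearMap.smul_apply, ← hrq, smul_eq_mul, smul_eq_mul]
    field_simp

/-- An isometric family which differs from `e` only inside `V_n` defines an isometry of `V`. -/
theorem IsBasisOfTypeBCD.exists_isometry (hb : IsBasisOfTypeBCD w e)
    {φ : (ℕ ⊕ ℕ) ⊕ Fin ε → V} (hφ : ∀ a ∈ isoSupport ε n, φ a ∈ spanOf e (isoSupport ε n))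
    (hfix : ∀ a, a ∉ isoSupport ε n → φ a = e a)
    (hw : ∀ a b, w (φ a) (φ b) = w (e a) (e b)) :
    ∃ g : V ≃ₗ[k] V, IsLocal e (isoSupport ε n) g ∧ (∀ x y, w (g x) (g y) = w x y) ∧
      ∀ a, g (e a) = φ a := by
  let g := e.constr k φ
  have hg : ∀ a, g (e a) = φ a := fun a => e.constr_basis k φ a
  have hgw : ∀ x y, w (g x) (g y) = w x y := by
    have : w.compl₁₂ g g = w := e.ext fun a => e.ext fun b => by
      rw [LinearMap.compl₁₂_apply, hg, hg, hw]
    exact fun x y => LinearMap.congr_fun₂ this x y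
  -- A vector in the kernel is orthogonal to everything, as `g` preserves the form.
  have hinj : Function.Injective g := by
    rw [injective_iff_map_eq_zero]
    intro x hx
    refine hb.eq_zero_of_apply fun b => ?_
    rw [← hgw, hx, map_zero, LinearMap.zero_apply]
  have hmap : (spanOf e (isoSupport ε n)).map g = spanOf e (isoSupport ε n) := by
    refine Submodule.eq_of_le_of_finrank_eq ?_ ?_
    · rw [spanOf, Submodule.map_span, Submodule.span_le]
      rintro _ ⟨_, ⟨a, ha, rfl⟩, rfl⟩
      rw [hg]
      exact hφ a ha
    · exact (Submodule.equivMapOfInjective g hinj _).finrank_eq.symm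
  have hsurj : Function.Surjective g := by
    rw [← LinearMap.range_eq_top, eq_top_iff, ← e.span_eq, Submodule.span_le]
    rintro _ ⟨a, rfl⟩
    by_cases ha : a ∈ isoSupport ε n
    · have h1 : e a ∈ (spanOf e (isoSupport ε n)).map g := by
        rw [hmap]
        exact basis_mem_spanOf_iff.2 ha
      exact LinearMap.map_le_range h1
    · exact ⟨e a, by rw [hg, hfix a ha]⟩
  refine ⟨LinearEquiv.ofBijective g ⟨hinj, hsurj⟩, ⟨fun a ha => ?_, ?_⟩, hgw, hg⟩
  · exact (hg a).trans (hfix a ha)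
  · exact hmap

/-- Any two families of the same length spanning Lagrangian subspaces of `V_n` are conjugate. -/
theorem IsBasisOfTypeBCD.exists_isometry_of_lagrangian [CharZero k] (hb : IsBasisOfTypeBCD w e)
    {f : Fin n → V} (hfi : LinearIndependent k f)
    (hf : ∀ i, f i ∈ spanOf e (isoSupport ε n)) (hff : ∀ i j, w (f i) (f j) = 0) :
    ∃ g : V ≃ₗ[k] V, IsLocal e (isoSupport ε n) g ∧ (∀ x y, w (g x) (g y) = w x y) ∧
      ∀ i : Fin n, g (e (.inl (.inl (i : ℕ)))) = f i := by
  obtain ⟨f', hf', hff', hf'f'⟩ := hb.exists_dual_family hfi hf hff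
  obtain ⟨u, hu, huf, huf', huu⟩ := hb.exists_unit_orthogonal hfi hf hf' hff hff' hf'f'
  obtain ⟨g, hg, hgw, hge⟩ := hb.exists_isometry (n := n) (φ := replaceFamily e f f' u)
    (fun a ha => replaceFamily_mem hf hf' hu ha) (fun a ha => replaceFamily_of_notMem ha)
    (fun a b => by
      rw [hb.apply_replaceFamily hf hf' hu hff hff' hf'f' huf huf' huu]
      rcases a with a | z
      · exact one_mul _
      · exact one_mul _)
  refine ⟨g, hg, hgw, fun i => ?_⟩
  rw [hge, replaceFamily, dif_pos i.2]

/-- A member of dimension at most `n` is contained in its complement, which is a member of no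
smaller dimension. So the largest such member is isotropic; it extends to a Lagrangian subspace, in
which a basis adapted to all these members is chosen. -/
theorem IsBasisOfTypeBCD.exists_lagrangian_family (hb : IsBasisOfTypeBCD w e) {d : Finset ℕ}
    {H : Set (Submodule k V)} (hH : H ∈ FlIsoFin e w (isoSupport ε n) d) :
    ∃ f : Fin n → V, LinearIndependent k f ∧ (∀ i, f i ∈ spanOf e (isoSupport ε n)) ∧
      (∀ i j, w (f i) (f j) = 0) ∧ ∀ C ∈ H, Module.finrank k C ≤ n →
        Submodule.span k (f '' {j | (j : ℕ) < Module.finrank k C}) = C := by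
  have hiso : ∀ C ∈ H, Module.finrank k C ≤ n → ∀ x ∈ C, ∀ y ∈ C, w x y = 0 := by
    intro C hC hCn x hx y hy
    have h1 := FlIsoFin.finrank_orthogonal (hb.restrict_nondegenerate n) hH hC
    rw [card_isoSupport] at h1
    have h2 : C ≤ w.orthogonal C ⊓ spanOf e (isoSupport ε n) :=
      FlFin.le_of_finrank_le hH.1 hC (hH.2 C hC) (by omega)
    exact (h2 hy).1 x hx
  obtain ⟨C₀, hC₀W, hC₀, hmax⟩ : ∃ C₀ ≤ spanOf e (isoSupport ε n),
      (∀ x ∈ C₀, ∀ y ∈ C₀, w x y = 0) ∧ ∀ C ∈ H, Module.finrank k C ≤ n → C ≤ C₀ := by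
    by_cases hne : ∃ C ∈ H, Module.finrank k C ≤ n
    · have hfin : ((fun C : Submodule k V => Module.finrank k C) ''
          {C | C ∈ H ∧ Module.finrank k C ≤ n}).Finite := by
        refine (Set.finite_Iic n).subset ?_
        rintro _ ⟨C, hC, rfl⟩
        exact hC.2
      obtain ⟨C₁, h1⟩ := hne
      obtain ⟨C₀, hC₀, hmax⟩ := hfin.exists_maximalFor' _ _ ⟨C₁, h1⟩
      refine ⟨C₀, hH.1.2.1 _ hC₀.1, hiso _ hC₀.1 hC₀.2, fun C hC hCn => ?_⟩
      refine FlFin.le_of_finrank_le hH.1 hC hC₀.1 ?_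
      by_contra hlt
      exact hlt (hmax (show C ∈ {C | C ∈ H ∧ Module.finrank k C ≤ n} from ⟨hC, hCn⟩)
        (not_le.1 hlt).le)
    · exact ⟨⊥, bot_le, fun x hx y _ => by rw [(Submodule.mem_bot k).1 hx, map_zero,
        LinearMap.zero_apply], fun C hC hCn => absurd ⟨C, hC, hCn⟩ hne⟩
  obtain ⟨M, hCM, hMW, hMw, hMn⟩ := hb.exists_lagrangian hC₀W hC₀
  have : FiniteDimensional k M := Submodule.finiteDimensional_of_le hMW
  obtain ⟨f, hfi, hspan, hf⟩ := exists_adapted_family n M hMn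
    {C | C ∈ H ∧ Module.finrank k C ≤ n} (hH.1.1.mono fun C hC => hC.1)
    (fun C hC => (hmax C hC.1 hC.2).trans hCM)
  have hfM : ∀ i, f i ∈ M := fun i => hspan ▸ Submodule.subset_span ⟨i, rfl⟩
  exact ⟨f, hfi, fun i => hMW (hfM i), fun i j => hMw _ (hfM i) _ (hfM j),
    fun C hC hCn => hf C ⟨hC, hCn⟩⟩

/-- The standard flag of `V_n`: its members of dimension at most `n` are spanned by vectors `e_i`,
the others are orthogonal complements of such. -/
noncomputable def standardFlag (w : LinearMap.BilinForm k V)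
    (e : Module.Basis ((ℕ ⊕ ℕ) ⊕ Fin ε) k V) (n i : ℕ) : Submodule k V :=
  let L (i : ℕ) : Submodule k V :=
    Submodule.span k ((fun j : Fin n => e (.inl (.inl (j : ℕ)))) '' {j | (j : ℕ) < i})
  if i ≤ n then L i else w.orthogonal (L (2 * n + ε - i)) ⊓ spanOf e (isoSupport ε n)

/-- An isometry commutes with complements, so it suffices to match the members of dimension at most
`n`; each remaining one is the complement of such a member. -/
theorem IsBasisOfTypeBCD.exists_map_standardFlag [CharZero k] (hb : IsBasisOfTypeBCD w e)
    {d : Finset ℕ} {H : Set (Submodule k V)} (hH : H ∈ FlIsoFin e w (isoSupport ε n) d) :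
    ∃ g : V ≃ₗ[k] V, IsLocal e (isoSupport ε n) g ∧ (∀ x y, w (g x) (g y) = w x y) ∧
      ∀ C ∈ H, (standardFlag w e n (Module.finrank k C)).map g.toLinearMap = C := by
  obtain ⟨f, hfi, hf, hff, hfH⟩ := hb.exists_lagrangian_family hH
  obtain ⟨g, hg, hgw, hge⟩ := hb.exists_isometry_of_lagrangian hfi hf hff
  refine ⟨g, hg, hgw, fun C hC => ?_⟩
  have hL : ∀ i : ℕ, (Submodule.span k ((fun j : Fin n => e (.inl (.inl (j : ℕ)))) ''
      {j | (j : ℕ) < i})).map g.toLinearMap = Submodule.span k (f '' {j | (j : ℕ) < i}) := by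
    intro i
    rw [Submodule.map_span, ← Set.image_comp]
    congr 1
    exact Set.image_congr fun j _ => hge j
  rw [standardFlag]
  split_ifs with h
  · rw [hL, hfH C hC h]
  · have h1 := FlIsoFin.finrank_orthogonal (hb.restrict_nondegenerate n) hH hC
    rw [card_isoSupport] at h1
    have h2 := hb.le_one
    -- The complement has dimension `2n + ε - dim C`, at most `n` because `ε ≤ 1` and `dim C > n`.
    have h3 := hfH _ (hH.2 C hC) (by omega)
    rw [show 2 * n + ε - Module.finrank k C =
        Module.finrank k ↥(w.orthogonal C ⊓ spanOf e (isoSupport ε n)) by omega,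
      ← hg.map_inf_spanOf, ← orthogonal_map g hgw, hL, h3]
    exact orthogonal_orthogonal_inf hb.isRefl (hb.restrict_nondegenerate n) (hH.1.2.1 C hC)

end Witt

/-! ### The isotropic ind-variety. -/

section IsotropicCase

variable {k : Type u} [Field k] {V : Type v} [AddCommGroup V] [Module k V]
  {w : LinearMap.BilinForm k V} {ε : ℕ} {e : Module.Basis ((ℕ ⊕ ℕ) ⊕ Fin ε) k V}
  {F : Set (Submodule k V)}

theorem IsIsotropicBasisSet.isBasisSet {L : Set V} (h : IsIsotropicBasisSet w L) :
    IsBasisSet k L := by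
  obtain ⟨ε, b, -, rfl⟩ := h
  exact isBasisSet_range b

theorem isoSupport_mono : Monotone (isoSupport ε) := fun _ _ h =>
  Finset.disjSum_mono (Finset.disjSum_mono (Finset.range_mono h) (Finset.range_mono h)) le_rfl

theorem exists_subset_isoSupport (B : Finset ((ℕ ⊕ ℕ) ⊕ Fin ε)) : ∃ n, B ⊆ isoSupport ε n := by
  classical
  induction B using Finset.induction_on with
  | empty => exact ⟨0, Finset.empty_subset _⟩
  | insert b B _ ih =>
    obtain ⟨n, hn⟩ := ih
    obtain ⟨m, hm⟩ : ∃ m, b ∈ isoSupport ε m := by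
      rcases b with (i | i) | z
      · exact ⟨i + 1, by simp [isoSupport]⟩
      · exact ⟨i + 1, by simp [isoSupport]⟩
      · exact ⟨0, by simp [isoSupport]⟩
    exact ⟨max m n, Finset.insert_subset (isoSupport_mono (le_max_left m n) hm)
      (hn.trans (isoSupport_mono (le_max_right m n)))⟩

theorem exists_isAdapted_isoSupport
    (h : IsWeaklyCompatible (IsIsotropicBasisSet w) (Set.range e) F) :
    ∃ n, IsAdapted e (IsIsotropicBasisSet w) F (isoSupport ε n) := by
  obtain ⟨B, hB⟩ := h.exists_isAdapted fun _ hL => hL.isBasisSet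
  obtain ⟨n, hn⟩ := exists_subset_isoSupport B
  exact ⟨n, hB.mono hn⟩

theorem IsBasisOfTypeBCD.truncate_mem_flIsoFin (hb : IsBasisOfTypeBCD w e)
    (hF : IsGeneralizedFlag F) (hFw : IsIsotropic w F) {n : ℕ}
    (h : IsAdapted e (IsIsotropicBasisSet w) F (isoSupport ε n)) :
    truncate e (isoSupport ε n) F ∈
      FlIsoFin e w (isoSupport ε n) (flagType e (isoSupport ε n) F) :=
  IndFlag.truncate_mem_flIsoFin hb.isRefl (hb.restrict_nondegenerate n)
    (fun _ hbn _ hx => hb.perp hbn hx) hF hFw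
    fun _ hA => h.isSplit (fun _ hL => hL.isBasisSet) hA

theorem isIndVarietyOfFlags_flIso [CharZero k] (hb : IsBasisOfTypeBCD w e)
    (hF : IsGeneralizedFlag F) (hFw : IsIsotropic w F) {n : ℕ}
    (hn : IsAdapted e (IsIsotropicBasisSet w) F (isoSupport ε n)) :
    IsIndVarietyOfFlags e (fun m => isoSupport ε (n + m)) F (FlIso w F (Set.range e))
      (fun m => FlIsoFin e w (isoSupport ε (n + m))
        (flagType e (isoSupport ε (n + m)) F)) := by
  have hS : Monotone fun m => isoSupport ε (n + m) := fun a b hab =>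
    isoSupport_mono (Nat.add_le_add_left hab n)
  -- The trace of `F` itself supplies the non-emptiness needed to express isotropy by orthogonality
  -- relations.
  have heq : ∀ m, FlIsoFin e w (isoSupport ε (n + m)) (flagType e (isoSupport ε (n + m)) F) =
      FlRel e w (fun i j => i + j = (isoSupport ε (n + m)).card) (isoSupport ε (n + m))
        (flagType e (isoSupport ε (n + m)) F) := fun m =>
    flIsoFin_eq_flRel (hb.restrict_nondegenerate _)
      ⟨_, hb.truncate_mem_flIsoFin hF hFw (hn.mono (hS (Nat.zero_le m)))⟩
  rw [funext heq]
  refine isIndVarietyOfFlags_of_transitive (S := fun m => isoSupport ε (n + m))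
    (adm := IsIsotropicBasisSet w) (Iso := IsIsotropic w) hS (fun B => ?_)
    (fun _ hL => hL.isBasisSet) (fun g hg _ hL => hL.image g hg) (fun g hg _ h => h.mapFlag g hg)
    (fun m i j => i + j = (isoSupport ε (n + m)).card) (fun G hG hGw m hGm => ?_) hF hFw hn
    fun m => ⟨standardFlag w e (n + m), fun H hH => ?_⟩
  · obtain ⟨m, hm⟩ := exists_subset_isoSupport B
    exact ⟨m, hm.trans (isoSupport_mono (Nat.le_add_left m n))⟩
  · exact FlIsoFin.subset_flRel (hb.restrict_nondegenerate _)
      (hb.truncate_mem_flIsoFin hG hGw hGm)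
  · rw [← heq] at hH
    exact hb.exists_map_standardFlag hH

end IsotropicCase

end IndFlag

theorem proposition5 {k : Type u} [Field k] [CharZero k] {V : Type v} [AddCommGroup V]
    [Module k V] :
    -- the ind-variety `Fl(F, E)`, where `E = {e_n}` is a basis of `V`
    (∀ (e : Module.Basis ℕ k V) (F : Set (Submodule k V)),
      IndFlag.IsGeneralizedFlag F →
      IndFlag.IsWeaklyCompatible (IndFlag.IsBasisSet k) (Set.range e) F →
      (∃ n, IndFlag.IsAdapted e (IndFlag.IsBasisSet k) F (Finset.range n)) ∧
      ∀ n, IndFlag.IsAdapted e (IndFlag.IsBasisSet k) F (Finset.range n) →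
        IndFlag.IsIndVarietyOfFlags e (fun m => Finset.range (n + m)) F
          (IndFlag.Fl F (Set.range e))
          (fun m => IndFlag.FlFin e (Finset.range (n + m))
            (IndFlag.flagType e (Finset.range (n + m)) F))) ∧
    -- the ind-variety `Fl(F, w, E)`, where `E` is a `w`-isotropic basis of `V`
    (∀ (w : LinearMap.BilinForm k V) (ε : ℕ) (e : Module.Basis ((ℕ ⊕ ℕ) ⊕ Fin ε) k V)
      (F : Set (Submodule k V)),
      w.Nondegenerate →
      ((∀ x y, w x y = w y x) ∨ (∀ x y, w x y = - w y x)) →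
      IndFlag.IsBasisOfTypeBCD w e →
      IndFlag.IsGeneralizedFlag F →
      IndFlag.IsIsotropic w F →
      IndFlag.IsWeaklyCompatible (IndFlag.IsIsotropicBasisSet w) (Set.range e) F →
      (∃ n, IndFlag.IsAdapted e (IndFlag.IsIsotropicBasisSet w) F (IndFlag.isoSupport ε n)) ∧
      ∀ n, IndFlag.IsAdapted e (IndFlag.IsIsotropicBasisSet w) F (IndFlag.isoSupport ε n) →
        IndFlag.IsIndVarietyOfFlags e (fun m => IndFlag.isoSupport ε (n + m)) F
          (IndFlag.FlIso w F (Set.range e))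
          (fun m => IndFlag.FlIsoFin e w (IndFlag.isoSupport ε (n + m))
            (IndFlag.flagType e (IndFlag.isoSupport ε (n + m)) F))) := by
  refine ⟨fun e F hF hFE => ⟨IndFlag.exists_isAdapted_range hFE, fun n hn =>
    IndFlag.isIndVarietyOfFlags_fl hF hn⟩, fun w ε e F _ _ hb hF hFw hFE =>
    ⟨IndFlag.exists_isAdapted_isoSupport hFE, fun n hn =>
      IndFlag.isIndVarietyOfFlags_flIso hb hF hFw hn⟩⟩
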